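/- Setting. Let $M$ be a smooth manifold (without boundary, Hausdorff, second countable; neither connectedness nor the bracket-generating condition is needed) with a sub-Riemannian structure $(H,g_H)$: $H\subseteq TM$ is a smooth subbundle of constant rank and $g_H$ is a smooth metric tensor on $H$. Define $\sharp^H:T^*M\to H$ by $g_H(\sharp^H\alpha,v)=\alpha(v)$ for $v\in H$, the cometric $\langle\alpha,\beta\rangle_{g_H^*}=g_H(\sharp^H\alpha,\sharp^H\beta)$, and $\mathrm{tr}_H\,\xi(\times,\times)=\sum_i\xi(v_i,v_i)$ for any orthonormal basis $(v_i)$ of $H_x$. Let $g$ be a smooth Riemannian metric on $M$ taming $g_H$, i.e. $g|_H=g_H$. Let $V=H^\perp$, let $\mathrm{pr}_H,\mathrm{pr}_V$ be the $g$-orthogonal projections, and let $\sharp$ be the inverse of $v\mapsto g(v,\cdot)$. Put $\Delta_Hf=\mathrm{div}_\mu(\sharp^Hdf)$ with $\mu$ the Riemannian volume density of $g$. Let $\mathrm{II}$ be the symmetric vector-valued tensor given by $$\langle \mathrm{II}(A,A),Z\rangle_g=-\tfrac12(\mathcal L_{\mathrm{pr}_VZ}\,g)(\mathrm{pr}_HA,\mathrm{pr}_HA)-\tfrac12(\mathcal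 L_{\mathrm{pr}_HZ}\,g)(\mathrm{pr}_VA,\mathrm{pr}_VA).$$ For a smooth affine connection $\nabla$ on $TM$ with torsion $T$, its adjoint is $\hat\nabla_AB=\nabla_AB-T(A,B)$. Let $L(\nabla)=\mathrm{tr}_H\nabla^2_{\times,\times}$, where $\nabla^2_{A,B}=\nabla_A\nabla_B-\nabla_{\nabla_AB}$, acting on functions and on one-forms, and let $\mathrm{Ric}(\nabla)(\alpha)(v)=\mathrm{tr}_H\,(R^\nabla(\times,v)\alpha)(\times)$. Compatibility of $\nabla$ with $g_H^*$ (resp. $g$) means $\nabla g_H^*=0$ (resp. $\nabla g=0$). Claim. (1) If $\nabla$ is compatible with $g_H^*$ and $\hat\nabla g=0$, then $\mathrm{II}=0$, and for every $f\in C^\infty(M)$, $$\bigl(L(\hat\nabla)-\mathrm{Ric}(\nabla)\bigr)df=dL(\hat\nabla)f=dL(\nabla)f=d\Delta_Hf.$$ (2) Conversely, suppose $\mathrm{II}=0$. Let $\mathcal R(A,Z)=\mathrm{pr}_V[\mathrm{pr}_HA,\mathrm{pr}_HZ]$, $\bar{\mathcal R}(A,Z)=\mathrm{pr}_H[\mathrm{pr}_VA,\mathrm{pr}_VZ]$,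 let $\zeta$ be the three-form $$\zeta(v_1,v_2,v_3)=\circlearrowright\langle\mathcal R(v_1,v_2),v_3\rangle_g+\circlearrowright\langle\bar{\mathcal R}(v_1,v_2),v_3\rangle_g$$ (cyclic sums), and let $\nabla^g$ be the Levi-Civita connection of $g$. Then the connection $$\nabla_AB=\nabla^g_AB-\tfrac12\,\sharp\,\zeta(A,B,\cdot)$$ is compatible with $g_H^*$, its adjoint is $\hat\nabla_AB=\nabla^g_AB+\tfrac12\,\sharp\,\zeta(A,B,\cdot)$, and both are compatible with $g$: $\nabla g=0$ and $\hat\nabla g=0$. (3) In the situation of (2), among all smooth connections $\nabla'$ compatible with $g_H^*$ and with $\hat\nabla'g=0$, the connection $\nabla$ gives the maximal lower bound of $\alpha\mapsto\langle\mathrm{Ric}(\nabla')\alpha,\alpha\rangle_{g_H^*}$. In fact $\langle\mathrm{Ric}(\nabla')\alpha,\alpha\rangle_{g_H^*}\le\langle\mathrm{Ric}(\nabla)\alpha,\alpha\rangle_{g_H^*}$ for every $x\in M$ and $\alpha\in T^*_xM$, and hence at every $x$ the infimum over $|\alpha|_{g_H^*}=1$ is largest for $\nabla$. -/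

import Mathlib

open Bundle Manifold
open scoped ContDiff

noncomputable section

namespace SubRiem

/-- The model space `ℝᵐ` of an `m`-dimensional manifold. -/
abbrev Model (m : ℕ) : Type := EuclideanSpace ℝ (Fin m)

section Basics

variable (m : ℕ) (M : Type*) [TopologicalSpace M] [ChartedSpace (Model m) M]

/-- (Not necessarily continuous) vector fields on `M`. -/
abbrev VField : Type _ := ∀ x : M, TangentSpace (𝓡 m) x

/-- (Not necessarily continuous) one-forms on `M`. -/
abbrev OneForm : Type _ := ∀ x : M, TangentSpace (𝓡 m) x →L[ℝ] ℝ

variable {m M}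

/-- Smooth vector fields, i.e. elements of `Γ(TM)`. -/
def VField.Smooth [IsManifold (𝓡 m) ∞ M] (X : VField m M) : Prop :=
  ContMDiff (𝓡 m) ((𝓡 m).prod 𝓘(ℝ, Model m)) ∞
    (fun x ↦ (TotalSpace.mk' (Model m) x (X x) : TangentBundle (𝓡 m) M))

/-- Smooth one-forms, i.e. elements of `Γ(T*M)`. -/
def OneForm.Smooth [IsManifold (𝓡 m) ∞ M] (α : OneForm m M) : Prop :=
  ContMDiff (𝓡 m) ((𝓡 m).prod 𝓘(ℝ, Model m →L[ℝ] ℝ)) ∞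
    (fun x ↦ TotalSpace.mk' (Model m →L[ℝ] ℝ)
      (E := fun x : M ↦ TangentSpace (𝓡 m) x →L[ℝ] ℝ) x (α x))

/-- The differential `df` of a real function, as a one-form. -/
def d (f : M → ℝ) : OneForm m M := mvfderiv (𝓡 m) f

/-- The smooth local vector field with value `v` at `x` which is constant in the preferred chart
at `x`. -/
def ext {x : M} [IsManifold (𝓡 m) ∞ M] (v : TangentSpace (𝓡 m) x) : VField m M :=
  FiberBundle.extend (Model m) (E := fun x : M ↦ TangentSpace (𝓡 m) x) v

/-- The standard basis `e₁, …, e_m` of `T_x M = ℝᵐ` (the coordinate frame of the preferred chart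
at `x`). -/
def stdVec (x : M) (i : Fin m) : TangentSpace (𝓡 m) x :=
  (EuclideanSpace.single i (1 : ℝ) : Model m)

/-- The basis of `T_x^* M` dual to `stdVec`. -/
def stdCovec (x : M) (i : Fin m) : TangentSpace (𝓡 m) x →L[ℝ] ℝ :=
  (EuclideanSpace.proj i : Model m →L[ℝ] ℝ)

end Basics

/-! ### Sub-Riemannian structures -/

/-- A family of subspaces `H_x ⊆ T_x M` with an inner product on each of them. No regularity in
`x` is required here; see `SubRiemannianStructure`. -/
structure HorizontalMetric (m : ℕ) (M : Type*) [TopologicalSpace M] [ChartedSpace (Model m) M] where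
  /-- the horizontal space `H_x` -/
  H : ∀ x : M, Submodule ℝ (TangentSpace (𝓡 m) x)
  /-- the inner product `g_H(x)` on `H_x` -/
  gH : ∀ x : M, LinearMap.BilinForm ℝ (H x)
  symm : ∀ x v w, gH x v w = gH x w v
  pos : ∀ x v, v ≠ 0 → 0 < gH x v v

namespace HorizontalMetric

variable {m : ℕ} {M : Type*} [TopologicalSpace M] [ChartedSpace (Model m) M]
  (S : HorizontalMetric m M)

instance (x : M) : FiniteDimensional ℝ (S.H x) :=
  haveI : FiniteDimensional ℝ (TangentSpace (𝓡 m) x) :=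
    inferInstanceAs (FiniteDimensional ℝ (Model m))
  inferInstance

theorem nondegenerate (x : M) : (S.gH x).Nondegenerate := by
  refine ⟨fun v hv ↦ ?_, fun v hv ↦ ?_⟩ <;>
  · by_contra h
    have := S.pos x v h
    rw [hv v] at this
    exact lt_irrefl _ this

/-- The map `♯^H : T_x^* M → H_x ⊆ T_x M`, determined by `g_H(♯^H α, v) = α(v)` for `v ∈ H_x`. -/
def sharp (x : M) (α : TangentSpace (𝓡 m) x →L[ℝ] ℝ) : TangentSpace (𝓡 m) x :=
  (((S.gH x).toDual (S.nondegenerate x)).symm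
    ((α : TangentSpace (𝓡 m) x →ₗ[ℝ] ℝ).domRestrict (S.H x)) : S.H x)

theorem sharp_mem (x : M) (α : TangentSpace (𝓡 m) x →L[ℝ] ℝ) : S.sharp x α ∈ S.H x :=
  Subtype.coe_prop _

theorem gH_sharp (x : M) (α : TangentSpace (𝓡 m) x →L[ℝ] ℝ) (v : S.H x) :
    S.gH x ⟨S.sharp x α, S.sharp_mem x α⟩ v = α v :=
  LinearMap.BilinForm.apply_toDual_symm_apply (hB := S.nondegenerate x) ..

/-- The (degenerate) cometric `⟨α, β⟩_{g_H^*} = ⟨♯^H α, ♯^H β⟩_{g_H}`. -/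
def cometric (x : M) (α β : TangentSpace (𝓡 m) x →L[ℝ] ℝ) : ℝ :=
  S.gH x ⟨S.sharp x α, S.sharp_mem x α⟩ ⟨S.sharp x β, S.sharp_mem x β⟩

/-- The trace `tr_H ξ(×, ×) = ξ(g_H^*)` of a bilinear form `ξ` on `T_x M`; this is
`∑ ξ(v_k, v_k)` for any orthonormal basis `(v_k)` of `H_x`. -/
def trace (x : M) (ξ : TangentSpace (𝓡 m) x → TangentSpace (𝓡 m) x → ℝ) : ℝ :=
  ∑ i, ∑ j, S.cometric x (stdCovec x i) (stdCovec x j) * ξ (stdVec x i) (stdVec x j)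

end HorizontalMetric

/-- A sub-Riemannian structure `(H, g_H)` on `M`: a subbundle `H ⊆ TM` with a smooth metric tensor
`g_H`. Smoothness of `(H, g_H)` is expressed by smoothness of the cometric `g_H^*`, i.e. of the
bundle map `♯^H : T*M → TM`, whose image `H` has constant rank. -/
structure SubRiemannianStructure (m : ℕ) (M : Type*) [TopologicalSpace M]
    [ChartedSpace (Model m) M] [IsManifold (𝓡 m) ∞ M] extends HorizontalMetric m M where
  rank : ℕ
  finrank_eq : ∀ x : M, Module.finrank ℝ (H x) = rank
  smooth : ∀ α : OneForm m M, α.Smooth →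
    VField.Smooth (fun x ↦ toHorizontalMetric.sharp x (α x))

variable {m : ℕ} {M : Type*} [TopologicalSpace M] [ChartedSpace (Model m) M]
  [IsManifold (𝓡 m) ∞ M]

/-- Smooth Riemannian metrics on `M`. -/
abbrev Metric (m : ℕ) (M : Type*) [TopologicalSpace M] [ChartedSpace (Model m) M]
    [IsManifold (𝓡 m) ∞ M] : Type _ :=
  ContMDiffRiemannianMetric (𝓡 m) ∞ (Model m) (fun x : M ↦ TangentSpace (𝓡 m) x)

/-- The Riemannian metric `g` tames `g_H`: `g|H = g_H`. -/
def Tames (S : SubRiemannianStructure m M) (g : Metric m M) : Prop :=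
  ∀ (x : M) (v w : S.H x), g.inner x v w = S.gH x v w

/-- The projection `pr_H = ♯^H ∘ ♭`; for a taming metric this is the `g`-orthogonal projection onto
`H`, see `prH_of_mem` and `inner_prV`. -/
def prH (S : SubRiemannianStructure m M) (g : Metric m M) (X : VField m M) : VField m M :=
  fun x ↦ S.sharp x (g.inner x (X x))

/-- The orthogonal projection onto the orthogonal complement `V` of `H`. -/
def prV (S : SubRiemannianStructure m M) (g : Metric m M) (X : VField m M) : VField m M :=
  fun x ↦ X x - prH S g X x

theorem inner_prV {S : SubRiemannianStructure m M} {g : Metric m M} (h : Tames S g)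
    (X : VField m M) (x : M) {w : TangentSpace (𝓡 m) x} (hw : w ∈ S.H x) :
    g.inner x (prV S g X x) w = 0 := by
  have h1 := h x ⟨_, S.sharp_mem x (g.inner x (X x))⟩ ⟨w, hw⟩
  rw [S.gH_sharp] at h1
  simp only [prV, prH, map_sub, sub_apply]
  simp only at h1
  rw [h1, sub_self]

theorem prH_of_mem {S : SubRiemannianStructure m M} {g : Metric m M} (h : Tames S g)
    (X : VField m M) (x : M) (hX : X x ∈ S.H x) : prH S g X x = X x := by
  have hm : prV S g X x ∈ S.H x := Submodule.sub_mem _ hX (S.sharp_mem x _)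
  have h0 := inner_prV h X x hm
  have hz : prV S g X x = 0 := by
    by_contra hne
    exact (g.pos x _ hne).ne' h0
  exact (sub_eq_zero.mp hz).symm

/-! ### The tensors `II`, `𝓡`, `𝓡̄` and the three-form `ζ` -/

/-- The Lie derivative `(𝓛_X g)(A, B) = X g(A, B) - g([X, A], B) - g(A, [X, B])`. -/
def lieDerivMetric (g : Metric m M) (X A B : VField m M) (x : M) : ℝ :=
  d (fun y ↦ g.inner y (A y) (B y)) x (X x)
    - g.inner x (VectorField.mlieBracket (𝓡 m) X A x) (B x)
    - g.inner x (A x) (VectorField.mlieBracket (𝓡 m) X B x)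

/-- `⟨II(A, B), Z⟩_g` for the symmetric vector-valued tensor `II`. -/
def II (S : SubRiemannianStructure m M) (g : Metric m M) (A B Z : VField m M) (x : M) : ℝ :=
  -(1 / 2) * lieDerivMetric g (prV S g Z) (prH S g A) (prH S g B) x
    - (1 / 2) * lieDerivMetric g (prH S g Z) (prV S g A) (prV S g B) x

/-- `II = 0`. -/
def IIVanishes (S : SubRiemannianStructure m M) (g : Metric m M) : Prop :=
  ∀ A B Z : VField m M, A.Smooth → B.Smooth → Z.Smooth → ∀ x, II S g A B Z x = 0

/-- The curvature `𝓡(A, Z) = pr_V [pr_H A, pr_H Z]` of `H`. -/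
def horCurv (S : SubRiemannianStructure m M) (g : Metric m M) (A Z : VField m M) : VField m M :=
  prV S g (VectorField.mlieBracket (𝓡 m) (prH S g A) (prH S g Z))

/-- The cocurvature `𝓡̄(A, Z) = pr_H [pr_V A, pr_V Z]` of `H`. -/
def horCocurv (S : SubRiemannianStructure m M) (g : Metric m M) (A Z : VField m M) : VField m M :=
  prH S g (VectorField.mlieBracket (𝓡 m) (prV S g A) (prV S g Z))

/-- The three-form `ζ(A, B, C) = ↻ ⟨𝓡(A, B), C⟩_g + ↻ ⟨𝓡̄(A, B), C⟩_g` (cyclic sums). -/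
def zeta (S : SubRiemannianStructure m M) (g : Metric m M) (A B C : VField m M) (x : M) : ℝ :=
  (g.inner x (horCurv S g A B x) (C x) + g.inner x (horCurv S g B C x) (A x)
      + g.inner x (horCurv S g C A x) (B x))
    + (g.inner x (horCocurv S g A B x) (C x) + g.inner x (horCocurv S g B C x) (A x)
      + g.inner x (horCocurv S g C A x) (B x))

/-! ### Connections -/

/-- Affine connections on `TM`. Note the order of arguments: `∇ Y x (X x)` is `(∇_X Y)(x)`. -/
abbrev Conn (m : ℕ) (M : Type*) [TopologicalSpace M] [ChartedSpace (Model m) M]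
    [IsManifold (𝓡 m) ∞ M] : Type _ :=
  CovariantDerivative (𝓡 m) (Model m) (fun x : M ↦ TangentSpace (𝓡 m) x)

/-- The connection maps smooth vector fields to smooth ones. -/
def Conn.Smooth (D : Conn m M) : Prop := D.ContMDiffCovariantDerivative ∞

/-- The vector field `∇_X Y`. -/
def Conn.along (D : Conn m M) (X Y : VField m M) : VField m M := fun x ↦ D Y x (X x)

/-- The adjoint connection `∇̂_A B = ∇_A B - T(A, B) = ∇_A B + T(B, A)`, with `T` the torsion of
`∇`. -/
def Conn.adjoint (D : Conn m M) : Conn m M :=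
  CovariantDerivative.addOneForm D D.torsion

theorem Conn.adjoint_apply (D : Conn m M) (A B : VField m M) (x : M) :
    D.adjoint B x (A x) = D B x (A x) - D.torsion x (A x) (B x) := by
  rw [D.torsion_antisymm (A x) (B x), sub_neg_eq_add]
  rfl

/-- `(∇_X α)(Y) = X (α(Y)) - α(∇_X Y)`: the induced connection on one-forms, where a one-form is
viewed as the map `Y ↦ α(Y)` from vector fields to functions. -/
def Conn.onForm (D : Conn m M) (X : VField m M) (α : VField m M → M → ℝ) :
    VField m M → M → ℝ :=
  fun Y x ↦ d (α Y) x (X x) - α (D.along X Y) x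

/-- A one-form, viewed as the map `Y ↦ α(Y)` from vector fields to functions. -/
def OneForm.eval (α : OneForm m M) : VField m M → M → ℝ := fun Y x ↦ α x (Y x)

/-- `∇ g = 0`. -/
def Conn.CompatibleMetric (D : Conn m M) (g : Metric m M) : Prop :=
  ∀ X Y Z : VField m M, X.Smooth → Y.Smooth → Z.Smooth → ∀ x,
    d (fun y ↦ g.inner y (Y y) (Z y)) x (X x)
      = g.inner x (D.along X Y x) (Z x) + g.inner x (Y x) (D.along X Z x)

/-- `∇ g_H^* = 0`, i.e. `X ⟨α, β⟩ = ⟨∇_X α, β⟩ + ⟨α, ∇_X β⟩` with respect to `g_H^*`; here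
`⟨γ, β⟩ = γ(♯^H β)`. -/
def Conn.CompatibleCometric (D : Conn m M) (S : SubRiemannianStructure m M) : Prop :=
  ∀ (X : VField m M) (α β : OneForm m M), X.Smooth → α.Smooth → β.Smooth → ∀ x,
    d (fun y ↦ S.cometric y (α y) (β y)) x (X x)
      = D.onForm X α.eval (fun y ↦ S.sharp y (β y)) x
        + D.onForm X β.eval (fun y ↦ S.sharp y (α y)) x

/-- `∇` is the Levi-Civita connection of `g`: smooth, compatible with `g` and torsion free. -/
def IsLeviCivita (g : Metric m M) (D : Conn m M) : Prop :=
  D.Smooth ∧ D.CompatibleMetric g ∧ D.torsion = 0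

/-- The Hessian `∇²_{A,B} f = A B f - (∇_A B) f` on functions. -/
def Conn.hessFun (D : Conn m M) (A B : VField m M) (f : M → ℝ) : M → ℝ :=
  fun x ↦ d (fun y ↦ d f y (B y)) x (A x) - d f x (D.along A B x)

/-- The Hessian `∇²_{A,B} α = ∇_A ∇_B α - ∇_{∇_A B} α` on one-forms. -/
def Conn.hessForm (D : Conn m M) (A B : VField m M) (α : VField m M → M → ℝ) :
    VField m M → M → ℝ :=
  fun Y x ↦ D.onForm A (D.onForm B α) Y x - D.onForm (D.along A B) α Y x

/-- The rough sub-Laplacian `L(∇) f = tr_H ∇²_{×,×} f` on functions. -/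
def roughLap (S : SubRiemannianStructure m M) (D : Conn m M) (f : M → ℝ) : M → ℝ :=
  fun x ↦ S.trace x (fun u w ↦ D.hessFun (ext u) (ext w) f x)

/-- The rough sub-Laplacian `L(∇) α = tr_H ∇²_{×,×} α` on one-forms, evaluated at `v ∈ T_x M`. -/
def roughLapForm (S : SubRiemannianStructure m M) (D : Conn m M) (α : OneForm m M)
    (x : M) (v : TangentSpace (𝓡 m) x) : ℝ :=
  S.trace x (fun u w ↦ D.hessForm (ext u) (ext w) α.eval (ext v) x)

/-- The curvature `R(X, Y) Z = ∇_X ∇_Y Z - ∇_Y ∇_X Z - ∇_{[X, Y]} Z`. -/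
def Conn.curv (D : Conn m M) (X Y Z : VField m M) : VField m M :=
  fun x ↦ D.along X (D.along Y Z) x - D.along Y (D.along X Z) x
    - D.along (VectorField.mlieBracket (𝓡 m) X Y) Z x

/-- `Ric(∇)(α)(v) = tr_H (R(×, v) α)(×)`, where the curvature acts on covectors by
`(R(u, v) α)(w) = - α (R(u, v) w)`. -/
def ric (S : SubRiemannianStructure m M) (D : Conn m M) (x : M)
    (α : TangentSpace (𝓡 m) x →L[ℝ] ℝ) (v : TangentSpace (𝓡 m) x) : ℝ :=
  S.trace x (fun u w ↦ -α (D.curv (ext u) (ext v) (ext w) x))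

/-- `⟨Ric(∇) α, α⟩_{g_H^*}`. -/
def ricQuad (S : SubRiemannianStructure m M) (D : Conn m M) (x : M)
    (α : TangentSpace (𝓡 m) x →L[ℝ] ℝ) : ℝ :=
  ric S D x α (S.sharp x α)

/-- The (best) lower bound of `α ↦ ⟨Ric(∇) α, α⟩_{g_H^*}` at `x`, over covectors with
`|α|_{g_H^*} = 1`. -/
def ricLowerBound (S : SubRiemannianStructure m M) (D : Conn m M) (x : M) : EReal :=
  ⨅ α : {α : TangentSpace (𝓡 m) x →L[ℝ] ℝ // S.cometric x α α = 1}, (ricQuad S D x α : EReal)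

/-! ### The sub-Laplacian -/

/-- The Riemannian volume density of `g`: `(v₁, …, v_m) ↦ √ det (g(v_i, v_j))`. -/
def volDensity (g : Metric m M) (x : M) (v : Fin m → TangentSpace (𝓡 m) x) : ℝ :=
  Real.sqrt (Matrix.det (Matrix.of fun i j ↦ g.inner x (v i) (v j)))

/-- The divergence of `X` with respect to a volume density `μ`: in local coordinates
`div X = ρ⁻¹ ∑ᵢ ∂ᵢ(ρ Xⁱ)`, where `ρ = μ(∂₁, …, ∂_m)`. -/
def divergence (μ : ∀ x : M, (Fin m → TangentSpace (𝓡 m) x) → ℝ) (X : VField m M) (x : M) : ℝ :=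
  let φ := extChartAt (𝓡 m) x
  let ρ : Model m → ℝ := fun y ↦ μ (φ.symm y) (fun i ↦
    mfderiv 𝓘(ℝ, Model m) (𝓡 m) φ.symm y (EuclideanSpace.single i (1 : ℝ) : Model m))
  let Xc : Model m → Model m := VectorField.mpullback 𝓘(ℝ, Model m) (𝓡 m) φ.symm X
  (ρ (φ x))⁻¹ * ∑ i, fderiv ℝ (fun y ↦ ρ y * Xc y i) (φ x) (EuclideanSpace.single i (1 : ℝ))

/-- The sub-Laplacian `Δ_H f = div (♯^H df)` with respect to the volume density of `g`. -/
def subLap (S : SubRiemannianStructure m M) (g : Metric m M) (f : M → ℝ) : M → ℝ :=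
  divergence (volDensity g) (fun x ↦ S.sharp x (d f x))

end SubRiem

end

open SubRiem

open Bundle Manifold
open scoped ContDiff Topology

noncomputable section

namespace SubRiem

set_option linter.unusedSectionVars false

variable {m : ℕ} {M : Type*} [TopologicalSpace M] [ChartedSpace (Model m) M]
  [IsManifold (𝓡 m) ∞ M]

/-! Everything rests on two facts about a pair of adjoint connections. The adjoint derivative of `Y`
along `X` is `∇_Y X + [X, Y]` (`Conn.adjoint_along`), so passing to the adjoint transposes the
Hessian of a function (`hessFun_adjoint`). Compatibility with the cometric means that `∇` preserves
`H` and is metric on horizontal fields (`Conn.CompatibleCometric.along_mem`,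
`Conn.CompatibleCometric.metric`, with converse `Conn.compatibleCometric_of`).

Part (1). Commuting three derivatives of `f` gives the identity `hessForm_adjoint_add_curv`: the
adjoint Hessian of `df` plus the curvature of `∇` equals the `∇`-derivative of the Hessian of `f`,
up to a torsion term antisymmetric in the two traced slots. The trace kills that term, and since the
cometric is parallel, the trace commutes with differentiation (`dir_contract`); this is
`weitzenboeck`. The two rough sub-Laplacians agree because the trace is symmetric. For `Δ_H`, a
metric adjoint makes the Riemannian divergence of `X` the full trace of `∇X`
(`divergence_eq_sum_along`), and a parallel cometric turns the trace of `∇(♯^H df)` into the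
horizontal trace of the Hessian (`subLap_eq_roughLap`). `II` vanishes because brackets of horizontal
with vertical fields can be written with one derivative from each connection
(`iiVanishes_of_compatible`).

Part (2). `ζ` is totally antisymmetric, so adding a multiple of it to the Levi-Civita connection
keeps `g` parallel, and taking the adjoint flips its sign. When `II = 0`, the Koszul formula shows
that the mixed component `g(∇^g_X Y, W)`, with `Y` horizontal and `W` vertical, is exactly `½ζ(X, Y,
W)`; subtracting it leaves a connection that preserves `H` (`inner_zetaConn_horizontal`,
`inner_zetaConn_vertical`).

Part (3). The difference of two admissible connections is a three-form on horizontal vectors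
(`difference_swap_outer`, `difference_swap_right`). Since `ζ` vanishes on horizontal triples, the
torsion of the distinguished connection has no horizontal part there (`zetaConn_bracket`). The
curvature form `⟨R(E, Y)E, Y⟩` then changes by exactly a square (`inner_curv_sub`), and the
horizontal trace enters the Ricci form with a minus sign (`ricQuad_le`).

Smoothness hypotheses concern global fields while traces are taken with chart-constant local fields,
so bump functions provide global fields with the right germs, and tensoriality (`TensorAt.eq_sum`)
reduces pointwise statements to a cut-off coordinate frame. -/

/-- Smooth real functions on `M`. -/
abbrev SmoothFun (f : M → ℝ) : Prop := ContMDiff (𝓡 m) 𝓘(ℝ, ℝ) ∞ f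

/-- The derivative `X f` of a function along a vector field. -/
def dir (X : VField m M) (f : M → ℝ) : M → ℝ := fun x ↦ d f x (X x)

/-! ### Smooth functions, vector fields and one-forms. -/

theorem SmoothFun.mdiffAt {f : M → ℝ} (hf : SmoothFun (m := m) f) (x : M) :
    MDifferentiableAt (𝓡 m) 𝓘(ℝ, ℝ) f x := hf.mdifferentiable (by simp) x

theorem VField.Smooth.mdiffAt {X : VField m M} (hX : X.Smooth) (x : M) :
    MDifferentiableAt (𝓡 m) ((𝓡 m).prod 𝓘(ℝ, Model m))
      (fun x ↦ (TotalSpace.mk' (Model m) x (X x) : TangentBundle (𝓡 m) M)) x :=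
  ContMDiff.mdifferentiable hX (by simp) x

namespace VField.Smooth

variable {X Y : VField m M} {f : M → ℝ}

theorem add (hX : X.Smooth) (hY : Y.Smooth) : VField.Smooth (X + Y) :=
  ContMDiff.add_section hX hY

theorem sub (hX : X.Smooth) (hY : Y.Smooth) : VField.Smooth (X - Y) :=
  ContMDiff.sub_section hX hY

theorem smul (hf : SmoothFun (m := m) f) (hX : X.Smooth) : VField.Smooth (f • X) :=
  ContMDiff.smul_section hf hX

theorem neg (hX : X.Smooth) : VField.Smooth (-X) :=
  ContMDiff.neg_section hX

theorem zero : VField.Smooth (0 : VField m M) :=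
  contMDiff_zeroSection ℝ (fun x : M ↦ TangentSpace (𝓡 m) x)

theorem sum {ι : Type*} {s : Finset ι} {X : ι → VField m M} (h : ∀ i ∈ s, (X i).Smooth) :
    VField.Smooth (fun x ↦ ∑ i ∈ s, X i x) :=
  ContMDiff.sum_section h

theorem bracket (hX : X.Smooth) (hY : Y.Smooth) :
    VField.Smooth (VectorField.mlieBracket (𝓡 m) X Y) := by
  intro x
  have : IsManifold (𝓡 m) (minSmoothness ℝ 2) M := by
    rw [minSmoothness_of_isRCLikeNormedField]; infer_instance
  have : IsManifold (𝓡 m) ((((⊤ : ℕ∞) : ℕ∞) : WithTop ℕ∞) + 1) M := by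
    simpa using (inferInstance : IsManifold (𝓡 m) ∞ M)
  exact ContMDiffAt.mlieBracket_vectorField (n := (⊤ : ℕ∞)) (m := (⊤ : ℕ∞)) (hX x) (hY x) (by simp)

end VField.Smooth

section Applications

variable {X Y : VField m M} {α : OneForm m M} {f : M → ℝ}

/-- A scalar function is a section of the trivial line bundle, so bundle evaluation applies and the
fibre component is read off. -/
theorem OneForm.Smooth.apply (hα : α.Smooth) (hX : X.Smooth) :
    SmoothFun (m := m) (fun x ↦ α x (X x)) := by
  have h : ContMDiff (𝓡 m) ((𝓡 m).prod 𝓘(ℝ, ℝ)) ∞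
      (fun x ↦ TotalSpace.mk' ℝ (E := Bundle.Trivial M ℝ) x (α x (X x))) :=
    ContMDiff.clm_bundle_apply (F₁ := Model m) (F₂ := ℝ)
      (E₁ := fun x : M ↦ TangentSpace (𝓡 m) x) (E₂ := Bundle.Trivial M ℝ) hα hX
  intro x
  have := h x
  rw [contMDiffAt_totalSpace] at this
  exact this.2

theorem metric_smooth (g : Metric m M) (hX : X.Smooth) (hY : Y.Smooth) :
    SmoothFun (m := m) (fun x ↦ g.inner x (X x) (Y x)) := by
  have h : ContMDiff (𝓡 m) ((𝓡 m).prod 𝓘(ℝ, ℝ)) ∞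
      (fun x ↦ TotalSpace.mk' ℝ (E := Bundle.Trivial M ℝ) x (g.inner x (X x) (Y x))) :=
    ContMDiff.clm_bundle_apply₂ (F₁ := Model m) (F₂ := Model m) (F₃ := ℝ)
      (E₁ := fun x : M ↦ TangentSpace (𝓡 m) x)
      (E₂ := fun x : M ↦ TangentSpace (𝓡 m) x) (E₃ := Bundle.Trivial M ℝ) g.contMDiff hX hY
  intro x
  have := h x
  rw [contMDiffAt_totalSpace] at this
  exact this.2

theorem flat_smooth (g : Metric m M) (hX : X.Smooth) :
    OneForm.Smooth (fun x ↦ g.inner x (X x)) := by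
  have h : ContMDiff (𝓡 m) ((𝓡 m).prod 𝓘(ℝ, Model m →L[ℝ] ℝ)) ∞
      (fun x ↦ TotalSpace.mk' (Model m →L[ℝ] ℝ)
        (E := fun x : M ↦ TangentSpace (𝓡 m) x →L[ℝ] Bundle.Trivial M ℝ x) x (g.inner x (X x))) :=
    ContMDiff.clm_bundle_apply (F₁ := Model m) (F₂ := Model m →L[ℝ] ℝ)
      (E₁ := fun x : M ↦ TangentSpace (𝓡 m) x)
      (E₂ := fun x : M ↦ TangentSpace (𝓡 m) x →L[ℝ] Bundle.Trivial M ℝ x) g.contMDiff hX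
  exact h

theorem dir_smooth (hX : X.Smooth) (hf : SmoothFun (m := m) f) : SmoothFun (m := m) (dir X f) := by
  have h1 : ContMDiff (𝓡 m) (𝓘(ℝ, ℝ).prod 𝓘(ℝ, ℝ)) ∞
      (fun x ↦ tangentMap (𝓡 m) 𝓘(ℝ, ℝ) f (TotalSpace.mk' (Model m) x (X x))) :=
    (hf.contMDiff_tangentMap (m := ∞) (by simp)).comp hX
  intro x
  have := h1 x
  rw [contMDiffAt_totalSpace] at this
  refine this.2.congr_of_eventuallyEq (Filter.Eventually.of_forall fun y ↦ ?_)
  simp [dir, d, mvfderiv, tangentMap]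
  rfl

end Applications

/-! ### Differentials of functions and the Lie bracket as a commutator. -/

section Calculus

variable {X Y Z : VField m M} {u v : M → ℝ} {x : M}

theorem d_congr (h : u =ᶠ[𝓝 x] v) : d (m := m) u x = d v x := by
  have := h.mfderiv_eq (I := 𝓡 m) (I' := 𝓘(ℝ, ℝ))
  ext w
  simp only [d, mvfderiv, ContinuousLinearMap.comp_apply]
  rw [this]; rfl

theorem dir_congr {X' : VField m M} (h : u =ᶠ[𝓝 x] v) (hX : X =ᶠ[𝓝 x] X') :
    dir X u =ᶠ[𝓝 x] dir X' v := by
  filter_upwards [h.eventuallyEq_nhds, hX] with y hy hXy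
  simp only [dir]
  rw [d_congr hy, hXy]

theorem d_add (hu : MDifferentiableAt (𝓡 m) 𝓘(ℝ, ℝ) u x)
    (hv : MDifferentiableAt (𝓡 m) 𝓘(ℝ, ℝ) v x) :
    d (m := m) (fun y ↦ u y + v y) x = d u x + d v x := mvfderiv_add hu hv

theorem d_sub (hu : MDifferentiableAt (𝓡 m) 𝓘(ℝ, ℝ) u x)
    (hv : MDifferentiableAt (𝓡 m) 𝓘(ℝ, ℝ) v x) :
    d (m := m) (fun y ↦ u y - v y) x = d u x - d v x := mvfderiv_sub hu hv

theorem d_mul (hu : MDifferentiableAt (𝓡 m) 𝓘(ℝ, ℝ) u x)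
    (hv : MDifferentiableAt (𝓡 m) 𝓘(ℝ, ℝ) v x) :
    d (m := m) (fun y ↦ u y * v y) x = u x • d v x + v x • d u x := by
  refine (mvfderiv_mul hu hv).trans ?_
  rfl

theorem d_const (c : ℝ) : d (m := m) (fun _ : M ↦ c) x = 0 := mvfderiv_const c

theorem d_sum {ι : Type*} {s : Finset ι} {u : ι → M → ℝ}
    (hu : ∀ i ∈ s, MDifferentiableAt (𝓡 m) 𝓘(ℝ, ℝ) (u i) x) :
    MDifferentiableAt (𝓡 m) 𝓘(ℝ, ℝ) (fun y ↦ ∑ i ∈ s, u i y) x ∧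
      d (m := m) (fun y ↦ ∑ i ∈ s, u i y) x = ∑ i ∈ s, d (u i) x := by
  classical
  induction s using Finset.induction_on with
  | empty => simpa using ⟨mdifferentiableAt_const, d_const 0⟩
  | insert a s ha ih =>
    have h1 := ih fun i hi ↦ hu i (Finset.mem_insert_of_mem hi)
    have h2 := hu a (Finset.mem_insert_self _ _)
    simp only [Finset.sum_insert ha]
    exact ⟨h2.add h1.1, by rw [d_add h2 h1.1, h1.2]⟩

/-- The chain rule for the coordinate expression of a function. -/
theorem fderiv_comp_extChartAt_symm {p : Model m} (hp : p ∈ (extChartAt (𝓡 m) x).target)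
    (hu : MDifferentiableAt (𝓡 m) 𝓘(ℝ, ℝ) u ((extChartAt (𝓡 m) x).symm p)) (w : Model m) :
    fderiv ℝ (u ∘ (extChartAt (𝓡 m) x).symm) p w =
      d u ((extChartAt (𝓡 m) x).symm p)
        (mfderiv 𝓘(ℝ, Model m) (𝓡 m) (extChartAt (𝓡 m) x).symm p w) := by
  have h1 : MDifferentiableAt 𝓘(ℝ, Model m) (𝓡 m) (extChartAt (𝓡 m) x).symm p := by
    have := contMDiffOn_extChartAt_symm (I := 𝓡 m) (n := ∞) x
    exact (this.mdifferentiableOn (by simp)).mdifferentiableAt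
      ((isOpen_extChartAt_target x).mem_nhds hp)
  rw [← mfderiv_eq_fderiv, mfderiv_comp p hu h1]
  rfl

end Calculus

/-- The expression of a vector field in the preferred chart at `x`. -/
def chartPull (x : M) (Z : VField m M) : Model m → Model m :=
  VectorField.mpullback 𝓘(ℝ, Model m) (𝓡 m) (extChartAt (𝓡 m) x).symm Z

/-- The chart expression of a field is related to the field by the inverse chart, so differentiation
along either gives the same function. -/
theorem fderiv_comp_chartPull {u : M → ℝ} {x : M} {p : Model m}
    (hp : p ∈ (extChartAt (𝓡 m) x).target)
    (hu : MDifferentiableAt (𝓡 m) 𝓘(ℝ, ℝ) u ((extChartAt (𝓡 m) x).symm p)) (Z : VField m M) :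
    fderiv ℝ (u ∘ (extChartAt (𝓡 m) x).symm) p (chartPull x Z p)
      = (dir Z u ∘ (extChartAt (𝓡 m) x).symm) p := by
  refine (fderiv_comp_extChartAt_symm hp hu _).trans ?_
  have h := isInvertible_mfderivWithin_extChartAt_symm (I := 𝓡 m) hp
  simp only [modelWithCornersSelf_coe, Set.range_id, mfderivWithin_univ] at h
  refine congrArg (d u _) ?_
  exact ((h.inverse_apply_eq (y := Z ((extChartAt (𝓡 m) x).symm p))).1 rfl).symm

theorem contDiffAt_comp_extChartAt_symm {u : M → ℝ} (hu : SmoothFun (m := m) u) (x : M) :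
    ContDiffAt ℝ ∞ (u ∘ (extChartAt (𝓡 m) x).symm) (extChartAt (𝓡 m) x x) := by
  have h1 := (contMDiffOn_extChartAt_symm (I := 𝓡 m) (n := ∞) x).contMDiffAt
    ((isOpen_extChartAt_target x).mem_nhds (mem_extChartAt_target x))
  exact contMDiffAt_iff_contDiffAt.1 (hu.contMDiffAt.comp _ h1)

theorem VField.Smooth.differentiableAt_chartPull {Z : VField m M} (hZ : Z.Smooth) (x : M) :
    DifferentiableAt ℝ (chartPull x Z) (extChartAt (𝓡 m) x x) := by
  have := (mdifferentiableWithinAt_univ.2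
    (hZ.mdiffAt x)).differentiableWithinAt_mpullbackWithin_vectorField
  rw [ModelWithCorners.Boundaryless.range_eq_univ, VectorField.mpullbackWithin_univ,
    Set.preimage_univ, Set.univ_inter] at this
  exact differentiableWithinAt_univ.1 this

/-- The manifold bracket is the bracket of the chart expressions carried back by the inverse of the
derivative of the chart, which is the derivative of the inverse chart. -/
theorem d_mlieBracket {f : M → ℝ} (hf : SmoothFun (m := m) f) (X Y : VField m M) (x : M) :
    dir (VectorField.mlieBracket (𝓡 m) X Y) f x
      = fderiv ℝ (f ∘ (extChartAt (𝓡 m) x).symm) (extChartAt (𝓡 m) x x)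
          (VectorField.lieBracket ℝ (chartPull x X) (chartPull x Y) (extChartAt (𝓡 m) x x)) := by
  refine Eq.trans ?_ (fderiv_comp_extChartAt_symm (mem_extChartAt_target x) (hf.mdiffAt _) _).symm
  have h1 : mfderiv 𝓘(ℝ, Model m) (𝓡 m) (extChartAt (𝓡 m) x).symm (extChartAt (𝓡 m) x x) =
      (mfderiv (𝓡 m) 𝓘(ℝ, Model m) (extChartAt (𝓡 m) x) x).inverse := by
    have ha := mfderivWithin_extChartAt_symm_comp_mfderiv_extChartAt' (I := 𝓡 m)
      (mem_extChartAt_source (I := 𝓡 m) x)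
    have hb := mfderiv_extChartAt_comp_mfderivWithin_extChartAt_symm' (I := 𝓡 m)
      (mem_extChartAt_source (I := 𝓡 m) x)
    rw [ModelWithCorners.Boundaryless.range_eq_univ, mfderivWithin_univ] at ha hb
    exact (ContinuousLinearMap.inverse_eq hb ha).symm
  -- The points `x` and `φ⁻¹(φ x)` agree only propositionally, so the two covectors are compared in
  -- the common model space.
  have h2 : (d f ((extChartAt (𝓡 m) x).symm (extChartAt (𝓡 m) x x)) : Model m →L[ℝ] ℝ) = d f x :=
    have : ∀ y : M, y = x → (d f y : Model m →L[ℝ] ℝ) = d f x := by rintro y rfl; rfl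
    this _ (extChartAt_to_inv x)
  have h3 : VectorField.mlieBracket (𝓡 m) X Y x =
      (mfderiv (𝓡 m) 𝓘(ℝ, Model m) (extChartAt (𝓡 m) x) x).inverse
        (VectorField.lieBracket ℝ (chartPull x X) (chartPull x Y) (extChartAt (𝓡 m) x x)) := by
    rw [← VectorField.mlieBracketWithin_univ, VectorField.mlieBracketWithin_apply,
      ModelWithCorners.Boundaryless.range_eq_univ, VectorField.mpullbackWithin_univ,
      VectorField.mpullbackWithin_univ, Set.preimage_univ, Set.univ_inter]
    exact congrArg _ (congrFun (VectorField.lieBracketWithin_univ (𝕜 := ℝ)) _)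
  have h4 : (d f x : Model m →L[ℝ] ℝ) (VectorField.mlieBracket (𝓡 m) X Y x) =
      (d f ((extChartAt (𝓡 m) x).symm (extChartAt (𝓡 m) x x)) : Model m →L[ℝ] ℝ)
        (mfderiv 𝓘(ℝ, Model m) (𝓡 m) (extChartAt (𝓡 m) x).symm (extChartAt (𝓡 m) x x)
          (VectorField.lieBracket ℝ (chartPull x X) (chartPull x Y) (extChartAt (𝓡 m) x x))) := by
    rw [h2, h1, h3]
    rfl
  exact h4

/-- In a chart this is the symmetry of the second derivative of `f`. The iterated derivatives
transfer because the first-order identities hold on a whole neighbourhood. -/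
theorem dir_bracket {X Y : VField m M} (hX : X.Smooth) (hY : Y.Smooth) {f : M → ℝ}
    (hf : SmoothFun (m := m) f) (x : M) :
    dir (VectorField.mlieBracket (𝓡 m) X Y) f x = dir X (dir Y f) x - dir Y (dir X f) x := by
  have htar : (extChartAt (𝓡 m) x).target ∈ 𝓝 (extChartAt (𝓡 m) x x) :=
    (isOpen_extChartAt_target x).mem_nhds (mem_extChartAt_target x)
  have pull : ∀ Z : VField m M,
      (fun p ↦ fderiv ℝ (f ∘ (extChartAt (𝓡 m) x).symm) p (chartPull x Z p))
        =ᶠ[𝓝 (extChartAt (𝓡 m) x x)] (dir Z f ∘ (extChartAt (𝓡 m) x).symm) := fun Z ↦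
    Filter.eventually_of_mem htar fun p hp ↦ fderiv_comp_chartPull hp (hf.mdiffAt _) Z
  have key := VectorField.fderiv_apply_lieBracket_of_isSymmSndFDerivAt
    ((contDiffAt_comp_extChartAt_symm hf x).of_le (WithTop.coe_le_coe.2 le_top))
    ((contDiffAt_comp_extChartAt_symm hf x).isSymmSndFDerivAt (by
      rw [minSmoothness_of_isRCLikeNormedField]; exact WithTop.coe_le_coe.2 le_top))
    (hY.differentiableAt_chartPull x) (hX.differentiableAt_chartPull x)
  rw [(pull Y).fderiv_eq, (pull X).fderiv_eq,
    fderiv_comp_chartPull (mem_extChartAt_target x) ((dir_smooth hX hf).mdiffAt _),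
    fderiv_comp_chartPull (mem_extChartAt_target x) ((dir_smooth hY hf).mdiffAt _),
    ← d_mlieBracket hf] at key
  simpa using key

/-! ### Cut-off coordinate frames -/

/-- The tangent space at `y` read in the preferred chart at `x`. -/
def chartDeriv (x y : M) : TangentSpace (𝓡 m) y →L[ℝ] Model m :=
  (trivializationAt (Model m) (TangentSpace (𝓡 m) : M → Type _) x).continuousLinearMapAt ℝ y

theorem chartDeriv_self (x : M) (v : TangentSpace (𝓡 m) x) : chartDeriv x x v = (v : Model m) := by
  unfold chartDeriv
  rw [TangentBundle.continuousLinearMapAt_trivializationAt_eq_core (mem_chart_source _ x)]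
  exact (tangentBundleCore (𝓡 m) M).coordChange_self (achart (Model m) x) x
    (mem_chart_source _ x) v

/-- The vector at `y` with given coordinates in the preferred chart at `x`. -/
def chartSymm (x y : M) : Model m →L[ℝ] TangentSpace (𝓡 m) y :=
  (trivializationAt (Model m) (TangentSpace (𝓡 m) : M → Type _) x).symmL ℝ y

theorem chartSymm_chartDeriv {x y : M} (hy : y ∈ (chartAt (Model m) x).source)
    (w : TangentSpace (𝓡 m) y) : chartSymm x y (chartDeriv x y w) = w :=
  Bundle.Trivialization.symmL_continuousLinearMapAt _ (by exact hy) w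

theorem chartDeriv_chartSymm {x y : M} (hy : y ∈ (chartAt (Model m) x).source) (w : Model m) :
    chartDeriv x y (chartSymm x y w) = w :=
  Bundle.Trivialization.continuousLinearMapAt_symmL _ (by exact hy) w

/-- The extension has constant coordinates in the trivialization at `x`, and these are `v` itself
because that trivialization is the identity on the fibre over `x`. -/
theorem ext_eq_chartSymm {x y : M} (hy : y ∈ (chartAt (Model m) x).source)
    (v : TangentSpace (𝓡 m) x) : ext v y = chartSymm x y (v : Model m) := by
  have h : (trivializationAt (Model m) (TangentSpace (𝓡 m)) x ⟨x, v⟩).2 = (v : Model m) := by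
    exact ((trivializationAt (Model m) (TangentSpace (𝓡 m) : M → Type _)
      x).continuousLinearMapAt_apply_of_mem (R := ℝ) (mem_chart_source _ x) v).symm.trans
      (chartDeriv_self x v)
  have h2 : chartSymm x y (v : Model m) =
      (trivializationAt (Model m) (TangentSpace (𝓡 m)) x).symm y (v : Model m) :=
    Bundle.Trivialization.symmL_apply _ (by exact hy) _
  rw [h2]
  exact congrArg ((trivializationAt (Model m) (TangentSpace (𝓡 m)) x).symm y) h

theorem chartDeriv_ext {x y : M} (hy : y ∈ (chartAt (Model m) x).source)
    (v : TangentSpace (𝓡 m) x) : chartDeriv x y (ext v y) = (v : Model m) := by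
  rw [ext_eq_chartSymm hy]
  exact chartDeriv_chartSymm hy _

@[simp] theorem ext_self {x : M} (v : TangentSpace (𝓡 m) x) : ext v x = v :=
  FiberBundle.extend_apply_self ..

theorem chartSymm_eq_sum {x y : M} (v : Model m) :
    chartSymm x y v = ∑ i, v i • chartSymm x y (EuclideanSpace.single i (1 : ℝ)) := by
  simp only [← map_smul, ← map_sum]
  congr 1
  ext j
  simp [Pi.single_apply]

theorem contMDiffOn_ext {x : M} (v : TangentSpace (𝓡 m) x) :
    ContMDiffOn (𝓡 m) ((𝓡 m).prod 𝓘(ℝ, Model m)) ∞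
      (fun y ↦ (TotalSpace.mk' (Model m) y (ext v y) : TangentBundle (𝓡 m) M))
      (chartAt (Model m) x).source := by
  refine ((trivializationAt (Model m) (TangentSpace (𝓡 m) : M → Type _)
    x).contMDiffOn_section_baseSet_iff (IB := 𝓡 m) (n := ∞) (s := ext v)).2 ?_
  let w : Model m := v
  have hc : ContMDiffOn (𝓡 m) 𝓘(ℝ, Model m) ∞ (fun _ : M ↦ w)
    (chartAt (Model m) x).source := contMDiffOn_const
  refine hc.congr ?_
  intro y hy
  have h := chartDeriv_ext hy v
  unfold chartDeriv at h
  rwa [Bundle.Trivialization.continuousLinearMapAt_apply_of_mem _ _ hy] at h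

/-- A smooth bump function at `x`. -/
def bump (x : M) : SmoothBumpFunction (𝓡 m) x := Classical.arbitrary _

section T2
variable [T2Space M]

theorem bump_smooth (x : M) : SmoothFun (m := m) (bump (m := m) x) := (bump x).contMDiff

/-- A global smooth vector field with the same germ at `x` as `ext v`. -/
def gext {x : M} (v : TangentSpace (𝓡 m) x) : VField m M := (bump (m := m) x : M → ℝ) • ext v

theorem gext_smooth {x : M} (v : TangentSpace (𝓡 m) x) : (gext v).Smooth :=
  ContMDiffOn.smul_section_of_tsupport (bump_smooth x).contMDiffOn
    (chartAt (Model m) x).open_source (bump x).tsupport_subset_chartAt_source (contMDiffOn_ext v)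

theorem gext_eventuallyEq {x : M} (v : TangentSpace (𝓡 m) x) : gext v =ᶠ[𝓝 x] ext v := by
  filter_upwards [(bump (m := m) x).eventuallyEq_one] with y hy
  simp only [gext, Pi.smul_apply', hy, Pi.one_apply]
  exact one_smul ℝ _

@[simp] theorem gext_self {x : M} (v : TangentSpace (𝓡 m) x) : gext v x = v :=
  (gext_eventuallyEq v).self_of_nhds.trans (ext_self v)

/-- Cut-off coordinate functions of the preferred chart at `x`. -/
def coord (x : M) (i : Fin m) : M → ℝ := fun y ↦ bump (m := m) x y * extChartAt (𝓡 m) x y i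

theorem coord_smooth (x : M) (i : Fin m) : SmoothFun (m := m) (coord x i) := by
  have h : ContMDiffOn (𝓡 m) 𝓘(ℝ, ℝ) ∞ (fun y ↦ extChartAt (𝓡 m) x y i)
      (chartAt (Model m) x).source :=
    (EuclideanSpace.proj i : Model m →L[ℝ] ℝ).contMDiff.comp_contMDiffOn
      (contMDiffOn_extChartAt (I := 𝓡 m))
  exact (bump x).contMDiff_smul h

/-- A coordinate frame near `x`, cut off. -/
def frame (x : M) (i : Fin m) : VField m M := gext (stdVec x i)

/-- The coframe dual to `frame` near `x`. -/
def coframe (x : M) (i : Fin m) : OneForm m M := d (coord x i)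

theorem frame_smooth (x : M) (i : Fin m) : (frame x i).Smooth := gext_smooth _

theorem frame_eventually (x : M) : ∀ᶠ y : M in 𝓝 x, ∀ i : Fin m, frame x i y = ext (stdVec x i) y :=
  Filter.eventually_all.2 fun i ↦ gext_eventuallyEq (stdVec x i)

/-- Near `x` the bump function is identically one, so the cut-off coordinate has the differential of
the genuine coordinate. -/
theorem coframe_eventually (x : M) : ∀ᶠ y : M in 𝓝 x, ∀ (i : Fin m) (w : TangentSpace (𝓡 m) y),
    coframe x i y w = chartDeriv x y w i := by
  filter_upwards [(bump (m := m) x).eventuallyEq_one.eventuallyEq_nhds,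
    (chartAt (Model m) x).open_source.mem_nhds (mem_chart_source _ x)] with y hy hs i w
  have h1 : coord x i =ᶠ[𝓝 y]
      (EuclideanSpace.proj i : Model m →L[ℝ] ℝ) ∘ (extChartAt (𝓡 m) x) := by
    filter_upwards [hy] with z hz
    simp [coord, hz]
  have h2 := mvfderiv_comp_apply (I := 𝓡 m) (I' := 𝓘(ℝ, Model m)) y
    (g := (EuclideanSpace.proj i : Model m →L[ℝ] ℝ)) (f := extChartAt (𝓡 m) x)
    (EuclideanSpace.proj i : Model m →L[ℝ] ℝ).mdifferentiableAt (mdifferentiableAt_extChartAt hs) w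
  rw [coframe, d_congr h1, chartDeriv, TangentBundle.continuousLinearMapAt_trivializationAt hs]
  refine h2.trans ?_
  simp only [mvfderiv, ContinuousLinearMap.mfderiv_eq]
  rfl

theorem coframe_frame_eventually (x : M) : ∀ᶠ y : M in 𝓝 x, ∀ i j : Fin m,
    coframe x i y (frame x j y) = if i = j then 1 else 0 := by
  filter_upwards [coframe_eventually (m := m) x, frame_eventually (m := m) x,
    (chartAt (Model m) x).open_source.mem_nhds (mem_chart_source _ x)] with y hy hb hs i j
  rw [hy, hb, chartDeriv_ext hs]
  simp [stdVec]

theorem sum_coframe_frame_eventually (x : M) : ∀ᶠ y : M in 𝓝 x, ∀ w : TangentSpace (𝓡 m) y,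
    ∑ i, coframe x i y w • frame x i y = w := by
  filter_upwards [coframe_eventually (m := m) x, frame_eventually (m := m) x,
    (chartAt (Model m) x).open_source.mem_nhds (mem_chart_source _ x)] with y hy hb hs w
  refine Eq.trans ?_ (chartSymm_chartDeriv hs w)
  rw [chartSymm_eq_sum]
  refine Finset.sum_congr rfl fun i _ ↦ ?_
  rw [hb, hy, ext_eq_chartSymm hs]
  rfl

end T2

/-! ### Tensoriality on global smooth vector fields -/

/-- Additivity and homogeneity over smooth functions at the point `x`, for maps on smooth
vector fields. -/
structure TensorAt (x : M) (Φ : VField m M → ℝ) : Prop where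
  add : ∀ X Y : VField m M, X.Smooth → Y.Smooth → Φ (X + Y) = Φ X + Φ Y
  smul : ∀ (f : M → ℝ) (X : VField m M), SmoothFun (m := m) f → X.Smooth → Φ (f • X) = f x * Φ X

namespace TensorAt

variable {x : M} {Φ : VField m M → ℝ}

theorem zero (h : TensorAt x Φ) : Φ 0 = 0 := by
  have := h.add 0 0 .zero .zero
  rw [add_zero] at this
  linarith

theorem neg (h : TensorAt x Φ) {X : VField m M} (hX : X.Smooth) : Φ (-X) = -Φ X := by
  have := h.add X (-X) hX hX.neg
  rw [add_neg_cancel, h.zero] at this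
  linarith

theorem sub (h : TensorAt x Φ) {X Y : VField m M} (hX : X.Smooth) (hY : Y.Smooth) :
    Φ (X - Y) = Φ X - Φ Y := by
  rw [sub_eq_add_neg, h.add _ _ hX hY.neg, h.neg hY, sub_eq_add_neg]

theorem sum (h : TensorAt x Φ) {ι : Type*} (s : Finset ι) {X : ι → VField m M}
    (hX : ∀ i, (X i).Smooth) : Φ (fun y ↦ ∑ i ∈ s, X i y) = ∑ i ∈ s, Φ (X i) := by
  classical
  induction s using Finset.induction_on with
  | empty => simp only [Finset.sum_empty]; exact h.zero
  | insert a s ha ih =>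
    rw [Finset.sum_insert ha, ← ih, ← h.add _ _ (hX a) (.sum fun i _ ↦ hX i)]
    congr 1
    funext y
    exact Finset.sum_insert ha

variable [T2Space M]

/-- Homogeneity over functions forces locality: a bump supported where `X` vanishes annihilates `X`
but equals one at `x`. -/
theorem eq_zero_of_eventuallyEq (h : TensorAt x Φ) {X : VField m M} (hX : X.Smooth)
    (h0 : ∀ᶠ y in 𝓝 x, X y = 0) : Φ X = 0 := by
  obtain ⟨f, -, hf⟩ := (SmoothBumpFunction.nhds_basis_support (I := 𝓡 m) h0).mem_iff.1 h0
  have hfX : (f : M → ℝ) • X = 0 := by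
    funext y
    by_cases hy : y ∈ Function.support f
    · have := hf hy
      simp only [Set.mem_ofPred_eq] at this
      simp [this]
    · simp [Function.notMem_support.1 hy]
  have := h.smul f X f.contMDiff hX
  rw [hfX, h.zero, f.eq_one, one_mul] at this
  exact this.symm

theorem congr_of_eventuallyEq (h : TensorAt x Φ) {X Y : VField m M} (hX : X.Smooth)
    (hY : Y.Smooth) (h0 : ∀ᶠ y in 𝓝 x, X y = Y y) : Φ X = Φ Y := by
  refine sub_eq_zero.1 ((h.sub hX hY).symm.trans (h.eq_zero_of_eventuallyEq (hX.sub hY) ?_))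
  filter_upwards [h0] with y hy
  simp [hy]

/-- The coefficients `X(xⁱ)` are global smooth functions, and near `x` the field is the
corresponding combination of frame fields; locality and homogeneity then leave only values at `x`.
-/
theorem eq_sum (h : TensorAt x Φ) {X : VField m M} (hX : X.Smooth) :
    Φ X = ∑ i, coframe x i x (X x) * Φ (frame x i) := by
  have hs : ∀ i, VField.Smooth ((dir X (coord x i)) • frame x i) := fun i ↦
    (frame_smooth x i).smul (dir_smooth hX (coord_smooth x i))
  rw [h.congr_of_eventuallyEq hX (.sum (s := Finset.univ) fun i _ ↦ hs i), h.sum _ hs]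
  · exact Finset.sum_congr rfl fun i _ ↦
      h.smul _ _ (dir_smooth hX (coord_smooth x i)) (frame_smooth x i)
  · filter_upwards [sum_coframe_frame_eventually (m := m) x] with y hy
    exact (hy (X y)).symm

theorem congr (h : TensorAt x Φ) {X Y : VField m M} (hX : X.Smooth) (hY : Y.Smooth)
    (hXY : X x = Y x) : Φ X = Φ Y := by
  rw [h.eq_sum hX, h.eq_sum hY, hXY]

end TensorAt

/-- Maps on pairs of smooth vector fields that are tensorial at `x` in both arguments. -/
structure BitensorAt (x : M) (Φ : VField m M → VField m M → ℝ) : Prop where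
  left : ∀ Y : VField m M, Y.Smooth → TensorAt x (fun X ↦ Φ X Y)
  right : ∀ X : VField m M, X.Smooth → TensorAt x (Φ X)

/-! ### Smoothness criteria -/

section HomSection

variable {F₂ : Type*} [NormedAddCommGroup F₂] [NormedSpace ℝ F₂] {E₂ : M → Type*}
  [∀ x, AddCommGroup (E₂ x)] [∀ x, Module ℝ (E₂ x)] [∀ x, TopologicalSpace (E₂ x)]
  [TopologicalSpace (TotalSpace F₂ E₂)] [FiberBundle F₂ E₂] [VectorBundle ℝ F₂ E₂]
  [∀ x, IsTopologicalAddGroup (E₂ x)] [∀ x, ContinuousSMul ℝ (E₂ x)]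
  [ContMDiffVectorBundle ∞ F₂ E₂ (𝓡 m)]

/-- A bundle map is determined near `x` by its values on the finitely many frame fields. The target
bundle is kept general to serve both one-forms and the endomorphism fields `∇Y`. -/
theorem contMDiff_hom_of_apply [T2Space M] (φ : ∀ x : M, TangentSpace (𝓡 m) x →L[ℝ] E₂ x)
    (h : ∀ X : VField m M, X.Smooth →
      ContMDiff (𝓡 m) ((𝓡 m).prod 𝓘(ℝ, F₂)) ∞ (fun x ↦ TotalSpace.mk' F₂ x (φ x (X x)))) :
    ContMDiff (𝓡 m) ((𝓡 m).prod 𝓘(ℝ, Model m →L[ℝ] F₂)) ∞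
      (fun x ↦ TotalSpace.mk' (Model m →L[ℝ] F₂)
        (E := fun x : M ↦ TangentSpace (𝓡 m) x →L[ℝ] E₂ x) x (φ x)) := by
  intro x
  refine (contMDiffAt_hom_bundle _).2 ⟨contMDiffAt_id, ?_⟩
  have h1 : ∀ i, ContMDiffAt (𝓡 m) 𝓘(ℝ, F₂) ∞
      (fun y ↦ (trivializationAt F₂ E₂ x ⟨y, φ y (frame x i y)⟩).2) x := fun i ↦
    (contMDiffAt_totalSpace.1 (h _ (frame_smooth x i) x)).2
  -- The coordinate matrix is rebuilt as the sum of the coordinate projections tensored with the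
  -- images of the frame.
  have h2 : ContMDiffAt (𝓡 m) 𝓘(ℝ, Model m →L[ℝ] F₂) ∞ (fun y ↦ ∑ i : Fin m,
      ContinuousLinearMap.smulRightL ℝ (Model m) F₂ (EuclideanSpace.proj i : Model m →L[ℝ] ℝ)
        (trivializationAt F₂ E₂ x ⟨y, φ y (frame x i y)⟩).2) x :=
    ContMDiffAt.sum fun i _ ↦ (ContinuousLinearMap.contMDiff _).contMDiffAt.comp x (h1 i)
  refine h2.congr_of_eventuallyEq ?_
  filter_upwards [frame_eventually (m := m) x,
    (chartAt (Model m) x).open_source.mem_nhds (mem_chart_source _ x),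
    (trivializationAt F₂ E₂ x).open_baseSet.mem_nhds
      (FiberBundle.mem_baseSet_trivializationAt' x)] with y hf hs hb
  ext w
  have h3 : ∀ i : Fin m, (trivializationAt F₂ E₂ x ⟨y, φ y (frame x i y)⟩).2 =
      (trivializationAt F₂ E₂ x).continuousLinearMapAt ℝ y
        (φ y (chartSymm x y (EuclideanSpace.single i (1 : ℝ)))) := fun i ↦ by
    rw [(trivializationAt F₂ E₂ x).continuousLinearMapAt_apply_of_mem ℝ hb, hf i,
      ext_eq_chartSymm hs]
    rfl
  have h4 : ContinuousLinearMap.inCoordinates (Model m) (fun x : M ↦ TangentSpace (𝓡 m) x)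
      F₂ E₂ x y x y (φ y) w = (trivializationAt F₂ E₂ x).continuousLinearMapAt ℝ y
        (φ y (chartSymm x y w)) := rfl
  refine h4.trans ?_
  rw [chartSymm_eq_sum]
  simp [h3]

end HomSection

theorem OneForm.smooth_of_apply [T2Space M] {α : OneForm m M}
    (h : ∀ X : VField m M, X.Smooth → SmoothFun (m := m) (fun x ↦ α x (X x))) : α.Smooth :=
  contMDiff_hom_of_apply (E₂ := Bundle.Trivial M ℝ) α fun X hX x ↦
    contMDiffAt_totalSpace.2 ⟨contMDiffAt_id, h X hX x⟩

theorem d_smooth [T2Space M] {f : M → ℝ} (hf : SmoothFun (m := m) f) :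
    OneForm.Smooth (d (m := m) f) :=
  OneForm.smooth_of_apply fun _ hX ↦ dir_smooth hX hf

theorem Conn.Smooth.along {D : Conn m M} (hD : D.Smooth) {X Y : VField m M} (hX : X.Smooth)
    (hY : Y.Smooth) : (D.along X Y).Smooth := by
  have h1 : ContMDiff (𝓡 m) ((𝓡 m).prod 𝓘(ℝ, Model m →L[ℝ] Model m)) ∞
      (fun x ↦ TotalSpace.mk' (Model m →L[ℝ] Model m)
        (E := fun x : M ↦ TangentSpace (𝓡 m) x →L[ℝ] TangentSpace (𝓡 m) x) x (D Y x)) :=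
    contMDiffOn_univ.1 (hD.contMDiff.contMDiff (by
      simpa using contMDiffOn_univ.2 hY))
  exact ContMDiff.clm_bundle_apply (F₁ := Model m) (F₂ := Model m)
    (E₁ := fun x : M ↦ TangentSpace (𝓡 m) x) (E₂ := fun x : M ↦ TangentSpace (𝓡 m) x) h1 hX

theorem Conn.smooth_of_along [T2Space M] {D : Conn m M}
    (h : ∀ X Y : VField m M, X.Smooth → Y.Smooth → (D.along X Y).Smooth) : D.Smooth where
  contMDiff := {
    contMDiff := fun hY ↦ contMDiffOn_univ.2 (contMDiff_hom_of_apply _ fun X hX ↦ h X _ hX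
      (contMDiffOn_univ.1 (by simpa using hY))) }

/-! ### Inverting the metric -/

/-- The components of `W` solve a linear system whose matrix is the Gram matrix of the frame and
whose right-hand side is smooth; inversion of operators is smooth. -/
theorem VField.smooth_of_inner [T2Space M] (g : Metric m M) {W : VField m M}
    (h : ∀ X : VField m M, X.Smooth → SmoothFun (m := m) (fun x ↦ g.inner x (W x) (X x))) :
    W.Smooth := by
  intro x
  -- `T y` is the Gram matrix at `y` acting on coordinates, and `b y` collects the products of `W`
  -- with the frame.
  let T : M → Model m →L[ℝ] Model m := fun y ↦ ∑ i, ∑ j,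
    g.inner y (frame x i y) (frame x j y) •
      (EuclideanSpace.proj j : Model m →L[ℝ] ℝ).smulRight (EuclideanSpace.single i (1 : ℝ))
  let b : M → Model m := fun y ↦ ∑ i, g.inner y (W y) (frame x i y) • EuclideanSpace.single i (1 : ℝ)
  have hT : ContMDiff (𝓡 m) 𝓘(ℝ, Model m →L[ℝ] Model m) ∞ T :=
    ContMDiff.sum fun i _ ↦ ContMDiff.sum fun j _ ↦
      (metric_smooth g (frame_smooth x i) (frame_smooth x j)).smul contMDiff_const
  have hb : ContMDiff (𝓡 m) 𝓘(ℝ, Model m) ∞ b :=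
    ContMDiff.sum fun i _ ↦ (h _ (frame_smooth x i)).smul contMDiff_const
  have hTi : ∀ y i (v : Model m), T y v i =
      g.inner y (frame x i y) (∑ j, v j • frame x j y) := fun y i v ↦ by
    simp only [T, FunLike.coe_sum, Finset.sum_apply, FunLike.coe_smul, Pi.smul_apply,
      WithLp.ofLp_sum, WithLp.ofLp_smul, ContinuousLinearMap.smulRight_apply, map_sum, map_smul]
    rw [Finset.sum_comm]
    simp [mul_comm]
  have hbi : ∀ y i, b y i = g.inner y (frame x i y) (W y) := fun y i ↦ by
    rw [g.symm]
    simp [b, Finset.sum_apply, Pi.single_apply]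
  have hinj : ∀ y, (∀ i j : Fin m, coframe x i y (frame x j y) = if i = j then 1 else 0) →
      Function.Injective (T y) := fun y hy ↦ by
    refine (injective_iff_map_eq_zero _).2 fun v hv ↦ ?_
    have h1 : g.inner y (∑ j, v j • frame x j y) (∑ j, v j • frame x j y) = 0 := by
      rw [map_sum (g.inner y (∑ j, v j • frame x j y))]
      refine Finset.sum_eq_zero fun i _ ↦ ?_
      rw [map_smul, g.symm, ← hTi, hv]
      simp
    have h2 : ∑ j, v j • frame x j y = 0 := by
      by_contra hne
      exact (g.pos y _ hne).ne' h1
    ext i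
    have h3 := congrArg (coframe x i y) h2
    simpa [hy] using h3
  have hinv : ∀ y, (∀ i j : Fin m, coframe x i y (frame x j y) = if i = j then 1 else 0) →
      (T y).IsInvertible := fun y hy ↦
    ⟨(LinearEquiv.ofInjectiveEndo (T y).toLinearMap (hinj y hy)).toContinuousLinearEquiv, rfl⟩
  have hc : ContMDiffAt (𝓡 m) 𝓘(ℝ, Model m) ∞ (fun y ↦ (T y).inverse (b y)) x := by
    have h1 : ContMDiffAt (𝓡 m) 𝓘(ℝ, Model m →L[ℝ] Model m) ∞ (fun y ↦ (T y).inverse) x :=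
      ((hinv x (coframe_frame_eventually (m := m) x).self_of_nhds).contDiffAt_map_inverse
        (n := ∞)).contMDiffAt.comp x (hT x)
    exact h1.clm_apply (hb x)
  have hW : ∀ᶠ y in 𝓝 x, W y = ∑ i, (T y).inverse (b y) i • frame x i y := by
    filter_upwards [coframe_frame_eventually (m := m) x,
      sum_coframe_frame_eventually (m := m) x] with y h1 h2
    have h3 : T y (WithLp.toLp 2 fun i ↦ coframe x i y (W y)) = b y := by
      ext i
      rw [hTi, hbi]
      exact congrArg (g.inner y (frame x i y)) (h2 (W y))
    rw [← h3, (hinv y h1).inverse_apply_self]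
    exact (h2 (W y)).symm
  have hs : ContMDiffAt (𝓡 m) ((𝓡 m).prod 𝓘(ℝ, Model m)) ∞
      (fun y ↦ (TotalSpace.mk' (Model m) y (∑ i, (T y).inverse (b y) i • frame x i y) :
        TangentBundle (𝓡 m) M)) x := by
    refine ContMDiffAt.sum_section fun i _ ↦ ContMDiffAt.smul_section ?_ (frame_smooth x i x)
    exact (EuclideanSpace.proj i : Model m →L[ℝ] ℝ).contMDiff.contMDiffAt.comp x hc
  refine hs.congr_of_eventuallyEq ?_
  filter_upwards [hW] with y hy
  rw [hy]

/-! ### The horizontal bundle and its trace -/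

namespace HorizontalMetric

variable {M : Type*} [TopologicalSpace M] [ChartedSpace (Model m) M] (S : HorizontalMetric m M)
  {x : M}

/-- Positivity of `g_H` makes the vector representing a covector on `H_x` unique; linearity of `♯^H`
follows from this. -/
theorem eq_sharp {α : TangentSpace (𝓡 m) x →L[ℝ] ℝ} {v : TangentSpace (𝓡 m) x} (hv : v ∈ S.H x)
    (h : ∀ w : S.H x, S.gH x ⟨v, hv⟩ w = α w) : v = S.sharp x α := by
  have h1 : (⟨v, hv⟩ : S.H x) - ⟨S.sharp x α, S.sharp_mem x α⟩ = 0 := by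
    by_contra hne
    have := S.pos x _ hne
    rw [LinearMap.map_sub₂, h, S.gH_sharp, sub_self] at this
    exact lt_irrefl _ this
  exact congrArg Subtype.val (sub_eq_zero.1 h1)

theorem sharp_add (α β : TangentSpace (𝓡 m) x →L[ℝ] ℝ) :
    S.sharp x (α + β) = S.sharp x α + S.sharp x β := by
  refine (S.eq_sharp (Submodule.add_mem _ (S.sharp_mem x α) (S.sharp_mem x β)) fun w ↦ ?_).symm
  have : (⟨S.sharp x α + S.sharp x β, Submodule.add_mem _ (S.sharp_mem x α) (S.sharp_mem x β)⟩ :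
    S.H x) = ⟨S.sharp x α, S.sharp_mem x α⟩ + ⟨S.sharp x β, S.sharp_mem x β⟩ := rfl
  rw [this, map_add, LinearMap.add_apply, S.gH_sharp, S.gH_sharp]
  rfl

theorem sharp_smul (c : ℝ) (α : TangentSpace (𝓡 m) x →L[ℝ] ℝ) :
    S.sharp x (c • α) = c • S.sharp x α := by
  refine (S.eq_sharp (Submodule.smul_mem _ c (S.sharp_mem x α)) fun w ↦ ?_).symm
  have : (⟨c • S.sharp x α, Submodule.smul_mem _ c (S.sharp_mem x α)⟩ :
    S.H x) = c • ⟨S.sharp x α, S.sharp_mem x α⟩ := rfl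
  rw [this, map_smul, LinearMap.smul_apply, S.gH_sharp]
  rfl

theorem sharp_eq_zero {α : TangentSpace (𝓡 m) x →L[ℝ] ℝ} (h : ∀ w ∈ S.H x, α w = 0) :
    S.sharp x α = 0 :=
  (S.eq_sharp (Submodule.zero_mem _) fun w ↦ by
    have : (⟨0, Submodule.zero_mem _⟩ : S.H x) = 0 := rfl
    rw [this, map_zero, h w w.2]
    rfl).symm

theorem cometric_comm (α β : TangentSpace (𝓡 m) x →L[ℝ] ℝ) :
    S.cometric x α β = S.cometric x β α := S.symm _ _ _

theorem cometric_eq_left (α β : TangentSpace (𝓡 m) x →L[ℝ] ℝ) :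
    S.cometric x α β = α (S.sharp x β) := S.gH_sharp x α ⟨S.sharp x β, S.sharp_mem x β⟩

theorem cometric_eq_right (α β : TangentSpace (𝓡 m) x →L[ℝ] ℝ) :
    S.cometric x α β = β (S.sharp x α) := by rw [cometric_comm, cometric_eq_left]

theorem trace_add (ξ η : TangentSpace (𝓡 m) x → TangentSpace (𝓡 m) x → ℝ) :
    S.trace x (fun u w ↦ ξ u w + η u w) = S.trace x ξ + S.trace x η := by
  simp only [trace, mul_add, Finset.sum_add_distrib]

theorem trace_sub (ξ η : TangentSpace (𝓡 m) x → TangentSpace (𝓡 m) x → ℝ) :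
    S.trace x (fun u w ↦ ξ u w - η u w) = S.trace x ξ - S.trace x η := by
  simp only [trace, mul_sub, Finset.sum_sub_distrib]

theorem trace_eq_zero {ξ : TangentSpace (𝓡 m) x → TangentSpace (𝓡 m) x → ℝ}
    (h : ∀ u w, ξ u w = -ξ w u) : S.trace x ξ = 0 := by
  have h1 : S.trace x ξ = -S.trace x ξ := by
    conv_lhs => rw [trace, Finset.sum_comm]
    simp only [trace, ← Finset.sum_neg_distrib]
    refine Finset.sum_congr rfl fun i _ ↦ Finset.sum_congr rfl fun j _ ↦ ?_
    rw [S.cometric_comm, h]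
    ring
  linarith

/-- A horizontal orthogonal basis diagonalizing the cometric. -/
theorem exists_cometric_eq_sum (x : M) : ∃ (n : ℕ) (b : Fin n → TangentSpace (𝓡 m) x)
    (c : Fin n → ℝ), (∀ i, b i ∈ S.H x) ∧ (∀ i, 0 < c i) ∧
      ∀ α β : TangentSpace (𝓡 m) x →L[ℝ] ℝ, S.cometric x α β = ∑ i, c i * (α (b i) * β (b i)) := by
  obtain ⟨v, hv⟩ := LinearMap.BilinForm.exists_orthogonal_basis (B := S.gH x)
    ⟨fun a b ↦ S.symm x a b⟩
  have hpos : ∀ i, 0 < S.gH x (v i) (v i) := fun i ↦ S.pos x _ (v.ne_zero i)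
  -- The basis is orthogonal but not normalized, so each weight is the inverse of a squared length.
  refine ⟨_, fun i ↦ v i, fun i ↦ (S.gH x (v i) (v i))⁻¹, fun i ↦ (v i).2,
    fun i ↦ inv_pos.2 (hpos i), fun α β ↦ ?_⟩
  have h1 : (⟨S.sharp x α, S.sharp_mem x α⟩ : S.H x) =
      ∑ i, ((S.gH x (v i) (v i))⁻¹ * α (v i)) • v i := by
    conv_lhs => rw [← v.sum_repr ⟨S.sharp x α, S.sharp_mem x α⟩]
    refine Finset.sum_congr rfl fun i _ ↦ ?_
    congr 1
    have h2 := S.gH_sharp x α (v i)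
    rw [← v.sum_repr ⟨S.sharp x α, S.sharp_mem x α⟩, map_sum, LinearMap.sum_apply,
      Finset.sum_eq_single i] at h2
    · rw [map_smul, LinearMap.smul_apply, smul_eq_mul] at h2
      rw [← h2]
      field_simp [(hpos i).ne']
    · intro j _ hj
      rw [map_smul, LinearMap.smul_apply, hv hj, smul_zero]
    · simp
  have h3 := congrArg (fun w : S.H x ↦ β w) h1
  rw [cometric_eq_right]
  refine h3.trans ?_
  simp [mul_assoc]

end HorizontalMetric

theorem sum_comm₄ {ι κ : Type*} [Fintype ι] [Fintype κ] (F : ι → ι → κ → κ → ℝ) :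
    ∑ i, ∑ j, ∑ k, ∑ l, F i j k l = ∑ k, ∑ l, ∑ i, ∑ j, F i j k l := by
  calc _ = ∑ i, ∑ k, ∑ j, ∑ l, F i j k l :=
        Finset.sum_congr rfl fun i _ ↦ Finset.sum_comm
    _ = ∑ k, ∑ i, ∑ l, ∑ j, F i j k l := by
        rw [Finset.sum_comm]
        exact Finset.sum_congr rfl fun k _ ↦ Finset.sum_congr rfl fun i _ ↦ Finset.sum_comm
    _ = _ := Finset.sum_congr rfl fun k _ ↦ Finset.sum_comm

section Frames

variable [T2Space M] (S : SubRiemannianStructure m M)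

theorem coframe_self (x : M) (i : Fin m) : coframe x i x = stdCovec x i := by
  ext v
  refine ((coframe_eventually (m := m) x).self_of_nhds i v).trans ?_
  rw [chartDeriv_self]
  rfl

theorem trace_gext {x : M} {Φ : VField m M → VField m M → ℝ} :
    S.trace x (fun u w ↦ Φ (gext u) (gext w)) =
      ∑ i, ∑ j, S.cometric x (coframe x i x) (coframe x j x) * Φ (frame x i) (frame x j) := by
  simp only [HorizontalMetric.trace, coframe_self, frame]

/-- Any fields whose values represent the cometric at `x` compute the trace of a bitensor. It is
applied to the coordinate frame of a nearby point and to a diagonalizing horizontal basis. -/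
theorem trace_eq_sum {ι : Type*} [Fintype ι] {x : M} {Φ : VField m M → VField m M → ℝ}
    (hΦ : BitensorAt x Φ) {E : ι → VField m M} (hE : ∀ k, (E k).Smooth) {c : ι → ι → ℝ}
    (hc : ∀ α β, S.cometric x α β = ∑ k, ∑ l, c k l * (α (E k x) * β (E l x))) :
    S.trace x (fun u w ↦ Φ (gext u) (gext w)) = ∑ k, ∑ l, c k l * Φ (E k) (E l) := by
  rw [trace_gext]
  have h1 : ∀ k l, Φ (E k) (E l) = ∑ i, ∑ j,
      coframe x i x (E k x) * coframe x j x (E l x) * Φ (frame x i) (frame x j) := fun k l ↦ by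
    rw [(hΦ.left _ (hE l)).eq_sum (hE k)]
    refine Finset.sum_congr rfl fun i _ ↦ ?_
    rw [(hΦ.right _ (frame_smooth x i)).eq_sum (hE l), Finset.mul_sum]
    exact Finset.sum_congr rfl fun j _ ↦ by ring
  simp only [h1, hc, Finset.mul_sum, Finset.sum_mul]
  rw [sum_comm₄]
  exact Finset.sum_congr rfl fun k _ ↦ Finset.sum_congr rfl fun l _ ↦
    Finset.sum_congr rfl fun i _ ↦ Finset.sum_congr rfl fun j _ ↦ by ring

theorem cometric_frame_eventually (x : M) : ∀ᶠ y : M in 𝓝 x, ∀ α β, S.cometric y α β =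
    ∑ k, ∑ l, S.cometric y (coframe x k y) (coframe x l y) *
      (α (frame x k y) * β (frame x l y)) := by
  filter_upwards [sum_coframe_frame_eventually (m := m) x] with y hy α β
  have h1 : ∀ γ : TangentSpace (𝓡 m) y →L[ℝ] ℝ, γ = ∑ k, γ (frame x k y) • coframe x k y := by
    intro γ
    ext w
    conv_lhs => rw [← hy w]
    simp [mul_comm]
  have h2 : ∀ w : TangentSpace (𝓡 m) y, ∀ γ : TangentSpace (𝓡 m) y →L[ℝ] ℝ,
      γ w = ∑ k, γ (frame x k y) * coframe x k y w := fun w γ ↦ by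
    conv_lhs => rw [h1 γ]
    simp
  rw [S.cometric_eq_left, h2]
  refine Finset.sum_congr rfl fun k _ ↦ ?_
  rw [← S.cometric_eq_left, S.cometric_eq_right, h2 _ β, Finset.mul_sum]
  refine Finset.sum_congr rfl fun l _ ↦ ?_
  rw [← S.cometric_eq_right]
  ring

/-- The trace at `y` is defined through the chart at `y`. Expressing it in the fixed frame based at
`x` gives a formula that can be differentiated in `y`. -/
theorem trace_eventually (x : M) : ∀ᶠ y : M in 𝓝 x, ∀ Φ : VField m M → VField m M → ℝ,
    BitensorAt y Φ → S.trace y (fun u w ↦ Φ (gext u) (gext w)) =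
      ∑ k, ∑ l, S.cometric y (coframe x k y) (coframe x l y) * Φ (frame x k) (frame x l) := by
  filter_upwards [cometric_frame_eventually S x] with y hy Φ hΦ
  exact trace_eq_sum S hΦ (frame_smooth x) hy

end Frames

/-! ### Orthogonal projections -/

section Projections

variable {S : SubRiemannianStructure m M} {g : Metric m M}

theorem prH_smooth (S : SubRiemannianStructure m M) (g : Metric m M) {X : VField m M}
    (hX : X.Smooth) : (prH S g X).Smooth := S.smooth _ (flat_smooth g hX)

theorem prV_smooth (S : SubRiemannianStructure m M) (g : Metric m M) {X : VField m M}
    (hX : X.Smooth) : (prV S g X).Smooth := hX.sub (prH_smooth S g hX)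

theorem prH_mem (S : SubRiemannianStructure m M) (g : Metric m M) (X : VField m M) (x : M) :
    prH S g X x ∈ S.H x := S.sharp_mem _ _

theorem prH_add_prV (S : SubRiemannianStructure m M) (g : Metric m M) (X : VField m M) :
    prH S g X + prV S g X = X := by
  funext x
  exact add_sub_cancel _ _

theorem prH_add (X Y : VField m M) : prH S g (X + Y) = prH S g X + prH S g Y := by
  funext x
  simp only [prH, Pi.add_apply, map_add]
  exact S.sharp_add _ _

theorem prH_smul (f : M → ℝ) (X : VField m M) : prH S g (f • X) = f • prH S g X := by
  funext x
  simp only [prH, Pi.smul_apply', map_smul]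
  exact S.sharp_smul _ _

theorem prV_add (X Y : VField m M) : prV S g (X + Y) = prV S g X + prV S g Y := by
  funext x
  have := congrFun (prH_add (S := S) (g := g) X Y) x
  simp only [prV, Pi.add_apply] at this ⊢
  rw [this]
  abel

theorem prV_smul (f : M → ℝ) (X : VField m M) : prV S g (f • X) = f • prV S g X := by
  funext x
  have := congrFun (prH_smul (S := S) (g := g) f X) x
  simp only [prV, Pi.smul_apply'] at this ⊢
  rw [this, smul_sub]

theorem inner_sharp (hg : Tames S g) (x : M) (α : TangentSpace (𝓡 m) x →L[ℝ] ℝ)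
    {w : TangentSpace (𝓡 m) x} (hw : w ∈ S.H x) : g.inner x (S.sharp x α) w = α w :=
  (hg x ⟨_, S.sharp_mem x α⟩ ⟨w, hw⟩).trans (S.gH_sharp x α ⟨w, hw⟩)

theorem eq_of_inner {x : M} {u v : TangentSpace (𝓡 m) x}
    (h : ∀ w, g.inner x u w = g.inner x v w) : u = v := by
  by_contra hne
  refine (g.pos x (u - v) (sub_ne_zero.2 hne)).ne' ?_
  rw [ContinuousLinearMap.map_sub₂, h, sub_self]

theorem prV_eq_zero (hg : Tames S g) {X : VField m M} {x : M} (hX : X x ∈ S.H x) :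
    prV S g X x = 0 := sub_eq_zero.2 (prH_of_mem hg X x hX).symm

theorem prH_eq_zero {X : VField m M} {x : M}
    (hX : ∀ w ∈ S.H x, g.inner x (X x) w = 0) : prH S g X x = 0 :=
  S.sharp_eq_zero hX

theorem mem_H_iff (hg : Tames S g) {X : VField m M} {x : M} :
    X x ∈ S.H x ↔ prV S g X x = 0 :=
  ⟨prV_eq_zero hg, fun h ↦ by rw [sub_eq_zero.1 h]; exact S.sharp_mem _ _⟩

theorem inner_prH_prV (hg : Tames S g) (X Y : VField m M) (x : M) :
    g.inner x (prH S g X x) (prV S g Y x) = 0 := by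
  rw [g.symm]
  exact inner_prV hg Y x (prH_mem S g X x)

theorem inner_prV_prH (hg : Tames S g) (X Y : VField m M) (x : M) :
    g.inner x (prV S g X x) (prH S g Y x) = 0 := inner_prV hg X x (prH_mem S g Y x)

theorem prH_prH (hg : Tames S g) (X : VField m M) : prH S g (prH S g X) = prH S g X :=
  funext fun x ↦ prH_of_mem hg _ x (prH_mem S g X x)

theorem prV_prH (hg : Tames S g) (X : VField m M) : prV S g (prH S g X) = 0 :=
  funext fun x ↦ prV_eq_zero hg (prH_mem S g X x)

theorem prH_prV (hg : Tames S g) (X : VField m M) : prH S g (prV S g X) = 0 :=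
  funext fun x ↦ prH_eq_zero fun _ hw ↦ inner_prV hg X x hw

theorem prV_prV (hg : Tames S g) (X : VField m M) : prV S g (prV S g X) = prV S g X :=
  funext fun x ↦ by
    have := congrFun (prH_prV hg X) x
    change prV S g X x - prH S g (prV S g X) x = _
    rw [this]
    exact sub_zero _

theorem inner_split (hg : Tames S g) (X Y : VField m M) (x : M) :
    g.inner x (X x) (Y x) = g.inner x (prH S g X x) (prH S g Y x)
      + g.inner x (prV S g X x) (prV S g Y x) := by
  have h1 : ∀ Z : VField m M, Z x = prH S g Z x + prV S g Z x := fun Z ↦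
    (congrFun (prH_add_prV S g Z) x).symm
  conv_lhs => rw [h1 X, h1 Y]
  simp only [map_add, FunLike.coe_add, Pi.add_apply, inner_prH_prV hg, inner_prV_prH hg]
  ring

theorem inner_prH_left (hg : Tames S g) (X Y : VField m M) (x : M) :
    g.inner x (prH S g X x) (Y x) = g.inner x (X x) (prH S g Y x) := by
  rw [inner_split hg, inner_split hg X, prV_prH hg, prV_prH hg, prH_prH hg, prH_prH hg]
  simp

theorem inner_prV_left (hg : Tames S g) (X Y : VField m M) (x : M) :
    g.inner x (prV S g X x) (Y x) = g.inner x (X x) (prV S g Y x) := by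
  rw [inner_split hg, inner_split hg X, prV_prV hg, prV_prV hg, prH_prV hg, prH_prV hg]
  simp

end Projections

/-! ### Calculus of derivatives, brackets and connections on smooth vector fields -/

section DirRules

variable {X Y : VField m M} {u v f : M → ℝ} {x : M}

theorem dir_add_fun (hu : SmoothFun (m := m) u) (hv : SmoothFun (m := m) v) :
    dir X (fun y ↦ u y + v y) x = dir X u x + dir X v x := by
  simp only [dir, d_add (hu.mdiffAt x) (hv.mdiffAt x)]
  rfl

theorem dir_sub_fun (hu : SmoothFun (m := m) u) (hv : SmoothFun (m := m) v) :
    dir X (fun y ↦ u y - v y) x = dir X u x - dir X v x := by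
  simp only [dir, d_sub (hu.mdiffAt x) (hv.mdiffAt x)]
  rfl

theorem dir_mul_fun (hu : SmoothFun (m := m) u) (hv : SmoothFun (m := m) v) :
    dir X (fun y ↦ u y * v y) x = u x * dir X v x + v x * dir X u x := by
  simp only [dir, d_mul (hu.mdiffAt x) (hv.mdiffAt x)]
  rfl

theorem dir_add_field : dir (X + Y) f x = dir X f x + dir Y f x :=
  map_add (d f x) _ _

theorem dir_smul_field : dir (u • X) f x = u x * dir X f x :=
  map_smul (d f x) _ _

theorem SmoothFun.add (hu : SmoothFun (m := m) u) (hv : SmoothFun (m := m) v) :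
    SmoothFun (m := m) (fun y ↦ u y + v y) := ContMDiff.add hu hv

theorem SmoothFun.sub (hu : SmoothFun (m := m) u) (hv : SmoothFun (m := m) v) :
    SmoothFun (m := m) (fun y ↦ u y - v y) := ContMDiff.sub hu hv

theorem SmoothFun.mul (hu : SmoothFun (m := m) u) (hv : SmoothFun (m := m) v) :
    SmoothFun (m := m) (fun y ↦ u y * v y) := ContMDiff.mul hu hv

end DirRules

section BracketRules

variable {X Y Z : VField m M} {f : M → ℝ}

theorem bracket_smul_left (hf : SmoothFun (m := m) f) (hX : X.Smooth) :
    VectorField.mlieBracket (𝓡 m) (f • X) Y = f • VectorField.mlieBracket (𝓡 m) X Y - dir Y f • X := by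
  have : IsManifold (𝓡 m) 2 M := inferInstance
  funext x
  refine (VectorField.mlieBracket_smul_left (hf.mdiffAt x) (hX.mdiffAt x)).trans ?_
  simp only [Pi.sub_apply, Pi.smul_apply', dir, d, neg_smul]
  abel

theorem bracket_add_left (hX : X.Smooth) (hZ : Z.Smooth) :
    VectorField.mlieBracket (𝓡 m) (X + Z) Y =
      VectorField.mlieBracket (𝓡 m) X Y + VectorField.mlieBracket (𝓡 m) Z Y :=
  funext fun x ↦ VectorField.mlieBracket_add_left (hX.mdiffAt x) (hZ.mdiffAt x)

theorem bracket_swap (X Y : VField m M) :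
    VectorField.mlieBracket (𝓡 m) X Y = -VectorField.mlieBracket (𝓡 m) Y X :=
  funext fun _ ↦ VectorField.mlieBracket_swap_apply

end BracketRules

namespace Conn

variable (D : Conn m M) {X Y Z X' Y' : VField m M} {f : M → ℝ}

theorem along_add_right (hY : Y.Smooth) (hZ : Z.Smooth) :
    D.along X (Y + Z) = D.along X Y + D.along X Z := by
  funext x
  simp only [along, D.isCovariantDerivativeOnUniv.add (hY.mdiffAt x) (hZ.mdiffAt x)]
  rfl

theorem along_smul_right (hf : SmoothFun (m := m) f) (hY : Y.Smooth) :
    D.along X (f • Y) = f • D.along X Y + dir X f • Y := by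
  funext x
  simp only [along, D.isCovariantDerivativeOnUniv.leibniz (hY.mdiffAt x) (hf.mdiffAt x)]
  rfl

theorem along_add_left : D.along (X + Z) Y = D.along X Y + D.along Z Y :=
  funext fun x ↦ map_add (D Y x) _ _

theorem along_smul_left : D.along (f • X) Y = f • D.along X Y :=
  funext fun x ↦ map_smul (D Y x) _ _

theorem along_sub_left : D.along (X - Z) Y = D.along X Y - D.along Z Y :=
  funext fun x ↦ map_sub (D Y x) _ _

theorem along_neg_right (hY : Y.Smooth) : D.along X (-Y) = -D.along X Y := by
  have h : (fun _ : M ↦ (-1 : ℝ)) • Y = -Y := by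
    funext x
    simp
  have h1 := D.along_smul_right (X := X) (f := fun _ ↦ (-1 : ℝ)) contMDiff_const hY
  rw [h] at h1
  rw [h1]
  funext x
  simp [dir, d_const]

theorem along_sub_right (hY : Y.Smooth) (hZ : Z.Smooth) :
    D.along X (Y - Z) = D.along X Y - D.along X Z := by
  rw [sub_eq_add_neg, D.along_add_right hY hZ.neg, D.along_neg_right hZ, sub_eq_add_neg]

theorem along_zero_right : D.along X 0 = 0 := by
  have h := D.along_sub_right (X := X) (Y := 0) (Z := 0) .zero .zero
  rwa [sub_zero, sub_self] at h

theorem along_congr {x : M} (hX : X =ᶠ[𝓝 x] X') (hYs : Y.Smooth) (hY : Y' =ᶠ[𝓝 x] Y) :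
    D.along X' Y' =ᶠ[𝓝 x] D.along X Y := by
  filter_upwards [hX, hY.eventuallyEq_nhds] with y h1 h2
  simp only [along, h1]
  have h3 : MDifferentiableAt (𝓡 m) ((𝓡 m).prod 𝓘(ℝ, Model m))
      (fun x ↦ (TotalSpace.mk' (Model m) x (Y' x) : TangentBundle (𝓡 m) M)) y := by
    refine (hYs.mdiffAt y).congr_of_eventuallyEq ?_
    filter_upwards [h2] with z hz
    rw [hz]
  rw [D.isCovariantDerivativeOnUniv.congr_of_eventuallyEq h3 (hYs.mdiffAt y) Filter.univ_mem h2]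

/-- Inserting the bracket formula for the torsion cancels `∇_X Y`, so the adjoint differentiates the
direction field instead of the argument. -/
theorem adjoint_along (hX : X.Smooth) (hY : Y.Smooth) :
    D.adjoint.along X Y = D.along Y X + VectorField.mlieBracket (𝓡 m) X Y := by
  funext x
  have h := D.torsion_apply (hX.mdiffAt x) (hY.mdiffAt x)
  refine (D.adjoint_apply X Y x).trans ?_
  rw [h]
  simp only [along, Pi.add_apply]
  abel

theorem Smooth.adjoint [T2Space M] {D : Conn m M} (hD : D.Smooth) : D.adjoint.Smooth :=
  Conn.smooth_of_along fun X Y hX hY ↦ by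
    rw [D.adjoint_along hX hY]
    exact (hD.along hY hX).add (hX.bracket hY)

theorem adjoint_along_sub (hX : X.Smooth) (hY : Y.Smooth) :
    D.adjoint.along X Y - D.along Y X = VectorField.mlieBracket (𝓡 m) X Y := by
  rw [D.adjoint_along hX hY, add_sub_cancel_left]

theorem bracket_eq_sub_adjoint (hX : X.Smooth) (hY : Y.Smooth) :
    VectorField.mlieBracket (𝓡 m) X Y = D.along X Y - D.adjoint.along Y X := by
  rw [D.adjoint_along hY hX, bracket_swap Y X]
  abel

end Conn

/-! ### Hessians and curvature -/

section Hessian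

variable [T2Space M] {D : Conn m M} {f : M → ℝ}

theorem hessFun_eq (D : Conn m M) (A B : VField m M) (f : M → ℝ) (x : M) :
    D.hessFun A B f x = dir A (dir B f) x - dir (D.along A B) f x := rfl

theorem hessFun_smooth (hD : D.Smooth) (hf : SmoothFun (m := m) f) {A B : VField m M}
    (hA : A.Smooth) (hB : B.Smooth) : SmoothFun (m := m) (D.hessFun A B f) :=
  (dir_smooth hA (dir_smooth hB hf)).sub (dir_smooth (hD.along hA hB) hf)

theorem hessFun_bitensor (D : Conn m M) (hf : SmoothFun (m := m) f) (x : M) :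
    BitensorAt x (fun A B ↦ D.hessFun A B f x) where
  left B hB :=
    { add := fun X Y hX hY ↦ by
        simp only [hessFun_eq, D.along_add_left, dir_add_field]
        ring
      smul := fun u X hu hX ↦ by
        simp only [hessFun_eq, D.along_smul_left, dir_smul_field]
        ring }
  right A hA :=
    { add := fun X Y hX hY ↦ by
        have h : dir (X + Y) f = fun y ↦ dir X f y + dir Y f y := funext fun y ↦ dir_add_field
        simp only [hessFun_eq, D.along_add_right hX hY, dir_add_field, h,
          dir_add_fun (dir_smooth hX hf) (dir_smooth hY hf)]
        ring
      smul := fun u X hu hX ↦ by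
        have h : dir (u • X) f = fun y ↦ u y * dir X f y := funext fun y ↦ dir_smul_field
        simp only [hessFun_eq, D.along_smul_right hu hX, dir_smul_field, dir_add_field, h,
          dir_mul_fun hu (dir_smooth hX hf)]
        ring }

/-- The extra bracket in the adjoint derivative turns `ABf` into `BAf`. -/
theorem hessFun_adjoint (D : Conn m M) (hf : SmoothFun (m := m) f) {A B : VField m M}
    (hA : A.Smooth) (hB : B.Smooth) (x : M) :
    D.adjoint.hessFun A B f x = D.hessFun B A f x := by
  rw [hessFun_eq, hessFun_eq, D.adjoint_along hA hB, dir_add_field, dir_bracket hA hB hf]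
  ring

theorem hessForm_d (D : Conn m M) (A B Z : VField m M) (x : M) :
    D.hessForm A B (OneForm.eval (d f)) Z x =
      dir A (D.hessFun B Z f) x - D.hessFun B (D.along A Z) f x - D.hessFun (D.along A B) Z f x :=
  rfl

theorem hessFun_congr {x : M} {A A' B B' : VField m M} (hB : B.Smooth) (h1 : A =ᶠ[𝓝 x] A') (h2 : B' =ᶠ[𝓝 x] B) :
    D.hessFun A' B' f =ᶠ[𝓝 x] D.hessFun A B f := by
  have e1 : dir B' f =ᶠ[𝓝 x] dir B f := dir_congr Filter.EventuallyEq.rfl h2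
  exact (dir_congr e1 h1.symm).sub (dir_congr .rfl (D.along_congr h1 hB h2))

theorem hessFun_ext {x : M} (u w : TangentSpace (𝓡 m) x) :
    D.hessFun (ext u) (ext w) f x = D.hessFun (gext u) (gext w) f x :=
  (hessFun_congr (gext_smooth w) (gext_eventuallyEq u)
    (gext_eventuallyEq w).symm).self_of_nhds

/-- The chart-constant fields in the trace are smooth only locally; the operator depends on germs,
so they may be replaced by cut-off global fields. -/
theorem hessForm_ext {x : M} (hD : D.Smooth)
    (u w v : TangentSpace (𝓡 m) x) :
    D.hessForm (ext u) (ext w) (OneForm.eval (d f)) (ext v) x =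
      D.hessForm (gext u) (gext w) (OneForm.eval (d f)) (gext v) x := by
  have eu := gext_eventuallyEq u
  have ew := gext_eventuallyEq w
  have ev := gext_eventuallyEq v
  have e1 : D.hessFun (ext w) (ext v) f =ᶠ[𝓝 x] D.hessFun (gext w) (gext v) f :=
    hessFun_congr (gext_smooth v) ew ev.symm
  have e2 := (dir_congr e1 eu.symm).self_of_nhds
  have e3 := (hessFun_congr (D := D) (f := f) (hD.along (gext_smooth u) (gext_smooth v)) ew
    (D.along_congr eu (gext_smooth v) ev.symm)).self_of_nhds
  have e4 := (hessFun_congr (D := D) (f := f) (gext_smooth v)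
    (D.along_congr eu (gext_smooth w) ew.symm).symm ev.symm).self_of_nhds
  change dir _ (D.hessFun (ext w) (ext v) f) x - D.hessFun (ext w) (D.along (ext u) (ext v)) f x
    - D.hessFun (D.along (ext u) (ext w)) (ext v) f x = _
  rw [e2, e3, e4]
  rfl

theorem curv_eq (D : Conn m M) (X Y Z : VField m M) :
    D.curv X Y Z = D.along X (D.along Y Z) - D.along Y (D.along X Z)
      - D.along (VectorField.mlieBracket (𝓡 m) X Y) Z := rfl

theorem curv_ext {x : M} (hD : D.Smooth) (u v w : TangentSpace (𝓡 m) x) :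
    D.curv (ext u) (ext v) (ext w) x = D.curv (gext u) (gext v) (gext w) x := by
  have eu := gext_eventuallyEq u
  have ew := gext_eventuallyEq w
  have ev := gext_eventuallyEq v
  have hw := gext_smooth w
  have e1 := (D.along_congr eu (hD.along (gext_smooth v) hw)
    (D.along_congr ev hw ew.symm)).self_of_nhds
  have e2 := (D.along_congr ev (hD.along (gext_smooth u) hw)
    (D.along_congr eu hw ew.symm)).self_of_nhds
  have e3 := (D.along_congr (eu.mlieBracket_vectorField ev) hw ew.symm).self_of_nhds
  simp only [Conn.curv, e1, e2, e3]

theorem curv_swap (D : Conn m M) (X Y Z : VField m M) :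
    D.curv X Y Z = -D.curv Y X Z := by
  have h : D.along (-VectorField.mlieBracket (𝓡 m) Y X) Z =
      -D.along (VectorField.mlieBracket (𝓡 m) Y X) Z := funext fun x ↦ map_neg (D Z x) _
  rw [curv_eq, curv_eq, bracket_swap X Y, h]
  abel

theorem curv_add_left {X X' Y Z : VField m M} (hD : D.Smooth) (hX : X.Smooth) (hX' : X'.Smooth)
    (hZ : Z.Smooth) : D.curv (X + X') Y Z = D.curv X Y Z + D.curv X' Y Z := by
  simp only [curv_eq, D.along_add_left, bracket_add_left hX hX',
    D.along_add_right (hD.along hX hZ) (hD.along hX' hZ)]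
  abel

theorem curv_smul_left {X Y Z : VField m M} (hD : D.Smooth) (hf : SmoothFun (m := m) f)
    (hX : X.Smooth) (hZ : Z.Smooth) : D.curv (f • X) Y Z = f • D.curv X Y Z := by
  simp only [curv_eq, D.along_smul_left, bracket_smul_left hf hX, D.along_sub_left,
    D.along_smul_right hf (hD.along hX hZ), smul_sub]
  abel

theorem curv_add_right {X Y Z Z' : VField m M} (hD : D.Smooth) (hX : X.Smooth) (hY : Y.Smooth)
    (hZ : Z.Smooth) (hZ' : Z'.Smooth) : D.curv X Y (Z + Z') = D.curv X Y Z + D.curv X Y Z' := by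
  simp only [curv_eq, D.along_add_right hZ hZ', D.along_add_right (hD.along hX hZ) (hD.along hX hZ'),
    D.along_add_right (hD.along hY hZ) (hD.along hY hZ')]
  abel

theorem curv_smul_right {X Y Z : VField m M} (hD : D.Smooth) (hf : SmoothFun (m := m) f)
    (hX : X.Smooth) (hY : Y.Smooth) (hZ : Z.Smooth) : D.curv X Y (f • Z) = f • D.curv X Y Z := by
  -- The second derivatives of the coefficient cancel against its derivative along the bracket.
  have hb : dir (VectorField.mlieBracket (𝓡 m) X Y) f = dir X (dir Y f) - dir Y (dir X f) :=
    funext fun x ↦ dir_bracket hX hY hf x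
  simp only [curv_eq, D.along_smul_right hf hZ, D.along_smul_right hf (hD.along hX hZ),
    D.along_smul_right hf (hD.along hY hZ), D.along_smul_right (dir_smooth hX hf) hZ,
    D.along_smul_right (dir_smooth hY hf) hZ,
    D.along_add_right ((hD.along hX hZ).smul hf) (hZ.smul (dir_smooth hX hf)),
    D.along_add_right ((hD.along hY hZ).smul hf) (hZ.smul (dir_smooth hY hf)), hb, smul_sub,
    sub_smul]
  abel

theorem curv_bitensor (hD : D.Smooth) {x : M} (α : TangentSpace (𝓡 m) x →L[ℝ] ℝ)
    {Y : VField m M} (hY : Y.Smooth) : BitensorAt x (fun X Z ↦ -α (D.curv X Y Z x)) where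
  left Z hZ :=
    { add := fun X X' hX hX' ↦ by
        rw [curv_add_left hD hX hX' hZ, Pi.add_apply, map_add]
        ring
      smul := fun u X hu hX ↦ by
        rw [curv_smul_left hD hu hX hZ, Pi.smul_apply', map_smul, smul_eq_mul]
        ring }
  right X hX :=
    { add := fun Z Z' hZ hZ' ↦ by
        rw [curv_add_right hD hX hY hZ hZ', Pi.add_apply, map_add]
        ring
      smul := fun u Z hu hZ ↦ by
        rw [curv_smul_right hD hu hX hY hZ, Pi.smul_apply', map_smul, smul_eq_mul]
        ring }

theorem curv_tensor (hD : D.Smooth) {x : M} (α : TangentSpace (𝓡 m) x →L[ℝ] ℝ)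
    {X Z : VField m M} (hZ : Z.Smooth) : TensorAt x (fun Y ↦ α (D.curv X Y Z x)) where
  add Y Y' hY hY' := by
    simp only [curv_swap D X, curv_add_left hD hY hY' hZ, Pi.neg_apply, Pi.add_apply,
      map_neg, map_add]
    ring
  smul u Y hu hY := by
    simp only [curv_swap D X, curv_smul_left hD hu hY hZ, Pi.neg_apply, Pi.smul_apply',
      map_neg, map_smul, smul_eq_mul]
    ring

end Hessian

/-! ### Compatibility with the cometric -/

section Inner

variable (g : Metric m M) {x : M} (u v w : TangentSpace (𝓡 m) x)

theorem inner_add_left : g.inner x (u + v) w = g.inner x u w + g.inner x v w :=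
  ContinuousLinearMap.map_add₂ ..

theorem inner_sub_left : g.inner x (u - v) w = g.inner x u w - g.inner x v w :=
  ContinuousLinearMap.map_sub₂ ..

theorem inner_neg_left : g.inner x (-u) w = -g.inner x u w :=
  ContinuousLinearMap.map_neg₂ ..

theorem inner_zero_left : g.inner x 0 w = 0 :=
  ContinuousLinearMap.map_zero₂ ..

theorem inner_smul_left (c : ℝ) : g.inner x (c • u) w = c * g.inner x u w :=
  ContinuousLinearMap.map_smul₂ ..

theorem inner_add_right : g.inner x w (u + v) = g.inner x w u + g.inner x w v := map_add ..

theorem inner_sub_right : g.inner x w (u - v) = g.inner x w u - g.inner x w v := map_sub ..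

theorem inner_zero_right : g.inner x w 0 = 0 := map_zero _

theorem inner_smul_right (c : ℝ) : g.inner x w (c • u) = c * g.inner x w u := map_smul ..

end Inner

section Compatible

variable [T2Space M] {S : SubRiemannianStructure m M} {g : Metric m M} {D : Conn m M}

/-- The covector field `g(X, ·)`. -/
def flat (g : Metric m M) (X : VField m M) : OneForm m M := fun x ↦ g.inner x (X x)

theorem Conn.onForm_eval (D : Conn m M) (X Y : VField m M) (α : OneForm m M) (x : M) :
    D.onForm X α.eval Y x = d (fun y ↦ α y (Y y)) x (X x) - α x (D.along X Y x) := rfl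

theorem sharp_flat (hg : Tames S g) {X : VField m M} (hX : ∀ x, X x ∈ S.H x) :
    (fun y ↦ S.sharp y (flat g X y)) = X :=
  funext fun x ↦ prH_of_mem hg X x (hX x)

/-- The parallel condition is tested on the covectors `g(Y, ·)` and `g(Z, ·)`, which `♯^H` sends
back to `Y` and `Z` because these are horizontal. -/
theorem Conn.CompatibleCometric.metric (hg : Tames S g) (h : D.CompatibleCometric S)
    {X Y Z : VField m M} (hX : X.Smooth) (hY : Y.Smooth) (hZ : Z.Smooth)
    (hYH : ∀ x, Y x ∈ S.H x) (hZH : ∀ x, Z x ∈ S.H x) (x : M) :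
    dir X (fun y ↦ g.inner y (Y y) (Z y)) x =
      g.inner x (D.along X Y x) (Z x) + g.inner x (Y x) (D.along X Z x) := by
  have h1 := h X (flat g Y) (flat g Z) hX (flat_smooth g hY) (flat_smooth g hZ) x
  rw [sharp_flat hg hYH, sharp_flat hg hZH] at h1
  have h2 : (fun y ↦ S.cometric y (flat g Y y) (flat g Z y)) =
      fun y ↦ g.inner y (Y y) (Z y) := by
    funext y
    rw [S.cometric_eq_left, congrFun (sharp_flat hg hZH) y]
    rfl
  have h3 : (fun y ↦ flat g Z y (Y y)) = fun y ↦ g.inner y (Y y) (Z y) :=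
    funext fun y ↦ g.symm y _ _
  simp only [h2, D.onForm_eval, h3] at h1
  simp only [flat] at h1
  rw [g.symm x (Z x)] at h1
  simp only [dir]
  linarith

/-- For vertical `W` the covector `g(W, ·)` is killed by `♯^H` and annihilates `Y` identically. The
parallel condition then reduces to `g(W, ∇_X Y) = 0`. -/
theorem Conn.CompatibleCometric.along_mem (hg : Tames S g) (h : D.CompatibleCometric S)
    {X Y : VField m M} (hX : X.Smooth) (hY : Y.Smooth)
    (hYH : ∀ x, Y x ∈ S.H x) (x : M) : D.along X Y x ∈ S.H x := by
  rw [mem_H_iff hg]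
  refine eq_of_inner (g := g) fun w ↦ ?_
  rw [map_zero, zero_apply, ← gext_self w, inner_prV_left hg, g.symm]
  set W := prV S g (gext w) with hW
  have hWs : W.Smooth := prV_smooth S g (gext_smooth w)
  have h0 : (fun y ↦ S.sharp y (flat g W y)) = 0 :=
    funext fun y ↦ S.sharp_eq_zero fun u hu ↦ inner_prV hg _ y hu
  have h1 := h X (flat g W) (flat g Y) hX (flat_smooth g hWs) (flat_smooth g hY) x
  rw [sharp_flat hg hYH, h0] at h1
  have h2 : (fun y ↦ S.cometric y (flat g W y) (flat g Y y)) = fun _ ↦ 0 := by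
    funext y
    rw [S.cometric_eq_right, congrFun h0 y, Pi.zero_apply, map_zero]
  have h3 : (fun y ↦ flat g W y (Y y)) = fun _ ↦ 0 :=
    funext fun y ↦ inner_prV hg _ y (hYH y)
  simp only [h2, D.onForm_eval, h3, d_const, D.along_zero_right, Pi.zero_apply, map_zero,
    zero_apply] at h1
  simp only [flat] at h1
  linarith

/-- A covector and `g(♯^H α, ·)` agree on `H`. Since `∇` preserves `H`, only such horizontal values
enter the condition. -/
theorem Conn.compatibleCometric_of (hg : Tames S g)
    (h1 : ∀ X Y Z : VField m M, X.Smooth → Y.Smooth → Z.Smooth → (∀ x, Y x ∈ S.H x) →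
      (∀ x, Z x ∈ S.H x) → ∀ x, dir X (fun y ↦ g.inner y (Y y) (Z y)) x =
        g.inner x (D.along X Y x) (Z x) + g.inner x (Y x) (D.along X Z x))
    (h2 : ∀ X Y : VField m M, X.Smooth → Y.Smooth → (∀ x, Y x ∈ S.H x) →
      ∀ x, D.along X Y x ∈ S.H x) : D.CompatibleCometric S := by
  intro X α β hX hα hβ x
  set A : VField m M := fun y ↦ S.sharp y (α y) with hA
  set B : VField m M := fun y ↦ S.sharp y (β y) with hB
  have hAs : A.Smooth := S.smooth α hα
  have hBs : B.Smooth := S.smooth β hβ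
  have hAH : ∀ y, A y ∈ S.H y := fun y ↦ S.sharp_mem y _
  have hBH : ∀ y, B y ∈ S.H y := fun y ↦ S.sharp_mem y _
  have hα' : ∀ y, ∀ w ∈ S.H y, α y w = g.inner y (A y) w := fun y w hw ↦
    (inner_sharp hg y (α y) hw).symm
  have hβ' : ∀ y, ∀ w ∈ S.H y, β y w = g.inner y (B y) w := fun y w hw ↦
    (inner_sharp hg y (β y) hw).symm
  have e1 : (fun y ↦ S.cometric y (α y) (β y)) = fun y ↦ g.inner y (A y) (B y) := by
    funext y
    rw [S.cometric_eq_left, hα' y _ (S.sharp_mem y _)]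
  have e2 : (fun y ↦ α y (B y)) = fun y ↦ g.inner y (A y) (B y) :=
    funext fun y ↦ hα' y _ (hBH y)
  have e3 : (fun y ↦ β y (A y)) = fun y ↦ g.inner y (A y) (B y) :=
    funext fun y ↦ (hβ' y _ (hAH y)).trans (g.symm y _ _)
  have key := h1 X A B hX hAs hBs hAH hBH x
  simp only [e1, D.onForm_eval, e2, e3, hα' x _ (h2 X B hX hBs hBH x),
    hβ' x _ (h2 X A hX hAs hAH x)]
  simp only [dir] at key
  rw [g.symm x (B x)]
  linarith

/-! ### Vanishing of `II` -/

theorem iiVanishes_of_compatible (hg : Tames S g) (h : D.CompatibleCometric S)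
    (h' : D.adjoint.CompatibleMetric g) : IIVanishes S g := by
  intro A B Z hA hB hZ x
  -- With `Z` vertical, `[Z, A] = ∇_Z A - ∇̂_A Z`. The `∇_Z` terms cancel the derivative of `g(A,
  -- B)`; metricity of `∇̂` moves the rest to `-g(Z, ∇̂_A B + ∇̂_B A)`, and this sum is horizontal
  -- since the two brackets cancel.
  have hl : ∀ A B Z : VField m M, A.Smooth → B.Smooth → Z.Smooth →
      lieDerivMetric g (prV S g Z) (prH S g A) (prH S g B) x = 0 := by
    intro A B Z hA hB hZ
    have hAs := prH_smooth S g hA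
    have hBs := prH_smooth S g hB
    have hZs := prV_smooth S g hZ
    have hAH := prH_mem S g A
    have hBH := prH_mem S g B
    have k0 := h.metric hg hZs hAs hBs hAH hBH x
    have k1 := h' _ _ _ hAs hBs hZs x
    have k2 := h' _ _ _ hBs hAs hZs x
    have z : ∀ W : VField m M, (∀ y, W y ∈ S.H y) →
        (fun y ↦ g.inner y (W y) (prV S g Z y)) = fun _ ↦ 0 := fun W hW ↦ funext fun y ↦
      (g.symm y _ _).trans (inner_prV hg Z y (hW y))
    have m1 := h.along_mem hg hAs hBs hBH x
    have m2 := h.along_mem hg hBs hAs hAH x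
    have o1 := inner_prV hg Z x m1
    have o2 := inner_prV hg Z x m2
    have b1 := D.bracket_eq_sub_adjoint hZs hAs
    have b2 := D.bracket_eq_sub_adjoint hZs hBs
    have b3 := D.bracket_eq_sub_adjoint hAs hBs
    have b4 := D.bracket_eq_sub_adjoint hBs hAs
    have b5 := congrFun (bracket_swap (prH S g A) (prH S g B)) x
    rw [b3, b4] at b5
    have b6 := congrArg (fun w ↦ g.inner x w (prV S g Z x)) b5
    simp only [z _ hAH, z _ hBH, d_const, zero_apply] at k1 k2
    simp only [dir] at k0
    simp only [Pi.sub_apply, Pi.neg_apply, inner_sub_left, inner_neg_left] at b6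
    simp only [lieDerivMetric, b1, b2, k0, Pi.sub_apply, inner_sub_left, inner_sub_right]
    rw [g.symm x] at o1 o2
    rw [g.symm x (prH S g B x) (D.adjoint.along _ _ x)] at k1
    linarith
  -- With `Z` horizontal, `[Z, A] = ∇̂_Z A - ∇_A Z`: the first terms cancel by metricity of `∇̂`,
  -- and `∇_A Z` is horizontal, hence orthogonal to `B`.
  have hr : ∀ A B Z : VField m M, A.Smooth → B.Smooth → Z.Smooth →
      lieDerivMetric g (prH S g Z) (prV S g A) (prV S g B) x = 0 := by
    intro A B Z hA hB hZ
    have hAs := prV_smooth S g hA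
    have hBs := prV_smooth S g hB
    have hZs := prH_smooth S g hZ
    have k0 := h' _ _ _ hZs hAs hBs x
    have m1 := inner_prV hg B x (h.along_mem hg hAs hZs (prH_mem S g Z) x)
    have m2 := inner_prV hg A x (h.along_mem hg hBs hZs (prH_mem S g Z) x)
    rw [g.symm] at m1
    simp only [lieDerivMetric, ← D.adjoint_along_sub hZs hAs, ← D.adjoint_along_sub hZs hBs, k0,
      Pi.sub_apply, inner_sub_left, inner_sub_right, m1, m2]
    ring
  simp only [II, hl A B Z hA hB hZ, hr A B Z hA hB hZ]
  ring

end Compatible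

/-! ### Differentiating horizontal traces -/

section Trace

variable [T2Space M] {S : SubRiemannianStructure m M} {D : Conn m M}

theorem dir_congr_fun {X : VField m M} {u v : M → ℝ} {x : M} (h : u =ᶠ[𝓝 x] v) :
    dir X u x = dir X v x := (dir_congr h .rfl).self_of_nhds

theorem dir_sum {ι : Type*} [Fintype ι] {X : VField m M} {u : ι → M → ℝ} {x : M}
    (hu : ∀ i, SmoothFun (m := m) (u i)) : dir X (fun y ↦ ∑ i, u i y) x = ∑ i, dir X (u i) x := by
  simp only [dir, (d_sum (s := Finset.univ) fun i _ ↦ (hu i).mdiffAt x).2]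
  simp

theorem SmoothFun.sum {ι : Type*} [Fintype ι] {u : ι → M → ℝ}
    (hu : ∀ i, SmoothFun (m := m) (u i)) : SmoothFun (m := m) (fun y ↦ ∑ i, u i y) :=
  ContMDiff.sum fun i _ ↦ hu i

theorem coframe_smooth (x : M) (i : Fin m) : (coframe x i).Smooth := d_smooth (coord_smooth x i)

theorem cometric_smooth (S : SubRiemannianStructure m M) {α β : OneForm m M} (hα : α.Smooth)
    (hβ : β.Smooth) : SmoothFun (m := m) (fun y ↦ S.cometric y (α y) (β y)) := by
  simp only [S.cometric_eq_left]
  exact hα.apply (S.smooth β hβ)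

theorem onForm_tensor (D : Conn m M) {α : OneForm m M} (hα : α.Smooth) (X : VField m M)
    (x : M) : TensorAt x (fun Y ↦ D.onForm X α.eval Y x) where
  add Y Z hY hZ := by
    have h1 := dir_add_fun (X := X) (x := x) (hα.apply hY) (hα.apply hZ)
    simp only [dir] at h1
    simp only [D.onForm_eval, h1, D.along_add_right hY hZ, Pi.add_apply, map_add]
    ring
  smul u Y hu hY := by
    have h1 := dir_mul_fun (X := X) (x := x) hu (hα.apply hY)
    simp only [dir] at h1
    simp only [D.onForm_eval, h1, D.along_smul_right hu hY, Pi.add_apply, Pi.smul_apply',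
      map_add, map_smul, smul_eq_mul, dir]
    ring

theorem onForm_coframe (D : Conn m M) (X : VField m M) {Y : VField m M} (hY : Y.Smooth) (x : M)
    (k : Fin m) : D.onForm X (coframe x k).eval Y x =
      -∑ p, coframe x p x (Y x) * coframe x k x (D.along X (frame x p) x) := by
  rw [(onForm_tensor D (coframe_smooth x k) X x).eq_sum hY, ← Finset.sum_neg_distrib]
  refine Finset.sum_congr rfl fun p _ ↦ ?_
  have h : (fun y ↦ coframe x k y (frame x p y)) =ᶠ[𝓝 x] fun _ ↦ if k = p then (1 : ℝ) else 0 := by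
    filter_upwards [coframe_frame_eventually (m := m) x] with y hy
    exact hy k p
  rw [D.onForm_eval, d_congr h, d_const, zero_apply]
  ring

/-- The coframe is dual to the frame near `x`, so its covariant derivative is minus the transposed
connection matrix; these are the coefficient derivatives needed in `dir_contract`. -/
theorem dir_cometric_coframe (h : D.CompatibleCometric S) {Z : VField m M} (hZ : Z.Smooth)
    (x : M) (k l : Fin m) :
    dir Z (fun y ↦ S.cometric y (coframe x k y) (coframe x l y)) x =
      -∑ p, (S.cometric x (coframe x p x) (coframe x l x) * coframe x k x (D.along Z (frame x p) x)
        + S.cometric x (coframe x k x) (coframe x p x)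
          * coframe x l x (D.along Z (frame x p) x)) := by
  refine (h Z _ _ hZ (coframe_smooth x k) (coframe_smooth x l) x).trans ?_
  rw [onForm_coframe D Z (S.smooth _ (coframe_smooth x l)),
    onForm_coframe D Z (S.smooth _ (coframe_smooth x k)), Finset.sum_add_distrib, neg_add]
  simp only [← S.cometric_eq_left, S.cometric_comm (coframe x k x)]

theorem sum_comm₃ {ι : Type*} [Fintype ι] (F : ι → ι → ι → ℝ) :
    ∑ k, ∑ l, ∑ p, F k l p = ∑ k, ∑ l, ∑ p, F p l k := by
  calc _ = ∑ l, ∑ k, ∑ p, F k l p := Finset.sum_comm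
    _ = ∑ l, ∑ k, ∑ p, F p l k := Finset.sum_congr rfl fun l _ ↦ Finset.sum_comm
    _ = _ := Finset.sum_comm

/-- The horizontal trace of a family of bitensors. -/
def contract (S : SubRiemannianStructure m M) (φ : VField m M → VField m M → M → ℝ) (y : M) : ℝ :=
  S.trace y (fun u w ↦ φ (gext u) (gext w) y)

theorem contract_eventuallyEq {φ : VField m M → VField m M → M → ℝ}
    (hφ : ∀ y, BitensorAt y (fun A B ↦ φ A B y)) (x : M) :
    contract S φ =ᶠ[𝓝 x] fun y ↦ ∑ k, ∑ l,
      S.cometric y (coframe x k y) (coframe x l y) * φ (frame x k) (frame x l) y := by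
  filter_upwards [trace_eventually S x] with y hy
  exact hy _ (hφ y)

theorem contract_smooth {φ : VField m M → VField m M → M → ℝ}
    (hφ : ∀ y, BitensorAt y (fun A B ↦ φ A B y))
    (hs : ∀ A B : VField m M, A.Smooth → B.Smooth → SmoothFun (m := m) (φ A B)) :
    SmoothFun (m := m) (contract S φ) := fun x ↦
  ContMDiffAt.congr_of_eventuallyEq (SmoothFun.sum fun k ↦ SmoothFun.sum fun l ↦
    (cometric_smooth S (coframe_smooth x k) (coframe_smooth x l)).mul
      (hs _ _ (frame_smooth x k) (frame_smooth x l)) : SmoothFun _).contMDiffAt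
    (contract_eventuallyEq hφ x)

/-- A parallel cometric lets contraction commute with covariant differentiation. In a frame,
derivatives of the coefficients cancel the connection matrices acting on the two slots. -/
theorem dir_contract {φ : VField m M → VField m M → M → ℝ}
    (hφ : ∀ y, BitensorAt y (fun A B ↦ φ A B y))
    (hs : ∀ A B : VField m M, A.Smooth → B.Smooth → SmoothFun (m := m) (φ A B))
    (hD : D.Smooth) (h : D.CompatibleCometric S) {Z : VField m M} (hZ : Z.Smooth) (x : M) :
    dir Z (contract S φ) x = S.trace x (fun u w ↦ dir Z (φ (gext u) (gext w)) x
      - φ (D.along Z (gext u)) (gext w) x - φ (gext u) (D.along Z (gext w)) x) := by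
  have hc : ∀ k l, SmoothFun (m := m)
      (fun y ↦ S.cometric y (coframe x k y) (coframe x l y)) := fun k l ↦
    cometric_smooth S (coframe_smooth x k) (coframe_smooth x l)
  have hf : ∀ k l, SmoothFun (m := m) (φ (frame x k) (frame x l)) := fun k l ↦
    hs _ _ (frame_smooth x k) (frame_smooth x l)
  have hE : ∀ k, (D.along Z (frame x k)).Smooth := fun k ↦ hD.along hZ (frame_smooth x k)
  rw [dir_congr_fun (contract_eventuallyEq hφ x),
    dir_sum fun k ↦ SmoothFun.sum fun l ↦ (hc k l).mul (hf k l)]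
  rw [trace_gext S (Φ := fun A B ↦ dir Z (φ A B) x - φ (D.along Z A) B x - φ A (D.along Z B) x)]
  simp only [dir_sum fun l ↦ (hc _ l).mul (hf _ l), dir_mul_fun (hc _ _) (hf _ _),
    dir_cometric_coframe h hZ]
  have e1 : ∀ k l, φ (D.along Z (frame x k)) (frame x l) x =
      ∑ p, coframe x p x (D.along Z (frame x k) x) * φ (frame x p) (frame x l) x := fun k l ↦
    ((hφ x).left _ (frame_smooth x l)).eq_sum (hE k)
  have e2 : ∀ k l, φ (frame x k) (D.along Z (frame x l)) x =
      ∑ p, coframe x p x (D.along Z (frame x l) x) * φ (frame x k) (frame x p) x := fun k l ↦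
    ((hφ x).right _ (frame_smooth x k)).eq_sum (hE l)
  simp only [e1, e2, mul_sub, mul_add, mul_neg, Finset.sum_add_distrib, Finset.sum_sub_distrib,
    Finset.sum_neg_distrib, Finset.mul_sum]
  -- Renaming the summed index against the first slot identifies a coefficient derivative with a
  -- connection term; `s2` does the same for the second slot.
  have s1 : ∑ k, ∑ l, ∑ p, φ (frame x k) (frame x l) x *
        (S.cometric x (coframe x p x) (coframe x l x) * coframe x k x (D.along Z (frame x p) x)) =
      ∑ k, ∑ l, ∑ p, S.cometric x (coframe x k x) (coframe x l x) *
        (coframe x p x (D.along Z (frame x k) x) * φ (frame x p) (frame x l) x) := by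
    rw [sum_comm₃]
    exact Finset.sum_congr rfl fun k _ ↦ Finset.sum_congr rfl fun l _ ↦
      Finset.sum_congr rfl fun p _ ↦ by ring
  have s2 : ∑ k, ∑ l, ∑ p, φ (frame x k) (frame x l) x *
        (S.cometric x (coframe x k x) (coframe x p x) * coframe x l x (D.along Z (frame x p) x)) =
      ∑ k, ∑ l, ∑ p, S.cometric x (coframe x k x) (coframe x l x) *
        (coframe x p x (D.along Z (frame x l) x) * φ (frame x k) (frame x p) x) := by
    refine Finset.sum_congr rfl fun k _ ↦ ?_
    rw [Finset.sum_comm]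
    exact Finset.sum_congr rfl fun l _ ↦ Finset.sum_congr rfl fun p _ ↦ by ring
  linarith

/-! ### The Weitzenböck identity -/

section Weitzenboeck

variable {f : M → ℝ}

theorem roughLap_eq_contract (S : SubRiemannianStructure m M) (D : Conn m M) (f : M → ℝ) :
    roughLap S D f = contract S (fun A B ↦ D.hessFun A B f) := by
  funext x
  simp only [roughLap, contract, hessFun_ext]

theorem roughLap_smooth (S : SubRiemannianStructure m M) (hD : D.Smooth)
    (hf : SmoothFun (m := m) f) : SmoothFun (m := m) (roughLap S D f) := by
  rw [roughLap_eq_contract]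
  exact contract_smooth (hessFun_bitensor D hf) fun A B hA hB ↦ hessFun_smooth hD hf hA hB

theorem roughLap_adjoint (S : SubRiemannianStructure m M) (D : Conn m M)
    (hf : SmoothFun (m := m) f) : roughLap S D.adjoint f = roughLap S D f := by
  funext x
  simp only [roughLap, hessFun_ext, hessFun_adjoint D hf (gext_smooth _) (gext_smooth _)]
  rw [HorizontalMetric.trace, Finset.sum_comm]
  exact Finset.sum_congr rfl fun i _ ↦ Finset.sum_congr rfl fun j _ ↦ by rw [S.cometric_comm]

/-- After transposing the adjoint Hessians, this is the Ricci commutation identity for `A` and `Z`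
acting on `df` paired with `B`. The leftover term on the right contains the torsion of `A` and `B`,
antisymmetric in them. -/
theorem hessForm_adjoint_add_curv (hD : D.Smooth) (hf : SmoothFun (m := m) f)
    {A B Z : VField m M} (hA : A.Smooth) (hB : B.Smooth) (hZ : Z.Smooth) (x : M) :
    D.adjoint.hessForm A B (OneForm.eval (d f)) Z x + d f x (D.curv A Z B x) =
      dir Z (D.hessFun A B f) x - D.hessFun (D.along Z A) B f x - D.hessFun A (D.along Z B) f x
        + D.hessFun Z (D.along A B - D.adjoint.along A B) f x := by
  have hDh := hD.adjoint
  have hAB := hD.along hA hB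
  have hZB := hD.along hZ hB
  have e1 : D.adjoint.hessFun B Z f = D.hessFun Z B f := funext (hessFun_adjoint D hf hB hZ)
  rw [hessForm_d, e1, hessFun_adjoint D hf hB (hDh.along hA hZ),
    hessFun_adjoint D hf (hDh.along hA hB) hZ, D.adjoint_along hA hZ]
  have e2 := ((hessFun_bitensor D hf x).left B hB).add _ _ (hD.along hZ hA) (hA.bracket hZ)
  have e3 := ((hessFun_bitensor D hf x).right Z hZ).sub hAB (hDh.along hA hB)
  rw [e2, e3]
  have e4 : ∀ X Y W : VField m M, X.Smooth → Y.Smooth → W.Smooth →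
      dir X (D.hessFun Y W f) x = dir X (dir Y (dir W f)) x - dir X (dir (D.along Y W) f) x :=
    fun X Y W hX hY hW ↦ dir_sub_fun (dir_smooth hY (dir_smooth hW hf))
      (dir_smooth (hD.along hY hW) hf)
  have e5 : d f x (D.curv A Z B x) = dir (D.along A (D.along Z B)) f x
      - dir (D.along Z (D.along A B)) f x
      - dir (D.along (VectorField.mlieBracket (𝓡 m) A Z) B) f x := by
    simp only [Conn.curv, map_sub]
    rfl
  rw [e4 _ _ _ hA hZ hB, e4 _ _ _ hZ hA hB, e5]
  simp only [hessFun_eq D (VectorField.mlieBracket (𝓡 m) A Z) B, hessFun_eq D Z (D.along A B),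
    hessFun_eq D A (D.along Z B), dir_bracket hA hZ (dir_smooth hB hf)]
  ring

theorem weitzenboeck (hD : D.Smooth) (h : D.CompatibleCometric S) (hf : SmoothFun (m := m) f)
    (x : M) (v : TangentSpace (𝓡 m) x) :
    roughLapForm S D.adjoint (d f) x v - ric S D x (d f x) v = d (roughLap S D f) x v := by
  have hv := gext_smooth v
  have e1 : d (roughLap S D f) x v = dir (gext v) (roughLap S D f) x := by
    simp only [dir, gext_self]
  rw [e1, roughLap_eq_contract, dir_contract (hessFun_bitensor D hf)
    (fun A B hA hB ↦ hessFun_smooth hD hf hA hB) hD h hv]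
  simp only [roughLapForm, ric, hessForm_ext hD.adjoint, curv_ext hD]
  rw [← HorizontalMetric.trace_sub]
  simp only [sub_neg_eq_add, hessForm_adjoint_add_curv hD hf (gext_smooth _) (gext_smooth _) hv]
  -- What remains is the Hessian evaluated on the torsion, which is antisymmetric in the traced
  -- arguments.
  rw [HorizontalMetric.trace_add, add_eq_left]
  refine HorizontalMetric.trace_eq_zero _ fun u w ↦ ?_
  have hu := gext_smooth u
  have hw := gext_smooth w
  have e2 : D.along (gext u) (gext w) - D.adjoint.along (gext u) (gext w) =
      -(D.along (gext w) (gext u) - D.adjoint.along (gext w) (gext u)) := by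
    rw [D.adjoint_along hu hw, D.adjoint_along hw hu, bracket_swap (gext w)]
    abel
  rw [e2]
  exact ((hessFun_bitensor D hf x).right _ hv).neg
    ((hD.along hw hu).sub (hD.adjoint.along hw hu))

end Weitzenboeck

end Trace

/-! ### The sub-Laplacian -/

section Determinant

variable [T2Space M] {X : VField m M} {x : M}

theorem dir_prod {ι : Type*} [DecidableEq ι] {s : Finset ι} {u : ι → M → ℝ}
    (hu : ∀ i, SmoothFun (m := m) (u i)) :
    SmoothFun (m := m) (fun y ↦ ∏ i ∈ s, u i y) ∧
      dir X (fun y ↦ ∏ i ∈ s, u i y) x = ∑ i ∈ s, (∏ j ∈ s.erase i, u j x) * dir X (u i) x := by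
  induction s using Finset.induction_on with
  | empty => exact ⟨by simpa using contMDiff_const, by simp [dir, d_const]⟩
  | insert a s ha ih =>
    simp only [Finset.prod_insert ha, Finset.sum_insert ha, Finset.erase_insert ha]
    refine ⟨(hu a).mul ih.1, ?_⟩
    rw [dir_mul_fun (hu a) ih.1, ih.2, Finset.mul_sum, add_comm]
    congr 1
    refine Finset.sum_congr rfl fun i hi ↦ ?_
    have hia : a ≠ i := fun h ↦ ha (h ▸ hi)
    rw [Finset.erase_insert_of_ne hia, Finset.prod_insert (fun h ↦ ha (Finset.mem_of_mem_erase h))]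
    ring

/-- Jacobi's formula, column by column: the product rule is applied to each term of the Leibniz
expansion. -/
theorem dir_det {G : Fin m → Fin m → M → ℝ} (hG : ∀ i j, SmoothFun (m := m) (G i j)) :
    SmoothFun (m := m) (fun y ↦ (Matrix.of fun i j ↦ G i j y).det) ∧
      dir X (fun y ↦ (Matrix.of fun i j ↦ G i j y).det) x =
        ∑ i, ((Matrix.of fun i j ↦ G i j x).updateCol i fun k ↦ dir X (G k i) x).det := by
  have h1 : ∀ σ : Equiv.Perm (Fin m), SmoothFun (m := m)
      (fun y ↦ ((Equiv.Perm.sign σ : ℤ) : ℝ) * ∏ i, G (σ i) i y) := fun σ ↦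
    SmoothFun.mul contMDiff_const (dir_prod (X := X) (x := x) fun i ↦ hG (σ i) i).1
  simp only [Matrix.det_apply', Matrix.of_apply]
  refine ⟨SmoothFun.sum h1, ?_⟩
  rw [dir_sum h1, Finset.sum_comm]
  refine Finset.sum_congr rfl fun σ _ ↦ ?_
  have h2 := dir_prod (X := X) (x := x) (s := Finset.univ) fun i ↦ hG (σ i) i
  rw [dir_mul_fun contMDiff_const h2.1, h2.2]
  simp only [dir, d_const, zero_apply, mul_zero, add_zero, Finset.mul_sum]
  refine Finset.sum_congr rfl fun i _ ↦ ?_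
  rw [← Finset.mul_prod_erase _ _ (Finset.mem_univ i), Matrix.updateCol_self]
  have h3 : ∏ j ∈ Finset.univ.erase i, (Matrix.of fun i j ↦ G i j x).updateCol i
      (fun k ↦ (d (G k i) x) (X x)) (σ j) j = ∏ j ∈ Finset.univ.erase i, G (σ j) j x :=
    Finset.prod_congr rfl fun j hj ↦ by
      rw [Matrix.updateCol_ne (Finset.ne_of_mem_erase hj)]
      rfl
  rw [h3]
  ring

/-- This evaluates the derivative of the determinant when `G' = aᵀG + Ga`, as for a Gram matrix and
a metric connection. In the `Ga` half each column contributes only its own diagonal coefficient; the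
other half is `tr(adj(G) aᵀ G)`. Each equals `det G · tr a`. -/
theorem det_derivation {n : Type*} [Fintype n] [DecidableEq n] (G a : Matrix n n ℝ) :
    ∑ i, (G.updateCol i fun k ↦ (∑ p, a p k * G p i) + ∑ p, a p i * G k p).det =
      2 * (G.det * a.trace) := by
  have h1 : ∀ i, (G.updateCol i fun k ↦ (∑ p, a p k * G p i) + ∑ p, a p i * G k p).det =
      (G.adjugate * (a.transpose * G)) i i + a i i * G.det := by
    intro i
    have e1 : (fun k ↦ (∑ p, a p k * G p i) + ∑ p, a p i * G k p) =
        (fun k ↦ (a.transpose * G) k i) + fun k ↦ ∑ p, a p i • G k p := by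
      funext k
      simp [Matrix.mul_apply]
    rw [e1, Matrix.det_updateCol_add, Matrix.det_updateCol_sum, smul_eq_mul, ← Matrix.cramer_apply,
      Matrix.cramer_eq_adjugate_mulVec]
    rfl
  simp only [h1, Finset.sum_add_distrib, ← Finset.sum_mul]
  have h2 : ∑ i, (G.adjugate * (a.transpose * G)) i i = G.det * a.trace := by
    have : ∑ i, (G.adjugate * (a.transpose * G)) i i =
        (G.adjugate * (a.transpose * G)).trace := rfl
    rw [this, ← Matrix.mul_assoc, Matrix.trace_mul_comm, ← Matrix.mul_assoc, Matrix.mul_adjugate]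
    simp [Matrix.trace_transpose]
  rw [h2]
  simp only [Matrix.trace, Matrix.diag]
  ring

end Determinant

/-! ### Derivatives of the inverse chart and chart components of fields. -/

section Chart

theorem mfderiv_extChartAt_symm_apply {x : M} {p : Model m}
    (hp : p ∈ (extChartAt (𝓡 m) x).target) (w : Model m) :
    mfderiv 𝓘(ℝ, Model m) (𝓡 m) (extChartAt (𝓡 m) x).symm p w =
      chartSymm x ((extChartAt (𝓡 m) x).symm p) w := by
  have hs : (extChartAt (𝓡 m) x).symm p ∈ (extChartAt (𝓡 m) x).source :=
    (extChartAt (𝓡 m) x).map_target hp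
  have hs' : (extChartAt (𝓡 m) x).symm p ∈ (chartAt (Model m) x).source := by
    rwa [extChartAt_source] at hs
  have h := mfderivWithin_extChartAt_symm_comp_mfderiv_extChartAt (I := 𝓡 m) hp
  rw [ModelWithCorners.Boundaryless.range_eq_univ, mfderivWithin_univ] at h
  have h1 := DFunLike.congr_fun h (chartSymm x ((extChartAt (𝓡 m) x).symm p) w)
  have h2 : mfderiv (𝓡 m) 𝓘(ℝ, Model m) (extChartAt (𝓡 m) x) ((extChartAt (𝓡 m) x).symm p)
      (chartSymm x ((extChartAt (𝓡 m) x).symm p) w) = w := by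
    have h3 := chartDeriv_chartSymm hs' w
    unfold chartDeriv at h3
    rw [TangentBundle.continuousLinearMapAt_trivializationAt hs'] at h3
    exact h3
  refine Eq.trans ?_ h1
  exact congrArg (mfderiv 𝓘(ℝ, Model m) (𝓡 m) (extChartAt (𝓡 m) x).symm p) h2.symm

theorem chartPull_eq {x : M} {p : Model m} (hp : p ∈ (extChartAt (𝓡 m) x).target)
    (X : VField m M) : chartPull x X p =
      chartDeriv x ((extChartAt (𝓡 m) x).symm p) (X ((extChartAt (𝓡 m) x).symm p)) := by
  have hs : (extChartAt (𝓡 m) x).symm p ∈ (extChartAt (𝓡 m) x).source :=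
    (extChartAt (𝓡 m) x).map_target hp
  have hs' : (extChartAt (𝓡 m) x).symm p ∈ (chartAt (Model m) x).source := by
    rwa [extChartAt_source] at hs
  have h := isInvertible_mfderivWithin_extChartAt_symm (I := 𝓡 m) hp
  simp only [modelWithCornersSelf_coe, Set.range_id, mfderivWithin_univ] at h
  refine (h.inverse_apply_eq (y := X ((extChartAt (𝓡 m) x).symm p))).2 ?_
  exact ((mfderiv_extChartAt_symm_apply hp _).trans (chartSymm_chartDeriv hs' _)).symm

end Chart

/-! ### Riemannian divergence as the trace of a covariant derivative. -/

section Divergence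

open scoped Matrix

variable [T2Space M] {g : Metric m M}

theorem gram_det_pos (g : Metric m M) (x : M) :
    0 < (Matrix.of fun i j : Fin m ↦ g.inner x (frame x i x) (frame x j x)).det := by
  have h : (Matrix.of fun i j : Fin m ↦ g.inner x (frame x i x) (frame x j x)).PosDef := by
    refine Matrix.PosDef.of_dotProduct_mulVec_pos ?_ fun {v} hv ↦ ?_
    · ext i j
      simp only [Matrix.conjTranspose_apply, Matrix.of_apply, star_trivial]
      exact g.symm x _ _
    · have h1 : star v ⬝ᵥ (Matrix.of fun i j : Fin m ↦ g.inner x (frame x i x) (frame x j x)) *ᵥ v =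
          g.inner x (∑ i, v i • frame x i x) (∑ i, v i • frame x i x) := by
        simp only [dotProduct, Matrix.mulVec, Matrix.of_apply, map_sum, map_smul, star_trivial]
        simp only [FunLike.coe_sum, Finset.sum_apply, FunLike.coe_smul, Pi.smul_apply, smul_eq_mul,
          Finset.mul_sum]
        rw [Finset.sum_comm]
        exact Finset.sum_congr rfl fun i _ ↦ Finset.sum_congr rfl fun j _ ↦ by ring
      rw [h1]
      refine g.pos x _ fun h0 ↦ hv ?_
      funext i
      have h3 := congrArg (coframe x i x) h0
      simpa [(coframe_frame_eventually (m := m) x).self_of_nhds] using h3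
  exact h.det_pos

/-- The volume density of `g` on the coordinate frame at `x`. -/
def frameVol (g : Metric m M) (x : M) (y : M) : ℝ := volDensity g y fun i ↦ frame x i y

theorem gram_smooth (g : Metric m M) (x : M) (i j : Fin m) :
    SmoothFun (m := m) (fun y ↦ g.inner y (frame x i y) (frame x j y)) :=
  metric_smooth g (frame_smooth x i) (frame_smooth x j)

theorem frameVol_pos (g : Metric m M) (x : M) : 0 < frameVol g x x :=
  Real.sqrt_pos.2 (gram_det_pos g x)

theorem frameVol_mdiffAt (g : Metric m M) (x : M) :
    MDifferentiableAt (𝓡 m) 𝓘(ℝ, ℝ) (frameVol g x) x := by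
  have h1 := (dir_det (X := 0) (x := x) (gram_smooth g x)).1.mdiffAt x
  have h2 : MDifferentiableAt 𝓘(ℝ, ℝ) 𝓘(ℝ, ℝ) Real.sqrt
      (Matrix.of fun i j : Fin m ↦ g.inner x (frame x i x) (frame x j x)).det :=
    ((Real.contDiffAt_sqrt (n := 1) (gram_det_pos g x).ne').differentiableAt
      (by simp)).mdifferentiableAt
  exact h2.comp x h1

/-- Metricity expresses the derivative of the Gram matrix through the connection matrix, and the
volume is the square root of the Gram determinant. -/
theorem dir_frameVol {D : Conn m M} (h : D.CompatibleMetric g) {X : VField m M}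
    (hX : X.Smooth) (x : M) : dir X (frameVol g x) x =
      frameVol g x x * ∑ i, coframe x i x (D.along X (frame x i) x) := by
  set G : Fin m → Fin m → M → ℝ := fun i j y ↦ g.inner y (frame x i y) (frame x j y) with hG
  set a : Matrix (Fin m) (Fin m) ℝ :=
    Matrix.of fun p i ↦ coframe x p x (D.along X (frame x i) x) with ha
  have hdet := dir_det (X := X) (x := x) (gram_smooth g x)
  have hpos : ∀ᶠ y in 𝓝 x, 0 < (Matrix.of fun i j : Fin m ↦ G i j y).det :=
    hdet.1.continuous.continuousAt.eventually (lt_mem_nhds (gram_det_pos g x))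
  -- Differentiating the square of the volume avoids differentiating the root; it is cancelled at
  -- the end by positivity.
  have hsq : (fun y ↦ frameVol g x y * frameVol g x y) =ᶠ[𝓝 x]
      fun y ↦ (Matrix.of fun i j : Fin m ↦ G i j y).det := by
    filter_upwards [hpos] with y hy
    exact Real.mul_self_sqrt hy.le
  have e1 := dir_congr_fun (X := X) hsq
  rw [hdet.2] at e1
  have hr := frameVol_mdiffAt g x
  have e2 : dir X (fun y ↦ frameVol g x y * frameVol g x y) x =
      2 * (frameVol g x x * dir X (frameVol g x) x) := by
    simp only [dir, d_mul hr hr, FunLike.coe_add, Pi.add_apply, FunLike.coe_smul, Pi.smul_apply,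
      smul_eq_mul]
    ring
  have hexp : ∀ i (w : TangentSpace (𝓡 m) x), g.inner x (D.along X (frame x i) x) w =
      ∑ p, a p i * g.inner x (frame x p x) w := fun i w ↦ by
    conv_lhs => rw [← (sum_coframe_frame_eventually (m := m) x).self_of_nhds
      (D.along X (frame x i) x)]
    simp [ha]
  have e3 : ∀ k i, dir X (G k i) x = (∑ p, a p k * G p i x) + ∑ p, a p i * G k p x := fun k i ↦ by
    refine (h X _ _ hX (frame_smooth x k) (frame_smooth x i) x).trans ?_
    rw [g.symm x (frame x k x), hexp, hexp]
    simp only [hG, g.symm x (frame x k x)]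
  have e4 := det_derivation (Matrix.of fun i j : Fin m ↦ G i j x) a
  simp only [Matrix.of_apply] at e4
  simp only [hG] at e3
  simp only [e3] at e1
  have e0 : frameVol g x x * frameVol g x x = (Matrix.of fun i j : Fin m ↦ G i j x).det :=
    hsq.self_of_nhds
  rw [e4, e2, ← e0] at e1
  have e5 : a.trace = ∑ i, coframe x i x (D.along X (frame x i) x) := rfl
  rw [e5] at e1
  have := frameVol_pos g x
  refine mul_left_cancel₀ this.ne' ?_
  linarith

/-- The product rule is applied to the coordinate formula, after the density and the components have
been identified with functions on `M` near `x`. -/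
theorem divergence_eq (g : Metric m M) {X : VField m M} (hX : X.Smooth) (x : M) :
    divergence (volDensity g) X x = (∑ i, dir (frame x i) (fun y ↦ coframe x i y (X y)) x)
      + (frameVol g x x)⁻¹ * dir X (frameVol g x) x := by
  have hlim : Filter.Tendsto (extChartAt (𝓡 m) x).symm (𝓝 (extChartAt (𝓡 m) x x)) (𝓝 x) := by
    have := continuousAt_extChartAt_symm (I := 𝓡 m) x
    rwa [ContinuousAt, extChartAt_to_inv] at this
  have htar : (extChartAt (𝓡 m) x).target ∈ 𝓝 (extChartAt (𝓡 m) x x) :=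
    (isOpen_extChartAt_target x).mem_nhds (mem_extChartAt_target x)
  have hsrc : ∀ᶠ y : M in 𝓝 x, y ∈ (chartAt (Model m) x).source :=
    (chartAt (Model m) x).open_source.mem_nhds (mem_chart_source _ x)
  have hρ : ∀ᶠ p in 𝓝 (extChartAt (𝓡 m) x x), volDensity g ((extChartAt (𝓡 m) x).symm p)
      (fun i ↦ mfderiv 𝓘(ℝ, Model m) (𝓡 m) (extChartAt (𝓡 m) x).symm p
        (EuclideanSpace.single i (1 : ℝ) : Model m)) = frameVol g x ((extChartAt (𝓡 m) x).symm p) := by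
    filter_upwards [htar, hlim.eventually (frame_eventually (m := m) x), hlim.eventually hsrc]
      with p hp hf hs
    unfold frameVol
    congr 1
    funext i
    rw [hf i, ext_eq_chartSymm hs]
    exact mfderiv_extChartAt_symm_apply hp _
  have hX' : ∀ᶠ p in 𝓝 (extChartAt (𝓡 m) x x), ∀ i, chartPull x X p i =
      coframe x i ((extChartAt (𝓡 m) x).symm p) (X ((extChartAt (𝓡 m) x).symm p)) := by
    filter_upwards [htar, hlim.eventually (coframe_eventually (m := m) x)] with p hp hc i
    rw [chartPull_eq hp, hc]
  have hE : ∀ i, chartPull x (frame x i) (extChartAt (𝓡 m) x x) =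
      EuclideanSpace.single i (1 : ℝ) := fun i ↦ by
    rw [chartPull_eq (mem_extChartAt_target x)]
    have h1 := hlim.eventually (frame_eventually (m := m) x)
    rw [h1.self_of_nhds i]
    exact chartDeriv_ext (hlim.eventually hsrc).self_of_nhds _
  have hu : ∀ i, SmoothFun (m := m) (fun y ↦ coframe x i y (X y)) := fun i ↦
    (coframe_smooth x i).apply hX
  have hr := frameVol_mdiffAt g x
  have hterm : ∀ i, fderiv ℝ (fun p ↦ volDensity g ((extChartAt (𝓡 m) x).symm p)
      (fun i ↦ mfderiv 𝓘(ℝ, Model m) (𝓡 m) (extChartAt (𝓡 m) x).symm p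
        (EuclideanSpace.single i (1 : ℝ) : Model m)) * chartPull x X p i) (extChartAt (𝓡 m) x x)
        (EuclideanSpace.single i (1 : ℝ)) =
      frameVol g x x * dir (frame x i) (fun y ↦ coframe x i y (X y)) x
        + coframe x i x (X x) * dir (frame x i) (frameVol g x) x := fun i ↦ by
    have e1 : (fun p ↦ volDensity g ((extChartAt (𝓡 m) x).symm p)
      (fun i ↦ mfderiv 𝓘(ℝ, Model m) (𝓡 m) (extChartAt (𝓡 m) x).symm p
        (EuclideanSpace.single i (1 : ℝ) : Model m)) * chartPull x X p i)
        =ᶠ[𝓝 (extChartAt (𝓡 m) x x)]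
        (fun y ↦ frameVol g x y * coframe x i y (X y)) ∘ (extChartAt (𝓡 m) x).symm := by
      filter_upwards [hρ, hX'] with p h1 h2
      rw [h1, h2]
      rfl
    have hm : MDifferentiableAt (𝓡 m) 𝓘(ℝ, ℝ) (fun y ↦ frameVol g x y * coframe x i y (X y))
        ((extChartAt (𝓡 m) x).symm (extChartAt (𝓡 m) x x)) := by
      rw [extChartAt_to_inv]
      exact hr.mul ((hu i).mdiffAt x)
    rw [e1.fderiv_eq, ← hE i, fderiv_comp_chartPull (mem_extChartAt_target x) hm,
      Function.comp_apply, extChartAt_to_inv]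
    simp only [dir, d_mul hr ((hu i).mdiffAt x), FunLike.coe_add, Pi.add_apply, FunLike.coe_smul,
      Pi.smul_apply, smul_eq_mul]
  have hXsum : ∑ i, coframe x i x (X x) * dir (frame x i) (frameVol g x) x =
      dir X (frameVol g x) x := by
    simp only [dir]
    conv_rhs => rw [← (sum_coframe_frame_eventually (m := m) x).self_of_nhds (X x)]
    simp
  have hρx : volDensity g ((extChartAt (𝓡 m) x).symm (extChartAt (𝓡 m) x x))
      (fun i ↦ mfderiv 𝓘(ℝ, Model m) (𝓡 m) (extChartAt (𝓡 m) x).symm (extChartAt (𝓡 m) x x)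
        (EuclideanSpace.single i (1 : ℝ) : Model m)) = frameVol g x x :=
    hρ.self_of_nhds.trans (congrArg (frameVol g x) (extChartAt_to_inv x))
  have key : divergence (volDensity g) X x = (frameVol g x x)⁻¹ * ∑ i,
      (frameVol g x x * dir (frame x i) (fun y ↦ coframe x i y (X y)) x
        + coframe x i x (X x) * dir (frame x i) (frameVol g x) x) :=
    congrArg₂ (fun a b : ℝ ↦ a⁻¹ * b) hρx (Finset.sum_congr rfl fun i _ ↦ hterm i)
  rw [key, Finset.sum_add_distrib, hXsum, ← Finset.mul_sum, mul_add,
    inv_mul_cancel_left₀ (frameVol_pos g x).ne']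

variable {S : SubRiemannianStructure m M} {D : Conn m M} {f : M → ℝ}

/-- The logarithmic derivative of the volume is the trace of `∇̂_X Eᵢ = ∇_{Eᵢ} X + [X, Eᵢ]`; the
bracket part cancels the coordinate derivatives of the components of `X`. -/
theorem divergence_eq_sum_along (h : D.adjoint.CompatibleMetric g)
    {X : VField m M} (hX : X.Smooth) (x : M) : divergence (volDensity g) X x =
      ∑ i, coframe x i x (D.along (frame x i) X x) := by
  rw [divergence_eq g hX, dir_frameVol h hX,
    inv_mul_cancel_left₀ (frameVol_pos g x).ne', ← Finset.sum_add_distrib]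
  refine Finset.sum_congr rfl fun i _ ↦ ?_
  have e1 := dir_bracket hX (frame_smooth x i) (coord_smooth x i) x
  -- The `i`th coordinate has derivative one along its own frame field near `x`, so differentiating
  -- again gives zero.
  have e2 : dir X (dir (frame x i) (coord x i)) x = 0 := by
    have : dir (frame x i) (coord x i) =ᶠ[𝓝 x] fun _ ↦ (1 : ℝ) := by
      filter_upwards [coframe_frame_eventually (m := m) x] with y hy
      exact (hy i i).trans (if_pos rfl)
    rw [dir_congr_fun this]
    simp [dir, d_const]
  have e3 : coframe x i x (D.adjoint.along X (frame x i) x) =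
      coframe x i x (D.along (frame x i) X x)
        + dir (VectorField.mlieBracket (𝓡 m) X (frame x i)) (coord x i) x := by
    rw [D.adjoint_along hX (frame_smooth x i), Pi.add_apply, map_add]
    rfl
  rw [e3, e1, e2]
  change dir (frame x i) (dir X (coord x i)) x + _ = _
  ring

/-- The parallel condition for `df` and the coframe element `θⁱ`, in direction `Eᵢ`, turns
`θⁱ(∇_{Eᵢ} ♯^H df)` into `(∇_{Eᵢ} df)(♯^H θⁱ)`; summing over `i` contracts the Hessian with the
cometric. -/
theorem subLap_eq_roughLap (hS : D.CompatibleCometric S)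
    (h : D.adjoint.CompatibleMetric g) (hf : SmoothFun (m := m) f) :
    subLap S g f = roughLap S D f := by
  funext x
  have hdf : (d (m := m) f).Smooth := d_smooth hf
  have hX := S.smooth _ hdf
  rw [subLap, divergence_eq_sum_along h hX, roughLap_eq_contract, contract,
    trace_gext S (Φ := fun A B ↦ D.hessFun A B f x)]
  refine Finset.sum_congr rfl fun i _ ↦ ?_
  have hθ := coframe_smooth (m := m) x i
  have e1 := hS (frame x i) _ _ (frame_smooth x i) hdf hθ x
  have e2 := (onForm_tensor D hdf (frame x i) x).eq_sum (S.smooth _ hθ)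
  have e3 : d (m := m) (fun y ↦ S.cometric y (d f y) (coframe x i y)) x =
      d (m := m) (fun y ↦ coframe x i y (S.sharp y (d f y))) x := by simp only [S.cometric_eq_right]
  have e4 := D.onForm_eval (frame x i) (fun y ↦ S.sharp y (d f y)) (coframe x i) x
  rw [e2, e3, e4] at e1
  simp only [S.cometric_comm (coframe x i x), S.cometric_eq_left]
  have e5 : ∀ l, D.onForm (frame x i) (OneForm.eval (d f)) (frame x l) x =
      D.hessFun (frame x i) (frame x l) f x := fun l ↦ rfl
  simp only [e5] at e1
  linarith

end Divergence

/-! ### The Levi-Civita connection -/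

section Koszul

variable {g : Metric m M} {x : M}

/-- Differentiability of a vector field at a point. -/
abbrev VField.DiffAt (X : VField m M) (x : M) : Prop :=
  MDifferentiableAt (𝓡 m) ((𝓡 m).prod 𝓘(ℝ, Model m))
    (fun x ↦ (TotalSpace.mk' (Model m) x (X x) : TangentBundle (𝓡 m) M)) x

theorem metric_mdiffAt (g : Metric m M) {X Y : VField m M} (hX : X.DiffAt x) (hY : Y.DiffAt x) :
    MDifferentiableAt (𝓡 m) 𝓘(ℝ, ℝ) (fun x ↦ g.inner x (X x) (Y x)) x := by
  have h : MDifferentiableAt (𝓡 m) ((𝓡 m).prod 𝓘(ℝ, ℝ))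
      (fun x ↦ TotalSpace.mk' ℝ (E := Bundle.Trivial M ℝ) x (g.inner x (X x) (Y x))) x :=
    MDifferentiableAt.clm_bundle_apply₂ (F₁ := Model m) (F₂ := Model m) (F₃ := ℝ)
      (E₁ := fun x : M ↦ TangentSpace (𝓡 m) x)
      (E₂ := fun x : M ↦ TangentSpace (𝓡 m) x) (E₃ := Bundle.Trivial M ℝ)
      (g.contMDiff.mdifferentiable (by simp) x) hX hY
  rw [mdifferentiableAt_totalSpace] at h
  exact h.2

/-- The right-hand side of the Koszul formula for `2 g(∇_X Y, Z)`. -/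
def koszul (g : Metric m M) (X Y Z : VField m M) (x : M) : ℝ :=
  d (fun y ↦ g.inner y (Y y) (Z y)) x (X x) + d (fun y ↦ g.inner y (Z y) (X y)) x (Y x)
    - d (fun y ↦ g.inner y (X y) (Y y)) x (Z x)
    + g.inner x (VectorField.mlieBracket (𝓡 m) X Y x) (Z x)
    - g.inner x (VectorField.mlieBracket (𝓡 m) Y Z x) (X x)
    - g.inner x (VectorField.mlieBracket (𝓡 m) X Z x) (Y x)

/-- This is the Leibniz rule of the future connection. Pointwise differentiability suffices, as the
definition of a covariant derivative requires. -/
theorem koszul_smul_middle {X Y Z : VField m M} {f : M → ℝ} (hX : X.DiffAt x) (hY : Y.DiffAt x)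
    (hZ : Z.DiffAt x) (hf : MDifferentiableAt (𝓡 m) 𝓘(ℝ, ℝ) f x) :
    koszul g X (f • Y) Z x = f x * koszul g X Y Z x + 2 * (d f x (X x) * g.inner x (Y x) (Z x)) := by
  have e1 : d (m := m) (fun y ↦ g.inner y ((f • Y) y) (Z y)) x =
      f x • d (fun y ↦ g.inner y (Y y) (Z y)) x + g.inner x (Y x) (Z x) • d f x := by
    rw [← d_mul hf (metric_mdiffAt g hY hZ)]
    simp only [Pi.smul_apply', inner_smul_left]
  have e2 : d (m := m) (fun y ↦ g.inner y (X y) ((f • Y) y)) x =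
      f x • d (fun y ↦ g.inner y (X y) (Y y)) x + g.inner x (X x) (Y x) • d f x := by
    rw [← d_mul hf (metric_mdiffAt g hX hY)]
    simp only [Pi.smul_apply', inner_smul_right]
  simp only [koszul, e1, e2, VectorField.mlieBracket_smul_left hf hY,
    VectorField.mlieBracket_smul_right hf hY]
  simp only [d, Pi.smul_apply', map_smul, FunLike.coe_add, Pi.add_apply, FunLike.coe_smul,
    Pi.smul_apply, smul_eq_mul, inner_add_left]
  rw [g.symm x (Y x) (X x)]
  ring

theorem koszul_add_middle {X Y Y' Z : VField m M} (hX : X.DiffAt x) (hY : Y.DiffAt x)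
    (hY' : Y'.DiffAt x) (hZ : Z.DiffAt x) :
    koszul g X (Y + Y') Z x = koszul g X Y Z x + koszul g X Y' Z x := by
  have e1 := d_add (metric_mdiffAt g hY hZ) (metric_mdiffAt g hY' hZ)
  have e2 := d_add (metric_mdiffAt g hX hY) (metric_mdiffAt g hX hY')
  simp only [koszul, Pi.add_apply, e1, e2, FunLike.coe_add,
    VectorField.mlieBracket_add_left hY hY', VectorField.mlieBracket_add_right hY hY', map_add]
  ring

theorem koszul_tensor_left {Y Z : VField m M} (hY : Y.Smooth) (hZ : Z.Smooth) :
    TensorAt x (fun X ↦ koszul g X Y Z x) where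
  add X X' hX hX' := by
    have e1 := d_add (metric_mdiffAt g (hZ.mdiffAt x) (hX.mdiffAt x))
      (metric_mdiffAt g (hZ.mdiffAt x) (hX'.mdiffAt x))
    have e2 := d_add (metric_mdiffAt g (hX.mdiffAt x) (hY.mdiffAt x))
      (metric_mdiffAt g (hX'.mdiffAt x) (hY.mdiffAt x))
    simp only [koszul, bracket_add_left hX hX', Pi.add_apply,
      e1, e2, FunLike.coe_add, map_add]
    ring
  smul f X hf hX := by
    have e1 : d (m := m) (fun y ↦ g.inner y ((f • X) y) (Y y)) x =
        f x • d (fun y ↦ g.inner y (X y) (Y y)) x + g.inner x (X x) (Y x) • d f x := by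
      rw [← d_mul (hf.mdiffAt x) (metric_mdiffAt g (hX.mdiffAt x) (hY.mdiffAt x))]
      simp only [Pi.smul_apply', inner_smul_left]
    have e2 : d (m := m) (fun y ↦ g.inner y (Z y) ((f • X) y)) x =
        f x • d (fun y ↦ g.inner y (Z y) (X y)) x + g.inner x (Z x) (X x) • d f x := by
      rw [← d_mul (hf.mdiffAt x) (metric_mdiffAt g (hZ.mdiffAt x) (hX.mdiffAt x))]
      simp only [Pi.smul_apply', inner_smul_right]
    simp only [koszul, e1, e2, bracket_smul_left hf hX]
    simp only [dir, Pi.sub_apply, Pi.smul_apply', map_smul, FunLike.coe_add, Pi.add_apply,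
      FunLike.coe_smul, Pi.smul_apply, smul_eq_mul, inner_sub_left]
    rw [g.symm x (Z x) (X x)]
    ring

theorem koszul_add_koszul (X Y Z : VField m M) :
    koszul g X Y Z x + koszul g X Z Y x = 2 * d (fun y ↦ g.inner y (Y y) (Z y)) x (X x) := by
  have e : ∀ A B : VField m M, (fun y ↦ g.inner y (A y) (B y)) = fun y ↦ g.inner y (B y) (A y) :=
    fun A B ↦ funext fun y ↦ g.symm y _ _
  simp only [koszul, e Z Y, e Z X, e Y X, bracket_swap Z Y, Pi.neg_apply, inner_neg_left]
  ring

theorem koszul_sub_koszul (X Y Z : VField m M) :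
    koszul g X Y Z x - koszul g Y X Z x =
      2 * g.inner x (VectorField.mlieBracket (𝓡 m) X Y x) (Z x) := by
  have e : ∀ A B : VField m M, (fun y ↦ g.inner y (A y) (B y)) = fun y ↦ g.inner y (B y) (A y) :=
    fun A B ↦ funext fun y ↦ g.symm y _ _
  simp only [koszul, e Z Y, e Z X, e Y X, bracket_swap Y X, Pi.neg_apply, inner_neg_left]
  ring

/-- By `koszul_add_koszul`, exchanging the last two arguments changes the sign up to the derivative
of `g(Y, Z)`. Tensoriality thus follows from the rules in the middle slot, whose derivative terms
cancel. -/
theorem koszul_tensor_right {X Y : VField m M} (hX : X.Smooth) (hY : Y.Smooth) :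
    TensorAt x (fun Z ↦ koszul g X Y Z x) where
  add Z Z' hZ hZ' := by
    have e1 := dir_add_fun (X := X) (x := x) (metric_smooth g hY hZ) (metric_smooth g hY hZ')
    have e2 := koszul_add_middle (g := g) (hX.mdiffAt x) (hZ.mdiffAt x) (hZ'.mdiffAt x)
      (hY.mdiffAt x)
    have e3 := koszul_add_koszul (g := g) (x := x) X Y (Z + Z')
    simp only [Pi.add_apply, inner_add_right] at e3
    simp only [dir] at e1
    linarith [koszul_add_koszul (g := g) (x := x) X Y Z, koszul_add_koszul (g := g) (x := x) X Y Z']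
  smul f Z hf hZ := by
    have e1 := dir_mul_fun (X := X) (x := x) hf (metric_smooth g hY hZ)
    have e2 := koszul_smul_middle (g := g) (hX.mdiffAt x) (hZ.mdiffAt x) (hY.mdiffAt x)
      (hf.mdiffAt x)
    have e3 := koszul_add_koszul (g := g) (x := x) X Y (f • Z)
    simp only [Pi.smul_apply', inner_smul_right] at e3
    simp only [dir] at e1
    rw [e1, e2, g.symm x (Z x)] at e3
    linear_combination e3 - f x * koszul_add_koszul (g := g) (x := x) X Y Z

theorem koszul_smooth {X Y Z : VField m M} (hX : X.Smooth) (hY : Y.Smooth) (hZ : Z.Smooth) :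
    SmoothFun (m := m) (koszul g X Y Z) :=
  (((((dir_smooth hX (metric_smooth g hY hZ)).add (dir_smooth hY (metric_smooth g hZ hX))).sub
    (dir_smooth hZ (metric_smooth g hX hY))).add (metric_smooth g (hX.bracket hY) hZ)).sub
    (metric_smooth g (hY.bracket hZ) hX)).sub (metric_smooth g (hX.bracket hZ) hY)

theorem exists_inner_eq (g : Metric m M) (x : M) (α : TangentSpace (𝓡 m) x →L[ℝ] ℝ) :
    ∃ v : TangentSpace (𝓡 m) x, g.inner x v = α := by
  have : FiniteDimensional ℝ (TangentSpace (𝓡 m) x) :=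
    inferInstanceAs (FiniteDimensional ℝ (Model m))
  let G : TangentSpace (𝓡 m) x →ₗ[ℝ] Module.Dual ℝ (TangentSpace (𝓡 m) x) :=
    { toFun := fun v ↦ (g.inner x v : TangentSpace (𝓡 m) x →ₗ[ℝ] ℝ)
      map_add' := fun u v ↦ by rw [map_add]; rfl
      map_smul' := fun c v ↦ by rw [map_smul]; rfl }
  have hinj : Function.Injective G := fun u v h ↦
    eq_of_inner (g := g) fun w ↦ LinearMap.congr_fun h w
  obtain ⟨v, hv⟩ := (LinearMap.injective_iff_surjective_of_finrank_eq_finrank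
    Subspace.dual_finrank_eq.symm).1 hinj α
  exact ⟨v, ContinuousLinearMap.ext fun w ↦ LinearMap.congr_fun hv w⟩

/-- The musical isomorphism `♯`, inverse to `v ↦ g(v, ·)`. -/
def msharp (g : Metric m M) (x : M) (α : TangentSpace (𝓡 m) x →L[ℝ] ℝ) : TangentSpace (𝓡 m) x :=
  (exists_inner_eq g x α).choose

theorem inner_msharp (α : TangentSpace (𝓡 m) x →L[ℝ] ℝ) (w : TangentSpace (𝓡 m) x) :
    g.inner x (msharp g x α) w = α w :=
  DFunLike.congr_fun (exists_inner_eq g x α).choose_spec w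

end Koszul

section LeviCivita

variable [T2Space M]

/-- The Levi-Civita connection, defined by the Koszul formula on a coordinate frame at each
point. -/
def leviCivita (g : Metric m M) : Conn m M where
  -- Linearity in the direction is built in by expanding along the frame at `x`; agreement with the
  -- Koszul formula on arbitrary smooth fields is `inner_leviCivita`.
  toFun Y x := ∑ i, (coframe x i x).smulRight
    (msharp g x (∑ j, (1 / 2 * koszul g (frame x i) Y (frame x j) x) • coframe x j x))
  isCovariantDerivativeOnUniv :=
    { add := by
        intro Y Y' x hY hY' _
        refine ContinuousLinearMap.ext fun v ↦ eq_of_inner (g := g) fun w ↦ ?_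
        simp only [FunLike.coe_add, FunLike.coe_sum, Finset.sum_apply, Pi.add_apply,
          ContinuousLinearMap.smulRight_apply, map_sum, map_smul, inner_add_left, FunLike.coe_smul,
          Pi.smul_apply, inner_msharp, smul_eq_mul,
          koszul_add_middle ((frame_smooth x _).mdiffAt x) hY hY' ((frame_smooth x _).mdiffAt x),
          ← Finset.sum_add_distrib]
        refine Finset.sum_congr rfl fun i _ ↦ ?_
        rw [← mul_add, ← Finset.sum_add_distrib]
        congr 1
        exact Finset.sum_congr rfl fun j _ ↦ by ring
      leibniz := by
        intro Y f x hY hf _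
        refine ContinuousLinearMap.ext fun v ↦ eq_of_inner (g := g) fun w ↦ ?_
        simp only [FunLike.coe_add, FunLike.coe_sum, Finset.sum_apply, Pi.add_apply,
          ContinuousLinearMap.smulRight_apply, map_sum, map_smul, inner_add_left, FunLike.coe_smul,
          Pi.smul_apply, inner_msharp, smul_eq_mul,
          koszul_smul_middle ((frame_smooth x _).mdiffAt x) hY ((frame_smooth x _).mdiffAt x) hf]
        have hw : g.inner x (Y x) w = ∑ j, coframe x j x w * g.inner x (Y x) (frame x j x) := by
          conv_lhs => rw [← (sum_coframe_frame_eventually (m := m) x).self_of_nhds w]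
          simp
        have hv : mvfderiv (𝓡 m) f x v = ∑ i, coframe x i x v * d f x (frame x i x) := by
          conv_lhs => rw [← (sum_coframe_frame_eventually (m := m) x).self_of_nhds v]
          simp [d]
        rw [hv, hw, Finset.sum_mul_sum, Finset.mul_sum, ← Finset.sum_add_distrib]
        refine Finset.sum_congr rfl fun i _ ↦ ?_
        simp only [Finset.mul_sum, ← Finset.sum_add_distrib]
        exact Finset.sum_congr rfl fun j _ ↦ by ring }

/-- Both sides are tensorial in `X` and `Z`, and on the frame at `x` they agree by construction. -/
theorem inner_leviCivita (g : Metric m M) {X Y Z : VField m M} (hX : X.Smooth) (hY : Y.Smooth)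
    (hZ : Z.Smooth) (x : M) :
    g.inner x ((leviCivita g).along X Y x) (Z x) = 1 / 2 * koszul g X Y Z x := by
  have e := (koszul_tensor_left (g := g) (x := x) hY hZ).eq_sum hX
  have e' := fun i ↦ (koszul_tensor_right (g := g) (x := x) (frame_smooth x i) hY).eq_sum hZ
  rw [e]
  have e1 : (leviCivita g).along X Y x = ∑ i, coframe x i x (X x) • msharp g x
      (∑ j, (1 / 2 * koszul g (frame x i) Y (frame x j) x) • coframe x j x) := by
    simp only [Conn.along, leviCivita, FunLike.coe_sum, Finset.sum_apply,
      ContinuousLinearMap.smulRight_apply]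
  rw [e1]
  simp only [map_sum, map_smul, FunLike.coe_sum, Finset.sum_apply, FunLike.coe_smul,
    Pi.smul_apply, inner_msharp, e', smul_eq_mul, Finset.mul_sum]
  exact Finset.sum_congr rfl fun i _ ↦ Finset.sum_congr rfl fun j _ ↦ by ring

theorem Conn.ext_inner {g : Metric m M} {x : M} {u v : TangentSpace (𝓡 m) x}
    (h : ∀ W : VField m M, W.Smooth → g.inner x u (W x) = g.inner x v (W x)) : u = v :=
  eq_of_inner (g := g) fun w ↦ by simpa using h (gext w) (gext_smooth w)

theorem leviCivita_smooth (g : Metric m M) : (leviCivita g).Smooth :=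
  Conn.smooth_of_along fun X Y hX hY ↦ VField.smooth_of_inner g fun Z hZ ↦ by
    simp only [inner_leviCivita g hX hY hZ]
    exact SmoothFun.mul contMDiff_const (koszul_smooth hX hY hZ)

/-- Symmetrizing the Koszul expression in its last two slots gives metricity; antisymmetrizing in
the first two gives vanishing torsion. -/
theorem isLeviCivita_leviCivita (g : Metric m M) : IsLeviCivita g (leviCivita g) := by
  refine ⟨leviCivita_smooth g, fun X Y Z hX hY hZ x ↦ ?_, ?_⟩
  · rw [inner_leviCivita g hX hY hZ, g.symm x (Y x), inner_leviCivita g hX hZ hY]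
    linarith [koszul_add_koszul (g := g) (x := x) X Y Z]
  · funext x
    refine ContinuousLinearMap.ext fun u ↦ ContinuousLinearMap.ext fun v ↦
      Conn.ext_inner (g := g) fun W hW ↦ ?_
    have hu := gext_smooth u
    have hv := gext_smooth v
    have h := (leviCivita g).torsion_apply (hu.mdiffAt x) (hv.mdiffAt x)
    rw [gext_self, gext_self] at h
    rw [h]
    have e1 := inner_leviCivita g hu hv hW x
    have e2 := inner_leviCivita g hv hu hW x
    simp only [Conn.along, gext_self] at e1 e2
    rw [inner_sub_left, inner_sub_left, e1, e2]
    refine Eq.trans ?_ (inner_zero_left g (W x)).symm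
    linarith [koszul_sub_koszul (g := g) (x := x) (gext u) (gext v) W]

end LeviCivita

/-! ### The three-form `ζ` -/

section Zeta

variable {S : SubRiemannianStructure m M} {g : Metric m M} {x : M} {X Y A B C W : VField m M}

theorem prV_zero : prV S g 0 = 0 := by
  have h := prV_add (S := S) (g := g) 0 0
  rw [add_zero] at h
  exact left_eq_add.1 h

theorem prH_zero : prH S g 0 = 0 := by
  have h := prH_add (S := S) (g := g) 0 0
  rw [add_zero] at h
  exact left_eq_add.1 h

theorem prV_sub : prV S g (X - Y) = prV S g X - prV S g Y := by
  rw [eq_sub_iff_add_eq, ← prV_add, sub_add_cancel]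

theorem prH_sub : prH S g (X - Y) = prH S g X - prH S g Y := by
  rw [eq_sub_iff_add_eq, ← prH_add, sub_add_cancel]

theorem prV_neg : prV S g (-X) = -prV S g X := by
  rw [← zero_sub, prV_sub, prV_zero, zero_sub]

theorem prH_neg : prH S g (-X) = -prH S g X := by
  rw [← zero_sub, prH_sub, prH_zero, zero_sub]

theorem horCurv_swap (A B : VField m M) : horCurv S g A B = -horCurv S g B A := by
  rw [horCurv, bracket_swap, prV_neg]
  rfl

theorem horCocurv_swap (A B : VField m M) : horCocurv S g A B = -horCocurv S g B A := by
  rw [horCocurv, bracket_swap, prH_neg]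
  rfl

theorem horCurv_smooth (hA : A.Smooth) (hB : B.Smooth) : (horCurv S g A B).Smooth :=
  prV_smooth S g ((prH_smooth S g hA).bracket (prH_smooth S g hB))

theorem horCocurv_smooth (hA : A.Smooth) (hB : B.Smooth) : (horCocurv S g A B).Smooth :=
  prH_smooth S g ((prV_smooth S g hA).bracket (prV_smooth S g hB))

theorem horCurv_add_left (hA : A.Smooth) (hC : C.Smooth) :
    horCurv S g (A + C) B = horCurv S g A B + horCurv S g C B := by
  simp only [horCurv, prH_add, bracket_add_left (prH_smooth S g hA) (prH_smooth S g hC), prV_add]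

theorem horCocurv_add_left (hA : A.Smooth) (hC : C.Smooth) :
    horCocurv S g (A + C) B = horCocurv S g A B + horCocurv S g C B := by
  simp only [horCocurv, prV_add, bracket_add_left (prV_smooth S g hA) (prV_smooth S g hC), prH_add]

/-- The derivative of `f` in the bracket multiplies a horizontal field, which `pr_V` removes. -/
theorem horCurv_smul_left (hg : Tames S g) {f : M → ℝ} (hf : SmoothFun (m := m) f)
    (hA : A.Smooth) : horCurv S g (f • A) B = f • horCurv S g A B := by
  simp only [horCurv, prH_smul, bracket_smul_left hf (prH_smooth S g hA), prV_sub, prV_smul,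
    prV_prH hg, smul_zero, sub_zero]

theorem horCocurv_smul_left (hg : Tames S g) {f : M → ℝ} (hf : SmoothFun (m := m) f)
    (hA : A.Smooth) : horCocurv S g (f • A) B = f • horCocurv S g A B := by
  simp only [horCocurv, prV_smul, bracket_smul_left hf (prV_smooth S g hA), prH_sub, prH_smul,
    prH_prV hg, smul_zero, sub_zero]

theorem zeta_swap_left (A B C : VField m M) : zeta S g A B C x = -zeta S g B A C x := by
  simp only [zeta, horCurv_swap B A, horCurv_swap A C, horCurv_swap C B, horCocurv_swap B A,
    horCocurv_swap A C, horCocurv_swap C B, Pi.neg_apply, inner_neg_left]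
  ring

theorem zeta_cyclic (A B C : VField m M) : zeta S g A B C x = zeta S g B C A x := by
  simp only [zeta]
  ring

theorem zeta_swap_right (A B C : VField m M) : zeta S g A B C x = -zeta S g A C B x := by
  rw [zeta_cyclic, zeta_swap_left, zeta_cyclic C B A, zeta_cyclic B A C]

theorem zeta_smooth (hA : A.Smooth) (hB : B.Smooth) (hC : C.Smooth) :
    SmoothFun (m := m) (zeta S g A B C) :=
  (((metric_smooth g (horCurv_smooth hA hB) hC).add (metric_smooth g (horCurv_smooth hB hC) hA)).add
    (metric_smooth g (horCurv_smooth hC hA) hB)).add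
  (((metric_smooth g (horCocurv_smooth hA hB) hC).add
    (metric_smooth g (horCocurv_smooth hB hC) hA)).add
    (metric_smooth g (horCocurv_smooth hC hA) hB))

theorem zeta_tensor_left (hg : Tames S g) (B C : VField m M) :
    TensorAt x (fun A ↦ zeta S g A B C x) where
  add A A' hA hA' := by
    simp only [zeta, horCurv_swap C, horCocurv_swap C, horCurv_add_left hA hA',
      horCocurv_add_left hA hA', Pi.add_apply, Pi.neg_apply, inner_neg_left, inner_add_left,
      inner_add_right]
    ring
  smul f A hf hA := by
    simp only [zeta, horCurv_swap C, horCocurv_swap C, horCurv_smul_left hg hf hA,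
      horCocurv_smul_left hg hf hA, Pi.smul_apply', Pi.neg_apply, inner_neg_left, inner_smul_left,
      inner_smul_right]
    ring

variable [T2Space M]

/-- Cyclic symmetry rotates each argument into the first slot, so tensoriality is needed only there.
-/
theorem zeta_eq_sum (hg : Tames S g) (hA : A.Smooth) (hB : B.Smooth) (hC : C.Smooth) :
    zeta S g A B C x = ∑ i, coframe x i x (A x) * ∑ j, coframe x j x (B x) *
      ∑ k, coframe x k x (C x) * zeta S g (frame x i) (frame x j) (frame x k) x := by
  rw [(zeta_tensor_left hg B C).eq_sum hA]
  refine Finset.sum_congr rfl fun i _ ↦ ?_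
  rw [zeta_cyclic, (zeta_tensor_left hg C (frame x i)).eq_sum hB]
  congr 1
  refine Finset.sum_congr rfl fun j _ ↦ ?_
  rw [zeta_cyclic, (zeta_tensor_left hg (frame x i) (frame x j)).eq_sum hC]
  congr 1
  refine Finset.sum_congr rfl fun k _ ↦ ?_
  rw [zeta_cyclic]

/-- The vector-valued two-form `½ ♯ζ(A, B, ·)`. -/
def halfSharpZeta (S : SubRiemannianStructure m M) (g : Metric m M) (x : M) :
    TangentSpace (𝓡 m) x →L[ℝ] TangentSpace (𝓡 m) x →L[ℝ] TangentSpace (𝓡 m) x :=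
  ∑ i, (coframe x i x).smulRight (∑ j, (coframe x j x).smulRight (msharp g x
    (∑ k, (1 / 2 * zeta S g (frame x i) (frame x j) (frame x k) x) • coframe x k x)))

theorem inner_halfSharpZeta (hg : Tames S g) (hA : A.Smooth) (hB : B.Smooth) (hC : C.Smooth) :
    g.inner x (halfSharpZeta S g x (A x) (B x)) (C x) = 1 / 2 * zeta S g A B C x := by
  rw [zeta_eq_sum hg hA hB hC]
  simp only [halfSharpZeta, FunLike.coe_sum, Finset.sum_apply, FunLike.coe_smul, Pi.smul_apply,
    ContinuousLinearMap.smulRight_apply, map_sum, map_smul, inner_msharp, smul_eq_mul,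
    Finset.mul_sum]
  exact Finset.sum_congr rfl fun i _ ↦ Finset.sum_congr rfl fun j _ ↦
    Finset.sum_congr rfl fun k _ ↦ by ring

/-! ### The connection `∇ = ∇^g - ½ ♯ζ` -/

/-- The connection `∇_A B = ∇'_A B - ½ ♯ζ(A, B, ·)`. -/
def zetaConn (S : SubRiemannianStructure m M) (g : Metric m M) (LC : Conn m M) : Conn m M :=
  CovariantDerivative.addOneForm LC (halfSharpZeta S g)

variable {LC : Conn m M}

theorem inner_zetaConn (hg : Tames S g) (LC : Conn m M) (hA : A.Smooth) (hB : B.Smooth)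
    (hC : C.Smooth) : g.inner x ((zetaConn S g LC).along A B x) (C x) =
      g.inner x (LC.along A B x) (C x) - 1 / 2 * zeta S g A B C x := by
  -- The correction takes the differentiated field first and the direction second, so antisymmetry
  -- of `ζ` yields the minus sign.
  have h : (zetaConn S g LC).along A B x = LC.along A B x + halfSharpZeta S g x (B x) (A x) := rfl
  rw [h, inner_add_left, inner_halfSharpZeta hg hB hA hC, zeta_swap_left B]
  ring

theorem zetaConn_smooth (hg : Tames S g) (h : LC.Smooth) : (zetaConn S g LC).Smooth :=
  Conn.smooth_of_along fun X Y hX hY ↦ VField.smooth_of_inner g fun Z hZ ↦ by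
    simp only [inner_zetaConn hg LC hX hY hZ]
    exact (metric_smooth g (h.along hX hY) hZ).sub
      (SmoothFun.mul contMDiff_const (zeta_smooth hX hY hZ))

theorem zetaConn_compatibleMetric (hg : Tames S g) (h : LC.CompatibleMetric g) :
    (zetaConn S g LC).CompatibleMetric g := by
  intro X Y Z hX hY hZ x
  rw [h X Y Z hX hY hZ x, inner_zetaConn hg LC hX hY hZ, g.symm x (Y x) ((zetaConn S g LC).along X Z x),
    inner_zetaConn hg LC hX hZ hY, zeta_swap_right X Z Y, g.symm x (Y x)]
  ring

theorem IsLeviCivita.along_sub (h : IsLeviCivita g LC) (hX : X.Smooth) (hY : Y.Smooth) :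
    VectorField.mlieBracket (𝓡 m) X Y = LC.along X Y - LC.along Y X :=
  funext fun x ↦ (((CovariantDerivative.torsion_eq_zero_iff LC).1 h.2.2) (hX.mdiffAt x)
    (hY.mdiffAt x)).symm

/-- The Levi-Civita connection is its own adjoint, so only the antisymmetric correction changes
sign. -/
theorem inner_zetaConn_adjoint (hg : Tames S g) (h : IsLeviCivita g LC) (hA : A.Smooth)
    (hB : B.Smooth) (hC : C.Smooth) :
    g.inner x ((zetaConn S g LC).adjoint.along A B x) (C x) =
      g.inner x (LC.along A B x) (C x) + 1 / 2 * zeta S g A B C x := by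
  rw [Conn.adjoint_along _ hA hB, Pi.add_apply, inner_add_left, inner_zetaConn hg LC hB hA hC,
    h.along_sub hA hB, Pi.sub_apply, inner_sub_left, zeta_swap_left B]
  ring

theorem zetaConn_adjoint_compatibleMetric (hg : Tames S g) (h : IsLeviCivita g LC) :
    (zetaConn S g LC).adjoint.CompatibleMetric g := by
  intro X Y Z hX hY hZ x
  rw [h.2.1 X Y Z hX hY hZ x, inner_zetaConn_adjoint hg h hX hY hZ,
    g.symm x (Y x) ((zetaConn S g LC).adjoint.along X Z x),
    inner_zetaConn_adjoint hg h hX hZ hY, zeta_swap_right X Z Y, g.symm x (Y x)]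
  ring

theorem IsLeviCivita.koszul_eq (h : IsLeviCivita g LC) (hX : X.Smooth) (hY : Y.Smooth)
    (hW : W.Smooth) : koszul g X Y W x = 2 * g.inner x (LC.along X Y x) (W x) := by
  rw [koszul, h.2.1 X Y W hX hY hW, h.2.1 Y W X hY hW hX, h.2.1 W X Y hW hX hY,
    h.along_sub hX hY, h.along_sub hY hW, h.along_sub hX hW]
  simp only [Pi.sub_apply, inner_sub_left]
  rw [g.symm x (Y x), g.symm x (W x), g.symm x (X x)]
  ring

/-! ### Compatibility with the cometric when `II` vanishes -/

theorem prV_eq_zero_of_prH (h : prH S g X = X) : prV S g X = 0 := by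
  have := prH_add_prV S g X
  rw [h] at this
  exact add_eq_left.1 this

theorem prV_eq_self_of_prH (h : prH S g X = 0) : prV S g X = X := by
  have := prH_add_prV S g X
  rwa [h, zero_add] at this

theorem lieDerivMetric_zero : lieDerivMetric g (0 : VField m M) 0 0 x = 0 := by
  simp [lieDerivMetric]

/-- For horizontal `A`, `B` and vertical `W`, all arguments of the other Lie derivative in `II`
project to zero. -/
theorem IIVanishes.lieDeriv_horizontal (h : IIVanishes S g) (hA : A.Smooth) (hB : B.Smooth)
    (hW : W.Smooth) (hAH : prH S g A = A) (hBH : prH S g B = B) (hWV : prH S g W = 0) :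
    lieDerivMetric g W A B x = 0 := by
  have := h A B W hA hB hW x
  rw [II, prV_eq_self_of_prH hWV, hWV, prV_eq_zero_of_prH hAH, prV_eq_zero_of_prH hBH, hAH, hBH,
    lieDerivMetric_zero] at this
  linarith

theorem IIVanishes.lieDeriv_vertical (h : IIVanishes S g) (hA : A.Smooth) (hB : B.Smooth)
    (hW : W.Smooth) (hAV : prH S g A = 0) (hBV : prH S g B = 0) (hWH : prH S g W = W) :
    lieDerivMetric g W A B x = 0 := by
  have := h A B W hA hB hW x
  rw [II, prV_eq_zero_of_prH hWH, hWH, prV_eq_self_of_prH hAV, prV_eq_self_of_prH hBV, hAV, hBV,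
    lieDerivMetric_zero] at this
  linarith

theorem inner_eq_zero_of (hg : Tames S g) (hX : prH S g X = X) (hW : prH S g W = 0) (y : M) :
    g.inner y (X y) (W y) = 0 := by
  rw [← hX, inner_prH_left hg, hW, Pi.zero_apply, inner_zero_right]

/-- Here `ζ(X, Y, W) = g([X, Y], W)`. The Koszul expression is this bracket term minus `(𝓛_W g)(X,
Y)`, and the latter vanishes with `II`. -/
theorem inner_zetaConn_horizontal (hg : Tames S g) (hII : IIVanishes S g) (h : IsLeviCivita g LC)
    (hX : X.Smooth) (hY : Y.Smooth) (hW : W.Smooth) (hXH : prH S g X = X) (hYH : prH S g Y = Y)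
    (hWV : prH S g W = 0) : g.inner x ((zetaConn S g LC).along X Y x) (W x) = 0 := by
  have hz : zeta S g X Y W x = g.inner x (VectorField.mlieBracket (𝓡 m) X Y x) (W x) := by
    simp only [zeta, horCurv, horCocurv, hXH, hYH, hWV, prV_eq_zero_of_prH hXH,
      prV_eq_zero_of_prH hYH, VectorField.mlieBracket_zero_left, VectorField.mlieBracket_zero_right,
      prV_zero, prH_zero, Pi.zero_apply, inner_zero_left, inner_prV_left hg,
      prV_eq_self_of_prH hWV]
    ring
  have hk := h.koszul_eq (x := x) hX hY hW
  have hl := hII.lieDeriv_horizontal (x := x) hX hY hW hXH hYH hWV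
  have e1 : (fun y ↦ g.inner y (Y y) (W y)) = fun _ ↦ 0 := funext (inner_eq_zero_of hg hYH hWV)
  have e2 : (fun y ↦ g.inner y (W y) (X y)) = fun _ ↦ 0 := funext fun y ↦
    (g.symm y _ _).trans (inner_eq_zero_of hg hXH hWV y)
  rw [inner_zetaConn hg LC hX hY hW, hz]
  simp only [koszul, e1, e2, d_const, zero_apply, bracket_swap Y W, bracket_swap X W, Pi.neg_apply,
    inner_neg_left] at hk
  simp only [lieDerivMetric] at hl
  rw [g.symm x (X x)] at hl
  linarith

/-- Only the cocurvature term `ζ(X, Y, W) = g([W, X], Y)` survives. The Koszul expression is this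
term plus `(𝓛_Y g)(X, W)`, which vanishes with `II`. -/
theorem inner_zetaConn_vertical (hg : Tames S g) (hII : IIVanishes S g) (h : IsLeviCivita g LC)
    (hX : X.Smooth) (hY : Y.Smooth) (hW : W.Smooth) (hXV : prH S g X = 0) (hYH : prH S g Y = Y)
    (hWV : prH S g W = 0) : g.inner x ((zetaConn S g LC).along X Y x) (W x) = 0 := by
  have hz : zeta S g X Y W x = g.inner x (VectorField.mlieBracket (𝓡 m) W X x) (Y x) := by
    simp only [zeta, horCurv, horCocurv, hXV, hYH, hWV, prV_eq_self_of_prH hXV,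
      prV_eq_zero_of_prH hYH, VectorField.mlieBracket_zero_left, VectorField.mlieBracket_zero_right,
      prV_zero, prH_zero, Pi.zero_apply, inner_zero_left, inner_prH_left hg,
      prV_eq_self_of_prH hWV]
    ring
  have hk := h.koszul_eq (x := x) hX hY hW
  have hl := hII.lieDeriv_vertical (x := x) hX hW hY hXV hWV hYH
  have e1 : (fun y ↦ g.inner y (Y y) (W y)) = fun _ ↦ 0 := funext (inner_eq_zero_of hg hYH hWV)
  have e2 : (fun y ↦ g.inner y (X y) (Y y)) = fun _ ↦ 0 := funext fun y ↦
    (g.symm y _ _).trans (inner_eq_zero_of hg hYH hXV y)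
  have e3 : (fun y ↦ g.inner y (W y) (X y)) = fun y ↦ g.inner y (X y) (W y) :=
    funext fun y ↦ g.symm y _ _
  rw [inner_zetaConn hg LC hX hY hW, hz]
  simp only [koszul, e1, e2, e3, d_const, zero_apply, bracket_swap X Y, bracket_swap X W,
    Pi.neg_apply, inner_neg_left] at hk
  simp only [lieDerivMetric] at hl
  rw [g.symm x (X x)] at hl
  linarith

theorem zetaConn_along_mem (hg : Tames S g) (hII : IIVanishes S g) (h : IsLeviCivita g LC)
    (hX : X.Smooth) (hY : Y.Smooth) (hYH : ∀ x, Y x ∈ S.H x) (x : M) :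
    (zetaConn S g LC).along X Y x ∈ S.H x := by
  rw [mem_H_iff hg]
  refine Conn.ext_inner (g := g) fun W hW ↦ ?_
  rw [inner_zero_left, inner_prV_left hg, ← prH_add_prV S g X, Conn.along_add_left, Pi.add_apply,
    inner_add_left]
  have hY' : prH S g Y = Y := funext fun y ↦ prH_of_mem hg Y y (hYH y)
  rw [inner_zetaConn_horizontal hg hII h (prH_smooth S g hX) hY (prV_smooth S g hW)
    (prH_prH hg X) hY' (prH_prV hg W), inner_zetaConn_vertical hg hII h (prV_smooth S g hX) hY
    (prV_smooth S g hW) (prH_prV hg X) hY' (prH_prV hg W), add_zero]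

theorem zetaConn_compatibleCometric (hg : Tames S g) (hII : IIVanishes S g)
    (h : IsLeviCivita g LC) : (zetaConn S g LC).CompatibleCometric S :=
  Conn.compatibleCometric_of hg
    (fun _ _ _ hX hY hZ _ _ x ↦ zetaConn_compatibleMetric hg h.2.1 _ _ _ hX hY hZ x)
    fun _ _ hX hY hYH x ↦ zetaConn_along_mem hg hII h hX hY hYH x

end Zeta

/-! ### Comparison of Ricci curvatures -/

section Ricci

variable [T2Space M] {S : SubRiemannianStructure m M} {g : Metric m M} {D D' : Conn m M}
  {x : M} {X Y Z A B C E : VField m M}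

/-- The difference of the adjoints is the difference of the connections with its arguments
exchanged, since brackets cancel. Both adjoints being metric makes it skew in direction and output;
no argument need be horizontal. -/
theorem difference_swap_outer (h : D.adjoint.CompatibleMetric g) (h' : D'.adjoint.CompatibleMetric g)
    (hA : A.Smooth) (hB : B.Smooth) (hC : C.Smooth) :
    g.inner x ((D'.along A B - D.along A B) x) (C x) =
      -g.inner x ((D'.along C B - D.along C B) x) (A x) := by
  have e1 := h B A C hB hA hC x
  have e2 := h' B A C hB hA hC x
  rw [D.adjoint_along hB hA, D.adjoint_along hB hC] at e1
  rw [D'.adjoint_along hB hA, D'.adjoint_along hB hC] at e2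
  simp only [Pi.add_apply, Pi.sub_apply, inner_add_left, inner_add_right, inner_sub_left] at e1 e2 ⊢
  rw [g.symm x (A x) (D.along C B x)] at e1
  rw [g.symm x (A x) (D'.along C B x)] at e2
  linarith

theorem difference_swap_right (hg : Tames S g) (h : D.CompatibleCometric S)
    (h' : D'.CompatibleCometric S) (hA : A.Smooth) (hB : B.Smooth) (hC : C.Smooth)
    (hBH : ∀ y, B y ∈ S.H y) (hCH : ∀ y, C y ∈ S.H y) :
    g.inner x ((D'.along A B - D.along A B) x) (C x) =
      -g.inner x ((D'.along A C - D.along A C) x) (B x) := by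
  have e1 := h.metric hg hA hB hC hBH hCH x
  have e2 := h'.metric hg hA hB hC hBH hCH x
  simp only [Pi.sub_apply, inner_sub_left]
  rw [g.symm x (B x)] at e1 e2
  linarith

theorem curv_mem (hg : Tames S g) (h : D.CompatibleCometric S) (hD : D.Smooth) (hX : X.Smooth)
    (hY : Y.Smooth) (hZ : Z.Smooth) (hZH : ∀ y, Z y ∈ S.H y) (y : M) :
    D.curv X Y Z y ∈ S.H y := by
  have h1 := h.along_mem hg hX (hD.along hY hZ) (h.along_mem hg hY hZ hZH) y
  have h2 := h.along_mem hg hY (hD.along hX hZ) (h.along_mem hg hX hZ hZH) y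
  have h3 := h.along_mem hg (hX.bracket hY) hZ hZH y
  exact Submodule.sub_mem _ (Submodule.sub_mem _ h1 h2) h3

/-- Compared with the connection `D` whose torsion is vertical on horizontal vectors, any other
compatible connection `D'` changes `⟨R(E, Y)E, Y⟩` by `|D'_Y E - D_Y E|²`. -/
theorem inner_curv_sub (hg : Tames S g) (hD : D.Smooth) (hD' : D'.Smooth)
    (h : D.CompatibleCometric S) (h' : D'.CompatibleCometric S)
    (ha : D.adjoint.CompatibleMetric g) (ha' : D'.adjoint.CompatibleMetric g)
    (hT : ∀ A B C : VField m M, A.Smooth → B.Smooth → C.Smooth → (∀ y, A y ∈ S.H y) →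
      (∀ y, B y ∈ S.H y) → (∀ y, C y ∈ S.H y) → ∀ y,
      g.inner y (VectorField.mlieBracket (𝓡 m) A B y) (C y) =
        g.inner y (D.along A B y) (C y) - g.inner y (D.along B A y) (C y))
    (hE : E.Smooth) (hY : Y.Smooth) (hEH : ∀ y, E y ∈ S.H y) (hYH : ∀ y, Y y ∈ S.H y) (x : M) :
    g.inner x (D'.curv E Y E x) (Y x) - g.inner x (D.curv E Y E x) (Y x) =
      g.inner x ((D'.along Y E - D.along Y E) x) ((D'.along Y E - D.along Y E) x) := by
  set P : VField m M := D'.along Y E - D.along Y E with hP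
  have sw {A B C : VField m M} {x : M} (hA : A.Smooth) (hB : B.Smooth) (hC : C.Smooth) :=
    difference_swap_outer (g := g) (x := x) ha ha' hA hB hC
  have sr {A B C : VField m M} {x : M} (hA : A.Smooth) (hB : B.Smooth) (hC : C.Smooth)
      (hBH : ∀ y, B y ∈ S.H y) (hCH : ∀ y, C y ∈ S.H y) :=
    difference_swap_right (x := x) hg h h' hA hB hC hBH hCH
  have hYE := hD.along hY hE
  have hYEH := h.along_mem hg hY hE hEH
  have hEE := hD.along hE hE
  have hEEH := h.along_mem hg hE hE hEH
  have hPs : P.Smooth := (hD'.along hY hE).sub hYE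
  have hPH : ∀ y, P y ∈ S.H y := fun y ↦
    Submodule.sub_mem _ (h'.along_mem hg hY hE hEH y) (hYEH y)
  -- The difference on `(E, E)` is horizontal, so it is tested against horizontal `W`; the two skew
  -- symmetries then force it to vanish.
  have hEE' : D'.along E E = D.along E E := by
    funext y
    refine Conn.ext_inner (g := g) fun W hW ↦ ?_
    have hH : ∀ y, (D'.along E E - D.along E E) y ∈ S.H y := fun y ↦
      Submodule.sub_mem _ (h'.along_mem hg hE hE hEH y) (hEEH y)
    have e0 : g.inner y ((D'.along E E - D.along E E) y) (W y) =
        g.inner y ((D'.along E E - D.along E E) y) (prH S g W y) := by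
      rw [← inner_prH_left hg, prH_of_mem hg _ y (hH y)]
    have hWs := prH_smooth S g hW
    have hWH := prH_mem S g W
    have e1 := sw (x := y) hE hE hWs
    have e2 := sr (x := y) hWs hE hE hEH hEH
    have e3 : g.inner y ((D'.along E E - D.along E E) y) (W y) = 0 := by linarith
    rw [Pi.sub_apply, inner_sub_left] at e3
    linarith
  -- Skewness in the outer slots makes `P` orthogonal to `Y` at every point, so the identity may be
  -- differentiated along `E` in `k1`.
  have hYP : (fun y ↦ g.inner y (Y y) (P y)) = fun _ ↦ 0 := by
    funext y
    have := sw (x := y) hY hE hY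
    rw [g.symm]
    linarith
  have c1 : D'.along E (D'.along Y E) = D'.along E (D.along Y E) + D'.along E P := by
    rw [← D'.along_add_right hYE hPs, hP, add_sub_cancel]
  have k1 := h.metric hg hE hY hPs hYH hPH x
  rw [hYP] at k1
  have k2 := sw (x := x) hE hYE hY
  have k3 := sr (x := x) hE hYE hY hYEH hYH
  have k4 := sw (x := x) hE hY hYE
  have k5 := sr (x := x) hYE hY hE hYH hEH
  have k6 := sw (x := x) hYE hE hY
  have k7 := sr (x := x) hE hPs hY hPH hYH
  have k8 := sw (x := x) hE hY hPs
  have k9 := sr (x := x) hPs hY hE hYH hEH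
  have k10 := sw (x := x) hPs hE hY
  have k11 := sw (x := x) hY hEE hY
  -- The bracket need not be horizontal, so here only the outer skewness is used.
  have k12 := sw (x := x) (hE.bracket hY) hE hY
  -- The torsion condition rewrites the bracket term so that all products of `P` with first
  -- derivatives of `E` and `Y` cancel, leaving `g(P, P)`.
  have k13 := hT E Y P hE hY hPs hEH hYH hPH x
  rw [← hP] at k6 k10 k12
  simp only [dir, d_const, zero_apply] at k1
  simp only [Conn.curv, c1, hEE', Pi.add_apply, inner_sub_left, inner_add_left]
  simp only [Pi.sub_apply, inner_sub_left] at k2 k3 k4 k5 k6 k7 k8 k9 k10 k11 k12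
  rw [g.symm x (Y x) (D.along E P x)] at k1
  rw [g.symm x (P x) (VectorField.mlieBracket (𝓡 m) E Y x)] at k12
  rw [g.symm x (P x) (D.along Y E x)] at k6
  linarith

theorem inner_self_nonneg (g : Metric m M) (v : TangentSpace (𝓡 m) x) : 0 ≤ g.inner x v v := by
  by_cases hv : v = 0
  · rw [hv, inner_zero_left]
  · exact (g.pos x v hv).le

/-- The trace is computed in a diagonalizing horizontal family. Curvature of `∇` preserves `H`, so
pairing with `α` is the inner product with `♯^H α`. -/
theorem ricQuad_eq_sum (hg : Tames S g) (hD : D.Smooth) (h : D.CompatibleCometric S)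
    (α : TangentSpace (𝓡 m) x →L[ℝ] ℝ) (hY : Y.Smooth)
    (hYx : Y x = S.sharp x α) {n : ℕ} {E : Fin n → VField m M} {c : Fin n → ℝ}
    (hE : ∀ k, (E k).Smooth) (hEH : ∀ k y, E k y ∈ S.H y)
    (hc : ∀ β γ, S.cometric x β γ = ∑ k, c k * (β (E k x) * γ (E k x))) :
    ricQuad S D x α = -∑ k, c k * g.inner x (D.curv (E k) Y (E k) x) (Y x) := by
  have hc' : ∀ β γ, S.cometric x β γ =
      ∑ k, ∑ l, (if k = l then c k else 0) * (β (E k x) * γ (E l x)) := fun β γ ↦ by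
    simp [hc]
  have h1 : ricQuad S D x α =
      S.trace x (fun u w ↦ -α (D.curv (gext u) Y (gext w) x)) := by
    simp only [ricQuad, ric, curv_ext hD]
    congr 1
    funext u w
    rw [(curv_tensor hD α (gext_smooth w)).congr (gext_smooth _) hY (by rw [gext_self, hYx])]
  rw [h1, trace_eq_sum S (curv_bitensor hD α hY) hE hc', ← Finset.sum_neg_distrib]
  refine Finset.sum_congr rfl fun k _ ↦ ?_
  have h2 : α (D.curv (E k) Y (E k) x) = g.inner x (D.curv (E k) Y (E k) x) (Y x) := by
    rw [g.symm, hYx, inner_sharp hg x α (curv_mem hg h hD (hE k) hY (hE k) (hEH k) x)]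
  simp [h2]

/-- Each term of the diagonal trace changes by a nonnegative square with positive weight, and the
overall sign of the sum is negative. -/
theorem ricQuad_le (hg : Tames S g) (hD : D.Smooth) (hD' : D'.Smooth)
    (h : D.CompatibleCometric S) (h' : D'.CompatibleCometric S)
    (ha : D.adjoint.CompatibleMetric g) (ha' : D'.adjoint.CompatibleMetric g)
    (hT : ∀ A B C : VField m M, A.Smooth → B.Smooth → C.Smooth → (∀ y, A y ∈ S.H y) →
      (∀ y, B y ∈ S.H y) → (∀ y, C y ∈ S.H y) → ∀ y,
      g.inner y (VectorField.mlieBracket (𝓡 m) A B y) (C y) =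
        g.inner y (D.along A B y) (C y) - g.inner y (D.along B A y) (C y))
    (α : TangentSpace (𝓡 m) x →L[ℝ] ℝ) : ricQuad S D' x α ≤ ricQuad S D x α := by
  obtain ⟨n, b, c, hb, hc, hbc⟩ := S.exists_cometric_eq_sum x
  have hv : ∀ v ∈ S.H x, prH S g (gext v) x = v := fun v hv ↦ by
    rw [prH_of_mem hg _ x (by rwa [gext_self]), gext_self]
  have hE : ∀ k, (prH S g (gext (b k))).Smooth := fun k ↦ prH_smooth S g (gext_smooth _)
  have hEH : ∀ k y, prH S g (gext (b k)) y ∈ S.H y := fun k ↦ prH_mem S g _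
  have hY : (prH S g (gext (S.sharp x α))).Smooth := prH_smooth S g (gext_smooth _)
  have hYH := prH_mem S g (gext (S.sharp x α))
  have hYx := hv _ (S.sharp_mem x α)
  have hbc' : ∀ β γ, S.cometric x β γ = ∑ k, c k *
      (β (prH S g (gext (b k)) x) * γ (prH S g (gext (b k)) x)) := fun β γ ↦ by
    simp only [hv _ (hb _), hbc]
  rw [ricQuad_eq_sum hg hD' h' α hY hYx hE hEH hbc', ricQuad_eq_sum hg hD h α hY hYx hE hEH hbc',
    neg_le_neg_iff]
  refine Finset.sum_le_sum fun k _ ↦ mul_le_mul_of_nonneg_left ?_ (hc k).le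
  have := inner_curv_sub hg hD hD' h h' ha ha' hT (hE k) hY (hEH k) hYH x
  linarith [inner_self_nonneg g ((D'.along (prH S g (gext (S.sharp x α))) (prH S g (gext (b k)))
    - D.along (prH S g (gext (S.sharp x α))) (prH S g (gext (b k)))) x)]

/-- On horizontal triples every term of `ζ` vanishes, so horizontally the connection is as torsion
free as the Levi-Civita connection. -/
theorem zetaConn_bracket (hg : Tames S g) {LC : Conn m M} (h : IsLeviCivita g LC)
    (hA : A.Smooth) (hB : B.Smooth) (hC : C.Smooth) (hAH : ∀ y, A y ∈ S.H y)
    (hBH : ∀ y, B y ∈ S.H y) (hCH : ∀ y, C y ∈ S.H y) (y : M) :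
    g.inner y (VectorField.mlieBracket (𝓡 m) A B y) (C y) =
      g.inner y ((zetaConn S g LC).along A B y) (C y)
        - g.inner y ((zetaConn S g LC).along B A y) (C y) := by
  have hz : ∀ {A B C : VField m M}, (∀ y, A y ∈ S.H y) → (∀ y, B y ∈ S.H y) →
      (∀ y, C y ∈ S.H y) → zeta S g A B C y = 0 := fun {A B C} hA hB hC ↦ by
    have pV : ∀ {X : VField m M}, (∀ y, X y ∈ S.H y) → prV S g X = 0 := fun hX ↦
      funext fun y ↦ prV_eq_zero hg (hX y)
    simp only [zeta, horCurv, horCocurv, pV hA, pV hB, pV hC, VectorField.mlieBracket_zero_left,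
      inner_prV_left hg, prH_zero, Pi.zero_apply, inner_zero_left, inner_zero_right]
    ring
  rw [inner_zetaConn hg LC hA hB hC, inner_zetaConn hg LC hB hA hC, hz hAH hBH hCH,
    hz hBH hAH hCH, h.along_sub hA hB, Pi.sub_apply, inner_sub_left]
  ring

end Ricci

end SubRiem

end

theorem proposition3p3 {m : ℕ} {M : Type*} [TopologicalSpace M] [T2Space M]
    [SecondCountableTopology M] [ChartedSpace (EuclideanSpace ℝ (Fin m)) M] [IsManifold (𝓡 m) ∞ M]
    (S : SubRiemannianStructure m M) (g : Metric m M) (hg : Tames S g) :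
    (∀ D : Conn m M, D.Smooth → D.CompatibleCometric S → D.adjoint.CompatibleMetric g →
      IIVanishes S g ∧
      ∀ f : M → ℝ, ContMDiff (𝓡 m) 𝓘(ℝ, ℝ) ∞ f →
        MDifferentiable (𝓡 m) 𝓘(ℝ, ℝ) (roughLap S D.adjoint f) ∧
        MDifferentiable (𝓡 m) 𝓘(ℝ, ℝ) (roughLap S D f) ∧
        MDifferentiable (𝓡 m) 𝓘(ℝ, ℝ) (subLap S g f) ∧
        (∀ (x : M) (v : TangentSpace (𝓡 m) x),
          roughLapForm S D.adjoint (d f) x v - ric S D x (d f x) v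
            = d (roughLap S D.adjoint f) x v) ∧
        d (roughLap S D.adjoint f) = d (m := m) (roughLap S D f) ∧
        d (roughLap S D f) = d (m := m) (subLap S g f)) ∧
    (∃ LC : Conn m M, IsLeviCivita g LC) ∧
    (IIVanishes S g → ∀ LC : Conn m M, IsLeviCivita g LC →
      ∃ D : Conn m M, D.Smooth ∧
        (∀ A B C : VField m M, A.Smooth → B.Smooth → C.Smooth → ∀ x,
          g.inner x (D.along A B x) (C x)
            = g.inner x (LC.along A B x) (C x) - (1 / 2) * zeta S g A B C x) ∧
        (∀ A B C : VField m M, A.Smooth → B.Smooth → C.Smooth → ∀ x,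
          g.inner x (D.adjoint.along A B x) (C x)
            = g.inner x (LC.along A B x) (C x) + (1 / 2) * zeta S g A B C x) ∧
        D.CompatibleCometric S ∧ D.CompatibleMetric g ∧ D.adjoint.CompatibleMetric g ∧
        ∀ D' : Conn m M, D'.Smooth → D'.CompatibleCometric S → D'.adjoint.CompatibleMetric g →
          ∀ x : M,
            (∀ α : TangentSpace (𝓡 m) x →L[ℝ] ℝ, ricQuad S D' x α ≤ ricQuad S D x α) ∧
            ricLowerBound S D' x ≤ ricLowerBound S D x) := by
  refine ⟨fun D hD hS hg' ↦ ⟨iiVanishes_of_compatible hg hS hg', fun f hf ↦ ?_⟩,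
    ⟨leviCivita g, isLeviCivita_leviCivita g⟩, fun hII LC hLC ↦ ?_⟩
  · have h1 := roughLap_adjoint S D hf
    have h2 := subLap_eq_roughLap hS hg' hf
    have h3 : MDifferentiable (𝓡 m) 𝓘(ℝ, ℝ) (roughLap S D f) := (roughLap_smooth S hD hf).mdiffAt
    -- All three Laplacians become the same function, so the three regularity claims and the last
    -- two equalities of differentials collapse.
    rw [h1, h2]
    exact ⟨h3, h3, h3, weitzenboeck hD hS hf, rfl, rfl⟩
  · have hD := zetaConn_smooth hg hLC.1
    have hS := zetaConn_compatibleCometric hg hII hLC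
    have ha := zetaConn_adjoint_compatibleMetric hg hLC
    refine ⟨zetaConn S g LC, hD, fun A B C hA hB hC x ↦ inner_zetaConn hg LC hA hB hC,
      fun A B C hA hB hC x ↦ inner_zetaConn_adjoint hg hLC hA hB hC, hS,
      zetaConn_compatibleMetric hg hLC.2.1, ha, fun D' hD' hS' ha' x ↦ ?_⟩
    have hle := fun α ↦ ricQuad_le (x := x) hg hD hD' hS hS' ha ha'
      (fun A B C hA hB hC ↦ zetaConn_bracket hg hLC hA hB hC) α
    -- Both infima run over the same unit covectors. Values are in `EReal`, so no boundedness or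
    -- nonemptiness is required.
    exact ⟨hle, iInf_mono fun α ↦ EReal.coe_le_coe_iff.2 (hle α)⟩
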